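/- Let $n\ge 2$ and let $\Omega\subset\mathbb R^n$ be a bounded domain (open, connected) with conical points $p_1,\dots,p_l\in\partial\Omega$ ($l\ge 0$) and no cracks. That is: $\partial\Omega=\partial\overline\Omega$; $\Omega_0:=\partial\Omega\setminus\{p_1,\dots,p_l\}$ is a smooth hypersurface; and for each $i$ there are an open neighbourhood $V_i$ of $p_i$, an open set $\omega_i\subsetneq S^{n-1}$ with smooth boundary $\partial\omega_i$ in $S^{n-1}$, and a diffeomorphism $\phi_i:V_i\to B^n$ onto the open unit ball with $\phi_i(p_i)=0$, $D\phi_i(p_i)=I$ and $\phi_i(\Omega\cap V_i)=\{ty:0<t<1,\ y\in\omega_i\}$, the closures $\overline{V_i}$ being pairwise disjoint. Fix $\epsilon_i\in(0,1)$. Let $\mathcal J'_i$ be the restriction to the units $[0,\epsilon_i)\times\partial\omega_i$ of the product of the transformation groupoid $[0,\infty)\rtimes(0,\infty)$ of dilations with the pair groupoid $(\partial\omega_i)^2$: its arrows are $(t,s,y_1,y_2)$ with $t,ts\in[0,\epsilon_i)$, $s>0$, $y_1,y_2\in\partial\omega_i$, with range $(t,y_1)$, domain $(ts,y_2)$ and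 product $(t,s,y_1,y_2)(ts,s',y_2,y_3)=(t,ss',y_1,y_3)$. Let $\mathcal G$ be obtained from $\coprod_i\mathcal J'_i$ and the pair groupoid $\Omega_0^2$ by identifying $(t,s,y_1,y_2)$, for $t>0$, with $(\phi_i^{-1}(ty_1),\phi_i^{-1}(tsy_2))$, and let $M$ be obtained from $\coprod_i[0,\epsilon_i)\times\partial\omega_i$ and $\Omega_0$ by identifying $(t,y)$, for $t>0$, with $\phi_i^{-1}(ty)$. Both carry the quotient topology, and the structure maps $\mathcal G\rightrightarrows M$ are those of the pieces. Write $\{p_i\}\times\partial\omega_i\subset M$ for the image of $\{0\}\times\partial\omega_i$. Then $M$ and $\mathcal G$ have smooth structures of manifolds with boundary, of dimensions $n-1$ and $2(n-1)$, for which the pieces are included diffeomorphically as open subsets, and with these $\mathcal G$ is a Lie groupoid with units $M$. Moreover $M=\partial'\Sigma(\Omega)$ in the following sense. Let $\psi_i$ be any functions, smooth on $\overline\Omega$, with $0\le\psi_i\le1$ on $\Omega$, $\psi_i=1$ on $\phi_i^{-1}(\{ty:0<t<\delta_i,\ y\in\omega_i\})$ for some $\delta_i\in(0,1)$ and $\psi_i=0$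 on $\Omega\setminus V_i$. Put $\Phi(x)=\bigl(x,\sum_i\psi_i(x)\,|x-p_i|^{-1}(x-p_i)\bigr)$, let $\Sigma(\Omega)\subset\mathbb R^{2n}$ be the closure of $\Phi(\Omega)$, and let $\partial'\Sigma(\Omega)$ be the closure of $\{z\in\Sigma(\Omega): z\text{ lies over }\Omega_0\}$ (the union of the hyperfaces not at infinity). Then there is a diffeomorphism of $M$ onto $\partial'\Sigma(\Omega)\subset\mathbb R^{2n}$ that equals $\Phi$ on $\Omega_0$ and sends the image of $(0,y)$, $y\in\partial\omega_i$, to $(p_i,y)$. Furthermore: 1. The interior $M_0$ of $M$ is $\Omega_0$, it is an invariant subset ($d^{-1}(M_0)=r^{-1}(M_0)$), and $\mathcal G_{M_0}\cong M_0\times M_0$ (pair groupoid) as Lie groupoids. 2. $\partial M=\bigcup_i\{p_i\}\times\partial\omega_i$; each $\{p_i\}\times\partial\omega_i$ and $\partial M$ are invariant subsets; and, as Lie groupoids, $$\mathcal G|_{\partial M}\cong\coprod_{i=1}^l(\partial\omega_i\times\partial\omega_i)\times(\mathbb R^+\times\{p_i\}),$$ where $\partial\omega_i\times\partial\omega_i$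 is the pair groupoid and $\mathbb R^+$ the multiplicative group of positive reals. 3. The Lie algebroid $A(\mathcal G)=\ker(d_*)|_M$, with anchor $r_*$ and the bracket of right invariant vector fields, is isomorphic as a Lie algebroid to the b-tangent bundle ${}^bTM$, the vector bundle whose smooth sections are the smooth vector fields on $M$ tangent to $\partial M$. -/

import Mathlib

open scoped Manifold ContDiff Topology
open Set Metric

noncomputable section

/-! ## Generalities on subsets of manifolds -/

/-- Euclidean space `ℝⁿ`. -/
abbrev Euc (n : ℕ) : Type := EuclideanSpace ℝ (Fin n)

section Subsets

variable {E : Type*} [NormedAddCommGroup E] [NormedSpace ℝ E]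
  {H : Type*} [TopologicalSpace H] (I : ModelWithCorners ℝ E H)
  {N : Type*} [TopologicalSpace N] [ChartedSpace H N]
  {E' : Type*} [NormedAddCommGroup E'] [NormedSpace ℝ E']
  {H' : Type*} [TopologicalSpace H'] (J : ModelWithCorners ℝ E' H')
  {N' : Type*} [TopologicalSpace N'] [ChartedSpace H' N']

/-- `S ⊆ N` is, near each of its points, a smooth hypersurface: the zero set of a smooth function
whose differential does not vanish. -/
def IsSmoothHypersurface (S : Set N) : Prop :=
  ∀ x ∈ S, ∃ U : Set N, IsOpen U ∧ x ∈ U ∧ ∃ f : N → ℝ,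
    ContMDiffOn I 𝓘(ℝ, ℝ) ∞ f U ∧ mfderiv I 𝓘(ℝ, ℝ) f x ≠ 0 ∧ S ∩ U = {y | y ∈ U ∧ f y = 0}

/-- `c` restricts to a diffeomorphism of the subset `S ⊆ N` onto the subset `X ⊆ N'`. Smoothness of
a map on a subset is local extendability to a smooth map of the ambient manifold (`ContMDiffOn`),
which for embedded submanifolds (with or without boundary) is smoothness on the submanifold. -/
structure IsDiffeoOn (S : Set N) (X : Set N') (c : N → N') : Prop where
  bijOn : BijOn c S X
  smooth : ContMDiffOn I J ∞ c S
  smooth_inv : ∀ x ∈ X, ∃ F : N' → N, (∀ s ∈ S, F (c s) = s) ∧ ContMDiffWithinAt J I ∞ F X x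

/-- `ι : X → N`, defined on a subset `X` of a manifold `N'`, is a diffeomorphism of `X` onto an open
subset of `N`. -/
def IsOpenDiffeo {X : Set N'} (ι : X → N) : Prop :=
  IsOpen (range ι) ∧ ∃ c : N → N', (∀ x : X, c (ι x) = x) ∧ IsDiffeoOn I J (range ι) X c

end Subsets

/-! ## Groupoids -/

/-- Structure maps of a groupoid with arrows `G` and units `M`: domain, range, unit, inverse, and
the product `mul g h = gh`, which is meaningful when `d g = r h` only. -/
structure GroupoidData (G M : Type*) where
  d : G → M
  r : G → M
  u : M → G
  inv : G → G
  mul : G → G → G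

namespace GroupoidData

/-- The pair groupoid `X × X ⇉ X`. -/
def pair (X : Type*) : GroupoidData (X × X) X where
  d g := g.2
  r g := g.1
  u x := (x, x)
  inv g := (g.2, g.1)
  mul g h := (g.1, h.2)

/-- The transformation groupoid of the action of dilations on the line; it is used on the subset
`[0, ∞) × (0, ∞)`. The arrow `(t, s)` has range `t` and domain `ts`. -/
def dilation : GroupoidData (ℝ × ℝ) ℝ where
  d g := g.1 * g.2
  r g := g.1
  u t := (t, 1)
  inv g := (g.1 * g.2, g.2⁻¹)
  mul g h := (g.1, g.2 * h.2)

/-- The multiplicative group `ℝ⁺` placed over each point `q` of a space: `ℝ⁺ × {q} ⇉ {q}`; it is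
used on the subset where the real coordinate is positive. -/
def multGroupOver (X : Type*) : GroupoidData (ℝ × X) X where
  d g := g.2
  r g := g.2
  u q := (1, q)
  inv g := (g.1⁻¹, g.2)
  mul g h := (g.1 * h.1, g.2)

/-- Product of two groupoids. -/
def prod {G M G' M' : Type*} (𝒢 : GroupoidData G M) (ℋ : GroupoidData G' M') :
    GroupoidData (G × G') (M × M') where
  d g := (𝒢.d g.1, ℋ.d g.2)
  r g := (𝒢.r g.1, ℋ.r g.2)
  u x := (𝒢.u x.1, ℋ.u x.2)
  inv g := (𝒢.inv g.1, ℋ.inv g.2)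
  mul g h := (𝒢.mul g.1 h.1, ℋ.mul g.2 h.2)

section Algebra

variable {G M : Type*} (𝒢 : GroupoidData G M)

/-- The groupoid laws. -/
structure IsGroupoid : Prop where
  d_unit : ∀ x, 𝒢.d (𝒢.u x) = x
  r_unit : ∀ x, 𝒢.r (𝒢.u x) = x
  d_mul : ∀ h g, 𝒢.d h = 𝒢.r g → 𝒢.d (𝒢.mul h g) = 𝒢.d g
  r_mul : ∀ h g, 𝒢.d h = 𝒢.r g → 𝒢.r (𝒢.mul h g) = 𝒢.r h
  assoc : ∀ k h g, 𝒢.d k = 𝒢.r h → 𝒢.d h = 𝒢.r g →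
    𝒢.mul k (𝒢.mul h g) = 𝒢.mul (𝒢.mul k h) g
  unit_mul : ∀ g, 𝒢.mul (𝒢.u (𝒢.r g)) g = g
  mul_unit : ∀ g, 𝒢.mul g (𝒢.u (𝒢.d g)) = g
  d_inv : ∀ g, 𝒢.d (𝒢.inv g) = 𝒢.r g
  r_inv : ∀ g, 𝒢.r (𝒢.inv g) = 𝒢.d g
  inv_mul : ∀ g, 𝒢.mul (𝒢.inv g) g = 𝒢.u (𝒢.d g)
  mul_inv : ∀ g, 𝒢.mul g (𝒢.inv g) = 𝒢.u (𝒢.r g)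

/-- A set of units is invariant if `d⁻¹(Y) = r⁻¹(Y)`. -/
def IsInvariant (Y : Set M) : Prop := 𝒢.d ⁻¹' Y = 𝒢.r ⁻¹' Y

end Algebra

section Smooth

variable {EM : Type*} [NormedAddCommGroup EM] [NormedSpace ℝ EM]
  {HM : Type*} [TopologicalSpace HM] (IM : ModelWithCorners ℝ EM HM)
  {M : Type*} [TopologicalSpace M] [ChartedSpace HM M]
  {EG : Type*} [NormedAddCommGroup EG] [NormedSpace ℝ EG]
  {HG : Type*} [TopologicalSpace HG] (IG : ModelWithCorners ℝ EG HG)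
  {G : Type*} [TopologicalSpace G] [ChartedSpace HG G]
  {EM' : Type*} [NormedAddCommGroup EM'] [NormedSpace ℝ EM']
  {HM' : Type*} [TopologicalSpace HM'] (IM' : ModelWithCorners ℝ EM' HM')
  {M' : Type*} [TopologicalSpace M'] [ChartedSpace HM' M']
  {EG' : Type*} [NormedAddCommGroup EG'] [NormedSpace ℝ EG']
  {HG' : Type*} [TopologicalSpace HG'] (IG' : ModelWithCorners ℝ EG' HG')
  {G' : Type*} [TopologicalSpace G'] [ChartedSpace HG' G']
  (𝒢 : GroupoidData G M)

/-- Lie groupoids, for manifolds with boundary. The product is smooth on the set of composable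
pairs. The domain map is a submersion of manifolds with boundary: its differential is onto, and it
sends boundary points, and no others, to boundary points (so that its fibres have no boundary). -/
structure IsLieGroupoid : Prop where
  isGroupoid : 𝒢.IsGroupoid
  manifold_units : IsManifold IM ∞ M
  manifold_arrows : IsManifold IG ∞ G
  secondCountable_units : SecondCountableTopology M
  secondCountable_arrows : SecondCountableTopology G
  smooth_d : ContMDiff IG IM ∞ 𝒢.d
  smooth_r : ContMDiff IG IM ∞ 𝒢.r
  smooth_u : ContMDiff IM IG ∞ 𝒢.u
  smooth_inv : ContMDiff IG IG ∞ 𝒢.inv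
  smooth_mul : ContMDiffOn (IG.prod IG) IG ∞ (fun p : G × G => 𝒢.mul p.1 p.2)
    {p | 𝒢.d p.1 = 𝒢.r p.2}
  submersion_d : ∀ g, Function.Surjective (mfderiv IG IM 𝒢.d g)
  boundary_d : ∀ g, IG.IsBoundaryPoint g ↔ IM.IsBoundaryPoint (𝒢.d g)
  hausdorff_units : T2Space M
  hausdorff_fibres : ∀ x : M, T2Space (𝒢.d ⁻¹' {x})

/-- `(c, c₀)` is an isomorphism of Lie groupoids from the restriction `𝒢_Y = d⁻¹(Y) ⇉ Y` of `𝒢` to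
an invariant set `Y` of units, onto the groupoid `X ⇉ Y'` whose structure maps are restrictions of
those of `ℋ`. -/
structure IsIsoOfRestriction (ℋ : GroupoidData G' M') (Y : Set M) (X : Set G') (Y' : Set M')
    (c : G → G') (c₀ : M → M') : Prop where
  diffeo_arrows : IsDiffeoOn IG IG' (𝒢.d ⁻¹' Y) X c
  diffeo_units : IsDiffeoOn IM IM' Y Y' c₀
  map_d : ∀ g ∈ 𝒢.d ⁻¹' Y, ℋ.d (c g) = c₀ (𝒢.d g)
  map_r : ∀ g ∈ 𝒢.d ⁻¹' Y, ℋ.r (c g) = c₀ (𝒢.r g)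
  map_u : ∀ x ∈ Y, c (𝒢.u x) = ℋ.u (c₀ x)
  map_inv : ∀ g ∈ 𝒢.d ⁻¹' Y, c (𝒢.inv g) = ℋ.inv (c g)
  map_mul : ∀ g ∈ 𝒢.d ⁻¹' Y, ∀ h ∈ 𝒢.d ⁻¹' Y, 𝒢.d g = 𝒢.r h →
    c (𝒢.mul g h) = ℋ.mul (c g) (c h)

/-! ### The Lie algebroid of a Lie groupoid -/

/-- The fibre at `x` of the Lie algebroid `A(𝒢) = ker d_* |_M`. -/
def algebroidFibre (x : M) : Submodule ℝ (TangentSpace IG (𝒢.u x)) :=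
  LinearMap.ker (mfderiv IG IM 𝒢.d (𝒢.u x)).toLinearMap

variable [IsManifold IG 1 G]

/-- Smoothness of a section of `A(𝒢) ⊆ T𝒢|_M`. -/
def IsSmoothAlgebroidSection (σ : ∀ x : M, 𝒢.algebroidFibre IM IG x) : Prop :=
  ContMDiff IM IG.tangent ∞
    (fun x => (⟨𝒢.u x, (σ x : TangentSpace IG (𝒢.u x))⟩ : TangentBundle IG G))

/-- Smooth `d`-vertical right invariant vector fields `X` on `𝒢`: for `d h = r g`, the differential
at `h` of right translation by `g`, from the fibre of `d` through `h` to the one through `g`, maps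
`X h` to `X (hg)`. -/
structure IsRightInvariantField (X : ∀ g : G, TangentSpace IG g) : Prop where
  smooth : ContMDiff IG IG.tangent ∞ (fun g => (⟨g, X g⟩ : TangentBundle IG G))
  vertical : ∀ g, mfderiv IG IM 𝒢.d g (X g) = 0
  invariant : ∀ h g, 𝒢.d h = 𝒢.r g →
    ∃ L : TangentSpace IG h →L[ℝ] TangentSpace IG (𝒢.mul h g),
      HasMFDerivWithinAt IG IG (fun k => 𝒢.mul k g) (𝒢.d ⁻¹' {𝒢.d h}) h L ∧
        L (X h) = X (𝒢.mul h g)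

/-- `ζ` is the Lie bracket of the sections `σ`, `τ` of `A(𝒢)`: the restriction to the units of the
bracket of the right invariant vector fields extending `σ` and `τ`. -/
def IsAlgebroidBracket (σ τ ζ : ∀ x : M, 𝒢.algebroidFibre IM IG x) : Prop :=
  ∃ X Y : ∀ g : G, TangentSpace IG g,
    𝒢.IsRightInvariantField IM IG X ∧ 𝒢.IsRightInvariantField IM IG Y ∧
    (∀ x, X (𝒢.u x) = σ x) ∧ (∀ x, Y (𝒢.u x) = τ x) ∧
    ∀ x, (ζ x : TangentSpace IG (𝒢.u x)) = VectorField.mlieBracket IG X Y (𝒢.u x)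

end Smooth

end GroupoidData

/-! ## The b-tangent bundle -/

section BTangent

variable {E : Type*} [NormedAddCommGroup E] [NormedSpace ℝ E]
  {H : Type*} [TopologicalSpace H] (I : ModelWithCorners ℝ E H)
  (M : Type*) [TopologicalSpace M] [ChartedSpace H M]

variable {M} in
/-- A tangent vector `v` at a boundary point `x` is tangent to the boundary if it annihilates all
germs of smooth functions vanishing on the boundary. -/
def IsTangentToBoundary (x : M) (v : TangentSpace I x) : Prop :=
  ∀ f : M → ℝ, ContMDiffAt I 𝓘(ℝ, ℝ) ∞ f x → (∀ᶠ y in 𝓝 x, y ∈ I.boundary M → f y = 0) →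
    mfderiv I 𝓘(ℝ, ℝ) f x v = 0

variable [IsManifold I 1 M]

/-- The space `𝒱_b` of smooth vector fields on `M` that are tangent to the boundary. -/
def bVectorFields : Submodule ℝ (∀ x : M, TangentSpace I x) where
  carrier := {V | ContMDiff I I.tangent ∞ (fun x => (⟨x, V x⟩ : TangentBundle I M)) ∧
    ∀ x ∈ I.boundary M, IsTangentToBoundary I x (V x)}
  zero_mem' := ⟨Bundle.contMDiff_zeroSection ℝ (TangentSpace I : M → Type _),
    fun _ _ f _ _ => map_zero (mfderiv I 𝓘(ℝ, ℝ) f _)⟩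
  add_mem' := fun {V W} hV hW => ⟨hV.1.add_section hW.1, fun x hx f hf h0 => by
    have h1 := hV.2 x hx f hf h0
    have h2 := hW.2 x hx f hf h0
    rw [Pi.add_apply, map_add, h1, h2, add_zero]⟩
  smul_mem' := fun a V hV => ⟨hV.1.const_smul_section, fun x hx f hf h0 => by
    have h1 := hV.2 x hx f hf h0
    rw [Pi.smul_apply, map_smul, h1, smul_zero]⟩

/-- The subspace `I_x 𝒱_b` of `𝒱_b`, with `I_x` the ideal of smooth functions vanishing at `x`. -/
def bVanishing (x : M) : Submodule ℝ (bVectorFields I M) :=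
  Submodule.span ℝ {W | ∃ f : M → ℝ, ContMDiff I 𝓘(ℝ, ℝ) ∞ f ∧ f x = 0 ∧
    ∃ V : bVectorFields I M, ∀ y, W.1 y = f y • V.1 y}

variable {M}

/-- The fibre `𝒱_b / I_x 𝒱_b` at `x` of the b-tangent bundle, the vector bundle whose module of
smooth sections is `𝒱_b`. -/
abbrev bTangentFibre (x : M) : Type _ := bVectorFields I M ⧸ bVanishing I M x

/-- The value at `x` of `V ∈ 𝒱_b`, as a section of the b-tangent bundle. -/
def bValue (V : bVectorFields I M) (x : M) : bTangentFibre I x := (bVanishing I M x).mkQ V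

/-- The smooth sections of the b-tangent bundle. -/
def IsSmoothBSection (τ : ∀ x : M, bTangentFibre I x) : Prop :=
  ∃ V : bVectorFields I M, ∀ x, τ x = bValue I V x

/-- The natural map from the b-tangent bundle to the tangent bundle. -/
def bAnchor (x : M) : bTangentFibre I x →ₗ[ℝ] TangentSpace I x :=
  (bVanishing I M x).liftQ ((LinearMap.proj x).comp (bVectorFields I M).subtype) (by
    refine Submodule.span_le.2 ?_
    rintro W ⟨f, -, hf, V, hW⟩
    simp [hW x, hf])

end BTangent

section AlgebroidIso

variable {EM : Type*} [NormedAddCommGroup EM] [NormedSpace ℝ EM]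
  {HM : Type*} [TopologicalSpace HM] (IM : ModelWithCorners ℝ EM HM)
  {M : Type*} [TopologicalSpace M] [ChartedSpace HM M] [IsManifold IM 1 M]
  {EG : Type*} [NormedAddCommGroup EG] [NormedSpace ℝ EG]
  {HG : Type*} [TopologicalSpace HG] (IG : ModelWithCorners ℝ EG HG)
  {G : Type*} [TopologicalSpace G] [ChartedSpace HG G] [IsManifold IG 1 G]

/-- The fibrewise linear isomorphisms `θ` form an isomorphism of Lie algebroids from `A(𝒢)` to the
b-tangent bundle of `M`: they match the smooth sections (so that `θ` is an isomorphism of smooth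
vector bundles), the anchors (`r_*` for `A(𝒢)`), and the Lie brackets of smooth sections. That the
brackets are defined on all pairs of smooth sections is part of the assertion. -/
structure IsAlgebroidIsoToBTangent (𝒢 : GroupoidData G M)
    (θ : ∀ x : M, 𝒢.algebroidFibre IM IG x ≃ₗ[ℝ] bTangentFibre IM x) : Prop where
  smooth_iff : ∀ σ : ∀ x : M, 𝒢.algebroidFibre IM IG x,
    𝒢.IsSmoothAlgebroidSection IM IG σ ↔ IsSmoothBSection IM (fun x => θ x (σ x))
  anchor : ∀ (x : M) (a : 𝒢.algebroidFibre IM IG x),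
    (⟨𝒢.r (𝒢.u x), mfderiv IG IM 𝒢.r (𝒢.u x) a⟩ : TangentBundle IM M) =
      ⟨x, bAnchor IM x (θ x a)⟩
  extension : ∀ σ : ∀ x : M, 𝒢.algebroidFibre IM IG x, 𝒢.IsSmoothAlgebroidSection IM IG σ →
    ∃! X : ∀ g : G, TangentSpace IG g,
      𝒢.IsRightInvariantField IM IG X ∧ ∀ x, X (𝒢.u x) = σ x
  bracket_exists : ∀ σ τ : ∀ x : M, 𝒢.algebroidFibre IM IG x,
    𝒢.IsSmoothAlgebroidSection IM IG σ → 𝒢.IsSmoothAlgebroidSection IM IG τ →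
    ∃! ζ, 𝒢.IsAlgebroidBracket IM IG σ τ ζ
  bracket_smooth : ∀ σ τ ζ, 𝒢.IsAlgebroidBracket IM IG σ τ ζ →
    𝒢.IsSmoothAlgebroidSection IM IG ζ
  bracket : ∀ σ τ ζ, 𝒢.IsAlgebroidBracket IM IG σ τ ζ → ∀ V W : bVectorFields IM M,
    (∀ x, θ x (σ x) = bValue IM V x) → (∀ x, θ x (τ x) = bValue IM W x) →
    ∃ U : bVectorFields IM M, (∀ x, U.1 x = VectorField.mlieBracket IM V.1 W.1 x) ∧
      ∀ x, θ x (ζ x) = bValue IM U x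

end AlgebroidIso

/-! ## Domains with conical points -/

/-- A bounded domain `Ω ⊆ ℝⁿ`, `n = m + 2`, with conical points `p i` and no cracks, together with
the data entering the construction of its boundary groupoid: the bases `base i` of the local cones,
the diffeomorphisms `φ i` from the neighbourhoods `V i = (φ i).source` of the conical points to the
unit ball, and the sizes `ε i` of the glued collars. -/
structure ConicalDomain (m : ℕ) where
  Ω : Set (Euc (m + 2))
  isOpen_Ω : IsOpen Ω
  isConnected_Ω : IsConnected Ω
  isBounded_Ω : Bornology.IsBounded Ω
  no_cracks : frontier Ω = frontier (closure Ω)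
  l : ℕ
  p : Fin l → Euc (m + 2)
  p_mem : ∀ i, p i ∈ frontier Ω
  smooth_boundary : IsSmoothHypersurface 𝓘(ℝ, Euc (m + 2)) (frontier Ω \ range p)
  base : Fin l → Set (sphere (0 : Euc (m + 2)) 1)
  isOpen_base : ∀ i, IsOpen (base i)
  base_ne_univ : ∀ i, base i ≠ univ
  smooth_boundary_base : ∀ i, IsSmoothHypersurface (𝓡 (m + 1)) (frontier (base i))
  φ : Fin l → OpenPartialHomeomorph (Euc (m + 2)) (Euc (m + 2))
  p_mem_source : ∀ i, p i ∈ (φ i).source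
  target_φ : ∀ i, (φ i).target = ball 0 1
  smooth_φ : ∀ i, ContDiffOn ℝ ∞ (φ i) (φ i).source
  smooth_φ_symm : ∀ i, ContDiffOn ℝ ∞ (φ i).symm (φ i).target
  φ_p : ∀ i, φ i (p i) = 0
  fderiv_φ : ∀ i, HasFDerivAt (φ i) (ContinuousLinearMap.id ℝ (Euc (m + 2))) (p i)
  image_φ : ∀ i, φ i '' (Ω ∩ (φ i).source) =
    {z | ∃ t ∈ Ioo (0 : ℝ) 1, ∃ y ∈ base i, z = t • (y : Euc (m + 2))}
  disjoint_V : ∀ i j, i ≠ j → Disjoint (closure (φ i).source) (closure (φ j).source)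
  ε : Fin l → ℝ
  ε_mem : ∀ i, ε i ∈ Ioo (0 : ℝ) 1

namespace ConicalDomain

variable {m : ℕ} (D : ConicalDomain m)

/-- The smooth part `Ω₀` of the boundary. -/
def Ω₀ : Set (Euc (m + 2)) := frontier D.Ω \ range D.p

/-- `∂ω_i`, the boundary being taken in the sphere, as a subset of `ℝⁿ`. -/
def bdω (i : Fin D.l) : Set (Euc (m + 2)) := (↑) '' frontier (D.base i)

/-! ### Desingularization -/

/-- The cutoff functions `ψ_i` used in the desingularization. -/
structure IsCutoff (ψ : Fin D.l → Euc (m + 2) → ℝ) : Prop where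
  smooth : ∀ i, ContDiffOn ℝ ∞ (ψ i) (closure D.Ω)
  mem_Icc : ∀ i, ∀ x ∈ D.Ω, ψ i x ∈ Icc (0 : ℝ) 1
  eq_one : ∀ i, ∃ δ ∈ Ioo (0 : ℝ) 1, ∀ t ∈ Ioo (0 : ℝ) δ, ∀ y ∈ D.base i,
    ψ i ((D.φ i).symm (t • (y : Euc (m + 2)))) = 1
  eq_zero : ∀ i, ∀ x ∈ D.Ω, x ∉ (D.φ i).source → ψ i x = 0

/-- `Φ(x) = (x, ∑ ψ_i(x) (x - p_i) / |x - p_i|)`. -/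
def Φ (ψ : Fin D.l → Euc (m + 2) → ℝ) (x : Euc (m + 2)) : Euc (m + 2) × Euc (m + 2) :=
  (x, ∑ i, ψ i x • ‖x - D.p i‖⁻¹ • (x - D.p i))

/-- The desingularization `Σ(Ω)`, a subset of `ℝ²ⁿ`; the desingularization map `κ` is the first
projection. -/
def desing (ψ : Fin D.l → Euc (m + 2) → ℝ) : Set (Euc (m + 2) × Euc (m + 2)) :=
  closure (D.Φ ψ '' D.Ω)

/-- `∂'Σ(Ω)`, the union of the hyperfaces of `Σ(Ω)` that are not at infinity: the closure of the
part of `Σ(Ω)` lying over the smooth part of `∂Ω`. -/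
def desingBoundary (ψ : Fin D.l → Euc (m + 2) → ℝ) : Set (Euc (m + 2) × Euc (m + 2)) :=
  closure {z | z ∈ D.desing ψ ∧ z.1 ∈ D.Ω₀}

/-! ### The glued space of units -/

/-- `[0, ε_i) × ∂ω_i`. -/
def unitCollar (i : Fin D.l) : Set (ℝ × Euc (m + 2)) := Ico 0 (D.ε i) ×ˢ D.bdω i

/-- Gluing relation: `(t, y)` with `t > 0` is glued to `φ_i⁻¹(ty)`. -/
inductive UnitRel : (Σ i, D.unitCollar i) ⊕ D.Ω₀ → (Σ i, D.unitCollar i) ⊕ D.Ω₀ → Prop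
  | glue (i : Fin D.l) (z : D.unitCollar i) (x : D.Ω₀) (ht : 0 < z.1.1)
      (hx : (x : Euc (m + 2)) = (D.φ i).symm (z.1.1 • z.1.2)) :
      UnitRel (Sum.inl ⟨i, z⟩) (Sum.inr x)

/-- The space of units `M = (∐ [0, ε_i) × ∂ω_i) ∪ Ω₀`. -/
def Units : Type := Quot D.UnitRel

instance : TopologicalSpace D.Units := inferInstanceAs (TopologicalSpace (Quot D.UnitRel))

/-- The canonical map `[0, ε_i) × ∂ω_i → M`. -/
def unitsOfCollar (i : Fin D.l) (z : D.unitCollar i) : D.Units :=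
  Quot.mk _ (Sum.inl ⟨i, z⟩)

/-- The canonical map `Ω₀ → M`. -/
def unitsOfSmooth (x : D.Ω₀) : D.Units := Quot.mk _ (Sum.inr x)

lemma zero_mem_unitCollar (i : Fin D.l) (y : D.bdω i) :
    ((0 : ℝ), (y : Euc (m + 2))) ∈ D.unitCollar i := ⟨⟨le_rfl, (D.ε_mem i).1⟩, y.2⟩

/-- The point `(p_i, y)`, `y ∈ ∂ω_i`, of `M`, that is, `(0, y)` in the collar at `p_i`. -/
def tip (i : Fin D.l) (y : D.bdω i) : D.Units :=
  D.unitsOfCollar i ⟨(0, y), D.zero_mem_unitCollar i y⟩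

/-! ### The glued space of arrows -/

/-- The product of the transformation groupoid of dilations with the pair groupoid. -/
def coneGroupoid (m : ℕ) :
    GroupoidData ((ℝ × ℝ) × (Euc (m + 2) × Euc (m + 2))) (ℝ × Euc (m + 2)) :=
  GroupoidData.dilation.prod (GroupoidData.pair (Euc (m + 2)))

/-- The arrows `𝒥'_i` of `([0, ∞) ⋊ (0, ∞)) × (∂ω_i)²` with domain and range in
`[0, ε_i) × ∂ω_i`. -/
def arrowCollar (i : Fin D.l) : Set ((ℝ × ℝ) × (Euc (m + 2) × Euc (m + 2))) :=
  {g | 0 < g.1.2 ∧ (coneGroupoid m).d g ∈ D.unitCollar i ∧ (coneGroupoid m).r g ∈ D.unitCollar i}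

/-- Gluing relation: `(t, s, y₁, y₂)` with `t > 0` is glued to `(φ_i⁻¹(t y₁), φ_i⁻¹(ts y₂))`. -/
inductive ArrowRel : (Σ i, D.arrowCollar i) ⊕ (D.Ω₀ × D.Ω₀) →
    (Σ i, D.arrowCollar i) ⊕ (D.Ω₀ × D.Ω₀) → Prop
  | glue (i : Fin D.l) (g : D.arrowCollar i) (x : D.Ω₀ × D.Ω₀) (ht : 0 < g.1.1.1)
      (h₁ : (x.1 : Euc (m + 2)) = (D.φ i).symm (g.1.1.1 • g.1.2.1))
      (h₂ : (x.2 : Euc (m + 2)) = (D.φ i).symm ((g.1.1.1 * g.1.1.2) • g.1.2.2)) :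
      ArrowRel (Sum.inl ⟨i, g⟩) (Sum.inr x)

/-- The arrows of the boundary groupoid: `𝒢 = (∐ 𝒥'_i) ∪ Ω₀²`. -/
def Arrows : Type := Quot D.ArrowRel

instance : TopologicalSpace D.Arrows := inferInstanceAs (TopologicalSpace (Quot D.ArrowRel))

/-- The canonical map `𝒥'_i → 𝒢`. -/
def arrowsOfCollar (i : Fin D.l) (g : D.arrowCollar i) : D.Arrows :=
  Quot.mk _ (Sum.inl ⟨i, g⟩)

/-- The canonical map `Ω₀² → 𝒢`. -/
def arrowsOfPair (x : D.Ω₀ × D.Ω₀) : D.Arrows := Quot.mk _ (Sum.inr x)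

/-- The canonical map `Ω₀² → 𝒢`, with `Ω₀²` as a subset of `ℝⁿ × ℝⁿ`. -/
def arrowsOfSmooth (x : D.Ω₀ ×ˢ D.Ω₀) : D.Arrows :=
  D.arrowsOfPair (⟨x.1.1, x.2.1⟩, ⟨x.1.2, x.2.2⟩)

/-- Domain: induced by the domain maps of the pieces. -/
def dom : D.Arrows → D.Units :=
  Quot.lift
    (Sum.elim (fun g => D.unitsOfCollar g.1 ⟨(coneGroupoid m).d g.2.1, g.2.2.2.1⟩)
      (fun x => D.unitsOfSmooth x.2))
    (by
      rintro _ _ ⟨i, g, x, ht, h₁, h₂⟩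
      exact Quot.sound (UnitRel.glue i _ x.2 (mul_pos ht g.2.1) h₂))

/-- Range: induced by the range maps of the pieces. -/
def ran : D.Arrows → D.Units :=
  Quot.lift
    (Sum.elim (fun g => D.unitsOfCollar g.1 ⟨(coneGroupoid m).r g.2.1, g.2.2.2.2⟩)
      (fun x => D.unitsOfSmooth x.1))
    (by
      rintro _ _ ⟨i, g, x, ht, h₁, h₂⟩
      exact Quot.sound (UnitRel.glue i _ x.1 ht h₁))

lemma unit_mem_arrowCollar (i : Fin D.l) (z : D.unitCollar i) :
    (coneGroupoid m).u z.1 ∈ D.arrowCollar i := by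
  have h : (coneGroupoid m).d ((coneGroupoid m).u z.1) = z.1 := by
    simp [coneGroupoid, GroupoidData.prod, GroupoidData.dilation, GroupoidData.pair]
  refine ⟨one_pos, ?_, z.2⟩
  rw [h]
  exact z.2

/-- Units: induced by the unit maps of the pieces. -/
def unit : D.Units → D.Arrows :=
  Quot.lift
    (Sum.elim (fun z => D.arrowsOfCollar z.1 ⟨_, D.unit_mem_arrowCollar z.1 z.2⟩)
      (fun x => D.arrowsOfPair (x, x)))
    (by
      rintro _ _ ⟨i, z, x, ht, hx⟩
      refine Quot.sound (ArrowRel.glue i _ (x, x) ht hx ?_)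
      simpa [coneGroupoid, GroupoidData.prod, GroupoidData.dilation, GroupoidData.pair] using hx)

lemma inv_mem_arrowCollar (i : Fin D.l) (g : D.arrowCollar i) :
    (coneGroupoid m).inv g.1 ∈ D.arrowCollar i := by
  have hs : g.1.1.2 ≠ 0 := g.2.1.ne'
  have h : (coneGroupoid m).d ((coneGroupoid m).inv g.1) = (coneGroupoid m).r g.1 := by
    simp [coneGroupoid, GroupoidData.prod, GroupoidData.dilation, GroupoidData.pair, hs]
  refine ⟨inv_pos.2 g.2.1, ?_, g.2.2.1⟩
  rw [h]
  exact g.2.2.2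

/-- Inversion: induced by the inversions of the pieces. -/
def inversion : D.Arrows → D.Arrows :=
  Quot.lift
    (Sum.elim (fun g => D.arrowsOfCollar g.1 ⟨_, D.inv_mem_arrowCollar g.1 g.2⟩)
      (fun x => D.arrowsOfPair (x.2, x.1)))
    (by
      rintro _ _ ⟨i, g, x, ht, h₁, h₂⟩
      refine Quot.sound (ArrowRel.glue i _ (x.2, x.1) (mul_pos ht g.2.1) h₂ ?_)
      have hs : g.1.1.2 ≠ 0 := g.2.1.ne'
      simpa [coneGroupoid, GroupoidData.prod, GroupoidData.dilation, GroupoidData.pair, hs]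
        using h₁)

/-- The graph of the product of `𝒢`: the union of the graphs of the products of the pieces. -/
inductive MulRel : D.Arrows → D.Arrows → D.Arrows → Prop
  | collar (i : Fin D.l) (g h k : D.arrowCollar i)
      (hgh : (coneGroupoid m).d g.1 = (coneGroupoid m).r h.1)
      (hk : k.1 = (coneGroupoid m).mul g.1 h.1) :
      MulRel (D.arrowsOfCollar i g) (D.arrowsOfCollar i h) (D.arrowsOfCollar i k)
  | smooth (x y z : D.Ω₀) :
      MulRel (D.arrowsOfPair (x, y)) (D.arrowsOfPair (y, z)) (D.arrowsOfPair (x, z))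

open Classical in
/-- The product `gh`: the arrow given by the pieces (an irrelevant value if there is none). -/
def mul (g h : D.Arrows) : D.Arrows := if H : ∃ k, D.MulRel g h k then H.choose else g

/-- The boundary groupoid `𝒢 ⇉ M` of the conical domain. -/
def groupoid : GroupoidData D.Arrows D.Units where
  d := D.dom
  r := D.ran
  u := D.unit
  inv := D.inversion
  mul := D.mul

/-! ### Statements about the glued objects -/

section Structures

variable [ChartedSpace (EuclideanHalfSpace (m + 1)) D.Units]
  [ChartedSpace (EuclideanHalfSpace (2 * m + 2)) D.Arrows]

/-- The smooth structures on `M` and `𝒢` are the glued ones: the canonical maps from the pieces are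
diffeomorphisms onto open subsets. As the images cover, this determines the smooth structures. The
product of `𝒢` extends that of each piece. -/
structure IsGlued : Prop where
  units_collar : ∀ i, IsOpenDiffeo (𝓡∂ (m + 1)) 𝓘(ℝ, ℝ × Euc (m + 2)) (D.unitsOfCollar i)
  units_smooth : IsOpenDiffeo (𝓡∂ (m + 1)) 𝓘(ℝ, Euc (m + 2)) D.unitsOfSmooth
  arrows_collar : ∀ i, IsOpenDiffeo (𝓡∂ (2 * m + 2))
    𝓘(ℝ, (ℝ × ℝ) × (Euc (m + 2) × Euc (m + 2))) (D.arrowsOfCollar i)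
  arrows_smooth : IsOpenDiffeo (𝓡∂ (2 * m + 2)) 𝓘(ℝ, Euc (m + 2) × Euc (m + 2)) D.arrowsOfSmooth
  mul_eq : ∀ g h k, D.MulRel g h k → D.mul g h = k

end Structures

end ConicalDomain

end

/-! Near `p_i` write `φ_i(x) = t y` with `t = |φ_i(x)|`. Cutoff functions extend the direction `y`
and the radius `t` to smooth functions on the complement of the conical points, with positive
radius. A unit is recorded by its position, direction and radius (`unitEmb`); a tip `(p_i, y)`
becomes `(p_i, y, 0)`, and the radius `ρ` is a boundary defining function. An arrow is recorded by
its range, its domain and a number `s > 0` (`arrowEmb`): over the interior `s = ρ(d)/ρ(r)`, over the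
boundary `s` is the dilation parameter. In all cases `ρ(d) = s ρ(r)`, and `s` is multiplicative.

Both maps are topological embeddings in a normed space, and their images have local parametrizations
by half spaces with inverses smooth on open sets of the ambient space. These parametrizations are
the charts, so smoothness of a map into `M` or `𝒢`, and equality of tangent vectors, can be checked
in the ambient coordinates (`IsPatchEmbedding`). The groupoid laws hold because an arrow is
determined by `(r, d, s)`; the structure maps are smooth because they are explicit in these terms.
Differentiating `ρ(d) = s ρ(r)` and counting dimensions gives the tangent space of `𝒢` at `g`: all
`(v₁, v₂, a)` with `dρ(v₂) = s dρ(v₁) + a ρ(r)` (`exists_tangent`). In particular `d` is a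
submersion.

At a unit the kernel of `d_*` consists of the pairs `(v, a)` with `dρ(v) = -aρ`. The b-tangent
bundle has the same fibre: a smooth field `V` tangent to the boundary satisfies `Vρ = -fρ` with `f`
smooth, by Hadamard's lemma, and `V ↦ (V(x), f(x))` has kernel exactly `I_x 𝒱_b` (`bIso`). The right
invariant field belonging to `V` has components `(V ∘ r, 0, (f ∘ r) s)`. Bracketing two such fields
gives the factor `Vw - Wf`, which is also the factor of `[V, W]`; so the brackets agree.

For `∂'Σ(Ω)`, since `Dφ_i(p_i) = I` there are smooth matrices `A(x)`, equal to `I` at `p_i`, with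
`φ_i(x) = A(x)(x - p_i)`, and likewise in the other direction. Hence the directions of `φ_i(x)` and
of `x - p_i` are smooth functions of each other up to the tips, where they coincide. -/

noncomputable section

/-! ## Submanifolds with boundary of a normed space -/

section Patches

variable {E : Type*} [NormedAddCommGroup E] [NormedSpace ℝ E] {N : Type*}

/-- A local parametrization, near `x`, of the image of `c : N → E` by the half space `0 ≤ ℓ` of
`P`, with a smooth inverse defined on an open subset of `E`. The boundary is `{ρ = 0}`, and the
function `ρ` equals `ℓ` in the parametrization if `x` lies on the boundary. -/
structure HalfPatch {P : Type*} [NormedAddCommGroup P] [NormedSpace ℝ P] (c : N → E) (ρ : N → ℝ)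
    (ℓ : P →L[ℝ] ℝ) (x : N) where
  O : Set E
  W : Set P
  F : E → P
  G : P → E
  isOpen_O : IsOpen O
  isOpen_W : IsOpen W
  mem_O : c x ∈ O
  smooth_F : ContDiffOn ℝ ∞ F O
  smooth_G : ContDiffOn ℝ ∞ G W
  map_F : ∀ y, c y ∈ O → F (c y) ∈ W
  nonneg : ∀ y, c y ∈ O → 0 ≤ ℓ (F (c y))
  zero_iff : ∀ y, c y ∈ O → (ℓ (F (c y)) = 0 ↔ ρ y = 0)
  eq_rho : ρ x = 0 → ∀ y, c y ∈ O → ℓ (F (c y)) = ρ y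
  left_inv : ∀ y, c y ∈ O → G (F (c y)) = c y
  exists_param : ∀ z ∈ W, 0 ≤ ℓ z → ∃ y, c y = G z ∧ c y ∈ O ∧ F (G z) = z

/-- A local parametrization, near `x`, of the image of `c : N → E` by an open subset of `P`, with a
smooth inverse defined on an open subset of `E`. -/
structure FlatPatch (P : Type*) [NormedAddCommGroup P] [NormedSpace ℝ P] (c : N → E) (x : N) where
  O : Set E
  W : Set P
  F : E → P
  G : P → E
  isOpen_O : IsOpen O
  isOpen_W : IsOpen W
  mem_O : c x ∈ O
  smooth_F : ContDiffOn ℝ ∞ F O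
  smooth_G : ContDiffOn ℝ ∞ G W
  map_F : ∀ y, c y ∈ O → F (c y) ∈ W
  left_inv : ∀ y, c y ∈ O → G (F (c y)) = c y
  exists_param : ∀ z ∈ W, ∃ y, c y = G z ∧ c y ∈ O ∧ F (G z) = z

variable {P : Type*} [NormedAddCommGroup P] [NormedSpace ℝ P]
  {P' : Type*} [NormedAddCommGroup P'] [NormedSpace ℝ P']
  {c : N → E} {ρ : N → ℝ} {x : N}

/-- Change of the model space of a patch by a linear isomorphism. -/
def HalfPatch.congr {ℓ : P →L[ℝ] ℝ} (p : HalfPatch c ρ ℓ x) (ℓ' : P' →L[ℝ] ℝ) (L : P ≃L[ℝ] P')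
    (hL : ∀ z, ℓ' (L z) = ℓ z) : HalfPatch c ρ ℓ' x where
  O := p.O
  W := L.symm ⁻¹' p.W
  F := L ∘ p.F
  G := p.G ∘ L.symm
  isOpen_O := p.isOpen_O
  isOpen_W := p.isOpen_W.preimage L.symm.continuous
  mem_O := p.mem_O
  smooth_F := L.contDiff.comp_contDiffOn p.smooth_F
  smooth_G := p.smooth_G.comp L.symm.contDiff.contDiffOn (fun _ h => h)
  map_F y hy := by simpa using p.map_F y hy
  nonneg y hy := by simpa [hL] using p.nonneg y hy
  zero_iff y hy := by simpa [hL] using p.zero_iff y hy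
  eq_rho hx y hy := by simpa [hL] using p.eq_rho hx y hy
  left_inv y hy := by simpa using p.left_inv y hy
  exists_param z hz h0 := by
    obtain ⟨y, h1, h2, h3⟩ := p.exists_param (L.symm z) hz (by rw [← hL]; simpa using h0)
    exact ⟨y, h1, h2, by simp [h3]⟩

/-- A patch without boundary, placed in the interior of a half space. -/
def FlatPatch.toHalfPatch (p : FlatPatch P c x) (ℓ : P →L[ℝ] ℝ) (v : P) (hv : ℓ v = 1)
    (hρ : ∀ y, c y ∈ p.O → ρ y ≠ 0) : HalfPatch c ρ ℓ x where
  -- The patch is translated so that `c x` goes to `v`, where `ℓ = 1`, and is cut down to the points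
  -- where `ℓ` remains positive.
  O := p.O ∩ p.F ⁻¹' {z | ℓ (p.F (c x)) - 1 < ℓ z}
  W := {z | z + (p.F (c x) - v) ∈ p.W ∧ (ℓ (p.F (c x)) - 1 < ℓ (z + (p.F (c x) - v)))}
  F y := p.F y - (p.F (c x) - v)
  G z := p.G (z + (p.F (c x) - v))
  isOpen_O := p.smooth_F.continuousOn.isOpen_inter_preimage p.isOpen_O
    (isOpen_lt continuous_const ℓ.continuous)
  isOpen_W := by
    exact (p.isOpen_W.preimage (by fun_prop)).inter (isOpen_lt continuous_const (ℓ.continuous.comp (continuous_id.add continuous_const)))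
  mem_O := ⟨p.mem_O, by simp⟩
  smooth_F := (p.smooth_F.sub contDiffOn_const).mono inter_subset_left
  smooth_G := p.smooth_G.comp (by fun_prop) (fun z hz => hz.1)
  map_F y hy := by
    have := p.map_F y hy.1
    have h2 : ℓ (p.F (c x)) - 1 < ℓ (p.F (c y)) := hy.2
    simpa using ⟨this, h2⟩
  nonneg y hy := by
    have h2 : ℓ (p.F (c x)) - 1 < ℓ (p.F (c y)) := hy.2
    simp only [map_sub, hv]; linarith
  zero_iff y hy := by
    have h2 : ℓ (p.F (c x)) - 1 < ℓ (p.F (c y)) := hy.2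
    refine iff_of_false ?_ (hρ y hy.1)
    simp only [map_sub, hv]; intro h; linarith
  eq_rho hx := absurd hx (hρ x p.mem_O)
  left_inv y hy := by simpa using p.left_inv y hy.1
  exists_param z hz h0 := by
    obtain ⟨y, h1, h2, h3⟩ := p.exists_param _ hz.1
    refine ⟨y, h1, ⟨h2, ?_⟩, by simp [h3]⟩
    rw [h1, mem_preimage, h3]; exact hz.2

/-! ### The manifold structure given by patches -/

/-- The first coordinate of `ℝᵈ`. -/
abbrev firstCoord (d : ℕ) [NeZero d] : EuclideanSpace ℝ (Fin d) →L[ℝ] ℝ := EuclideanSpace.proj 0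

variable {d : ℕ} [NeZero d]

open Classical in
/-- The inverse of a patch, as a map to `N`. -/
def HalfPatch.param (p : HalfPatch c ρ (firstCoord d) x) (z : EuclideanSpace ℝ (Fin d)) : N :=
  -- The default `x` is taken only off the part of `W` in the half space, where the chart never
  -- evaluates the inverse.
  if h : ∃ y, c y = p.G z ∧ c y ∈ p.O ∧ p.F (p.G z) = z then h.choose else x

lemma HalfPatch.param_spec (p : HalfPatch c ρ (firstCoord d) x) {z : EuclideanSpace ℝ (Fin d)}
    (hz : z ∈ p.W) (h0 : 0 ≤ z 0) :
    c (p.param z) = p.G z ∧ c (p.param z) ∈ p.O ∧ p.F (p.G z) = z := by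
  have h := p.exists_param z hz h0
  rw [HalfPatch.param, dif_pos h]
  exact h.choose_spec

variable [TopologicalSpace N]

/-- The chart of `N` with values in the half space given by a patch. -/
def HalfPatch.chart (p : HalfPatch c ρ (firstCoord d) x) (hc : Topology.IsEmbedding c) :
    OpenPartialHomeomorph N (EuclideanHalfSpace d) where
  toFun y := (𝓡∂ d).symm (p.F (c y))
  invFun z := p.param z.1
  source := c ⁻¹' p.O
  target := {z | z.1 ∈ p.W}
  map_source' y hy := by
    have h0 : 0 ≤ (p.F (c y)) 0 := p.nonneg y hy
    have : ((𝓡∂ d).symm (p.F (c y))).1 = p.F (c y) :=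
      (𝓡∂ d).right_inv (by rw [range_modelWithCornersEuclideanHalfSpace]; exact h0)
    rw [mem_ofPred_eq, this]
    exact p.map_F y hy
  map_target' z hz := (p.param_spec hz z.2).2.1
  left_inv' y hy := by
    have h0 : 0 ≤ (p.F (c y)) 0 := p.nonneg y hy
    have : ((𝓡∂ d).symm (p.F (c y))).1 = p.F (c y) :=
      (𝓡∂ d).right_inv (by rw [range_modelWithCornersEuclideanHalfSpace]; exact h0)
    rw [this]
    apply hc.injective
    rw [(p.param_spec (p.map_F y hy) h0).1, p.left_inv y hy]
  right_inv' z hz := by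
    have := p.param_spec hz z.2
    rw [this.1, this.2.2]
    exact (𝓡∂ d).left_inv z
  open_source := p.isOpen_O.preimage hc.continuous
  open_target := p.isOpen_W.preimage continuous_subtype_val
  continuousOn_toFun := (𝓡∂ d).continuous_symm.comp_continuousOn
    (p.smooth_F.continuousOn.comp hc.continuous.continuousOn (fun _ h => h))
  continuousOn_invFun := by
    rw [hc.isInducing.continuousOn_iff]
    have h : ContinuousOn (fun z : EuclideanHalfSpace d => p.G z.1) {z | z.1 ∈ p.W} :=
      p.smooth_G.continuousOn.comp continuous_subtype_val.continuousOn (fun _ h => h)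
    exact h.congr fun z hz => (p.param_spec hz z.2).1

/-- The smooth structure given by a family of patches. -/
abbrev patchChartedSpace (hc : Topology.IsEmbedding c) (hp : ∀ x, HalfPatch c ρ (firstCoord d) x) :
    ChartedSpace (EuclideanHalfSpace d) N where
  atlas := range fun x => (hp x).chart hc
  chartAt x := (hp x).chart hc
  mem_chart_source x := (hp x).mem_O
  chart_mem_atlas x := mem_range_self x

/-- A transition map is the restriction to the half space of `(hp y).F ∘ (hp x).G`. Both factors are
smooth on open sets of normed spaces, so no smoothness up to the boundary has to be proved. -/
lemma isManifold_patchChartedSpace (hc : Topology.IsEmbedding c)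
    (hp : ∀ x, HalfPatch c ρ (firstCoord d) x) :
    let := patchChartedSpace hc hp
    IsManifold (𝓡∂ d) ∞ N := by
  let := patchChartedSpace hc hp
  apply isManifold_of_contDiffOn
  rintro _ _ ⟨x, rfl⟩ ⟨y, rfl⟩
  have key : ∀ z ∈ (𝓡∂ d).symm ⁻¹' (((hp x).chart hc).symm ≫ₕ (hp y).chart hc).source ∩
      range (𝓡∂ d), z ∈ (hp x).W ∧ 0 ≤ z 0 ∧ (hp x).G z ∈ (hp y).O ∧
      c ((hp x).param z) = (hp x).G z := by
    rintro z ⟨hz, h0⟩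
    rw [OpenPartialHomeomorph.trans_source] at hz
    have hz0 : ((𝓡∂ d).symm z).1 = z := (𝓡∂ d).right_inv h0
    rw [range_modelWithCornersEuclideanHalfSpace] at h0
    have h1 : z ∈ (hp x).W := by
      have : ((𝓡∂ d).symm z).1 ∈ (hp x).W := hz.1
      rwa [hz0] at this
    have h2 : c ((hp x).param ((𝓡∂ d).symm z).1) ∈ (hp y).O := hz.2
    have h3 := (hp x).param_spec h1 h0
    rw [hz0, h3.1] at h2
    exact ⟨h1, h0, h2, h3.1⟩
  refine ContDiffOn.congr (f := (hp y).F ∘ (hp x).G) ?_ ?_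
  · exact (hp y).smooth_F.comp ((hp x).smooth_G.mono fun z hz => (key z hz).1)
      fun z hz => (key z hz).2.2.1
  · intro z hz
    obtain ⟨h1, h0, h2, h3⟩ := key z hz
    have hz0 : ((𝓡∂ d).symm z).1 = z := (𝓡∂ d).right_inv hz.2
    have h4 : 0 ≤ ((hp y).F (c ((hp x).param z))) 0 := (hp y).nonneg _ (by rw [h3]; exact h2)
    change ((𝓡∂ d).symm ((hp y).F (c ((hp x).param ((𝓡∂ d).symm z).1)))).1 = _
    rw [hz0]
    refine ((𝓡∂ d).right_inv ?_).trans ?_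
    · rw [range_modelWithCornersEuclideanHalfSpace]; exact h4
    · rw [h3]; rfl

variable (d) in
/-- `c : N → E` is an embedding of the manifold with boundary `N = {ρ ≥ 0}`, with charts given by
patches. -/
structure IsPatchEmbedding [ChartedSpace (EuclideanHalfSpace d) N] (c : N → E) (ρ : N → ℝ) :
    Prop where
  isEmbedding : Topology.IsEmbedding c
  exists_patch : ∀ x, ∃ p : HalfPatch c ρ (firstCoord d) x,
    (extChartAt (𝓡∂ d) x).source = c ⁻¹' p.O ∧
    (∀ y, c y ∈ p.O → extChartAt (𝓡∂ d) x y = p.F (c y)) ∧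
    (extChartAt (𝓡∂ d) x).target = {z | z ∈ p.W ∧ 0 ≤ z 0} ∧
    ∀ z ∈ p.W, 0 ≤ z 0 → c ((extChartAt (𝓡∂ d) x).symm z) = p.G z

/-- These are the only properties of the charts that are used afterwards. -/
lemma isPatchEmbedding_patchChartedSpace (hc : Topology.IsEmbedding c)
    (hp : ∀ x, HalfPatch c ρ (firstCoord d) x) :
    let := patchChartedSpace hc hp
    IsPatchEmbedding d c ρ := by
  let := patchChartedSpace hc hp
  refine ⟨hc, fun x => ⟨hp x, ?_, ?_, ?_, ?_⟩⟩
  · rw [extChartAt_source]; rfl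
  · intro y hy
    exact (𝓡∂ d).right_inv (by
      rw [range_modelWithCornersEuclideanHalfSpace]; exact (hp x).nonneg y hy)
  · ext z
    rw [extChartAt_target, range_modelWithCornersEuclideanHalfSpace]
    constructor
    · rintro ⟨h1, h0⟩
      have hz0 : ((𝓡∂ d).symm z).1 = z :=
        (𝓡∂ d).right_inv (by rw [range_modelWithCornersEuclideanHalfSpace]; exact h0)
      have : ((𝓡∂ d).symm z).1 ∈ (hp x).W := h1
      rw [hz0] at this
      exact ⟨this, h0⟩
    · rintro ⟨h1, h0⟩
      have hz0 : ((𝓡∂ d).symm z).1 = z :=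
        (𝓡∂ d).right_inv (by rw [range_modelWithCornersEuclideanHalfSpace]; exact h0)
      refine ⟨?_, h0⟩
      change ((𝓡∂ d).symm z).1 ∈ (hp x).W
      rwa [hz0]
  · intro z h1 h0
    have hz0 : ((𝓡∂ d).symm z).1 = z :=
      (𝓡∂ d).right_inv (by rw [range_modelWithCornersEuclideanHalfSpace]; exact h0)
    change c ((hp x).param ((𝓡∂ d).symm z).1) = _
    rw [hz0]
    exact ((hp x).param_spec h1 h0).1

end Patches

/-! ### Derivatives of vector valued functions on manifolds -/

section VectorDerivative

variable {E : Type*} [NormedAddCommGroup E] [NormedSpace ℝ E] {H : Type*} [TopologicalSpace H]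
  (I : ModelWithCorners ℝ E H) {N : Type*} [TopologicalSpace N] [ChartedSpace H N]
  {E' : Type*} [NormedAddCommGroup E'] [NormedSpace ℝ E'] {H' : Type*} [TopologicalSpace H']
  {I' : ModelWithCorners ℝ E' H'} {N' : Type*} [TopologicalSpace N'] [ChartedSpace H' N']
  {F : Type*} [NormedAddCommGroup F] [NormedSpace ℝ F]
  {F' : Type*} [NormedAddCommGroup F'] [NormedSpace ℝ F']

/-- The derivative of a vector valued function on a manifold, with values in the vector space. -/
def mvderiv (g : N → F) (x : N) : TangentSpace I x →L[ℝ] F := mfderiv I 𝓘(ℝ, F) g x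

variable {I}

lemma HasMFDerivAt.mvderiv_eq {g : N → F} {x : N} {L : TangentSpace I x →L[ℝ] F}
    (h : HasMFDerivAt I 𝓘(ℝ, F) g x L) : mvderiv I g x = L := h.mfderiv

lemma MDifferentiableAt.hasMFDerivAt_mvderiv {g : N → F} {x : N}
    (hg : MDifferentiableAt I 𝓘(ℝ, F) g x) : HasMFDerivAt I 𝓘(ℝ, F) g x (mvderiv I g x) :=
  hg.hasMFDerivAt

lemma mvderiv_fderiv_comp {h : F → F'} {g : N → F} {x : N} (hh : DifferentiableAt ℝ h (g x))
    (hg : MDifferentiableAt I 𝓘(ℝ, F) g x) (v : TangentSpace I x) :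
    mvderiv I (fun y => h (g y)) x v = fderiv ℝ h (g x) (mvderiv I g x v) := by
  have := (hh.hasFDerivAt.hasMFDerivAt).comp x hg.hasMFDerivAt
  exact congrArg (fun L => L v) this.mfderiv

lemma mvderiv_clm_comp (L : F →L[ℝ] F') {g : N → F} {x : N}
    (hg : MDifferentiableAt I 𝓘(ℝ, F) g x) (v : TangentSpace I x) :
    mvderiv I (fun y => L (g y)) x v = L (mvderiv I g x v) := by
  rw [mvderiv_fderiv_comp L.differentiableAt hg, L.fderiv]

lemma mvderiv_comp {g : N → F} {f : N' → N} {x : N'} (hg : MDifferentiableAt I 𝓘(ℝ, F) g (f x))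
    (hf : MDifferentiableAt I' I f x) (v : TangentSpace I' x) :
    mvderiv I' (fun y => g (f y)) x v = mvderiv I g (f x) (mfderiv I' I f x v) := by
  have := (hg.hasMFDerivAt).comp x hf.hasMFDerivAt
  exact congrArg (fun L => L v) this.mfderiv

lemma mvderiv_prodMk {g : N → F} {h : N → F'} {x : N} (hg : MDifferentiableAt I 𝓘(ℝ, F) g x)
    (hh : MDifferentiableAt I 𝓘(ℝ, F') h x) (v : TangentSpace I x) :
    mvderiv I (fun y => (g y, h y)) x v = (mvderiv I g x v, mvderiv I h x v) := by
  have hp : MDifferentiableAt I 𝓘(ℝ, F × F') (fun y => (g y, h y)) x := hg.prodMk_space hh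
  ext1
  · exact (mvderiv_clm_comp (ContinuousLinearMap.fst ℝ F F') hp v).symm
  · exact (mvderiv_clm_comp (ContinuousLinearMap.snd ℝ F F') hp v).symm

lemma mvderiv_mul {g h : N → ℝ} {x : N} (hg : MDifferentiableAt I 𝓘(ℝ, ℝ) g x)
    (hh : MDifferentiableAt I 𝓘(ℝ, ℝ) h x) (v : TangentSpace I x) :
    mvderiv I (fun y => g y * h y) x v = g x * mvderiv I h x v + mvderiv I g x v * h x := by
  have hp : MDifferentiableAt I 𝓘(ℝ, ℝ × ℝ) (fun y => (g y, h y)) x := hg.prodMk_space hh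
  have h1 := mvderiv_fderiv_comp (h := fun q : ℝ × ℝ => q.1 * q.2) (by fun_prop) hp v
  rw [mvderiv_prodMk hg hh] at h1
  refine h1.trans ?_
  rw [fderiv_fun_mul (by fun_prop) (by fun_prop)]
  simp [fderiv_fst, fderiv_snd, mul_comm]

lemma Filter.EventuallyEq.mvderiv_eq {g h : N → F} {x : N} (hgh : g =ᶠ[𝓝 x] h) :
    mvderiv I g x = mvderiv I h x := by
  have := hgh.mfderiv_eq (I := I) (I' := 𝓘(ℝ, F))
  ext v
  exact congrArg (fun L : TangentSpace I x →L[ℝ] F => L v) this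

end VectorDerivative

/-! ### Smooth maps and tangent vectors read through a patch embedding. -/

namespace IsPatchEmbedding

variable {E : Type*} [NormedAddCommGroup E] [NormedSpace ℝ E] {N : Type*} [TopologicalSpace N]
  {d : ℕ} [NeZero d] [ChartedSpace (EuclideanHalfSpace d) N] {c : N → E} {ρ : N → ℝ}
  {E' : Type*} [NormedAddCommGroup E'] [NormedSpace ℝ E'] {H' : Type*} [TopologicalSpace H']
  {I' : ModelWithCorners ℝ E' H'} {N' : Type*} [TopologicalSpace N'] [ChartedSpace H' N']

lemma contMDiff (hc : IsPatchEmbedding d c ρ) : ContMDiff (𝓡∂ d) 𝓘(ℝ, E) ∞ c := by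
  intro x
  obtain ⟨p, h1, h2, h3, h4⟩ := hc.exists_patch x
  rw [contMDiffAt_iff]
  refine ⟨hc.isEmbedding.continuous.continuousAt, ?_⟩
  have hx : extChartAt (𝓡∂ d) x x ∈ p.W := by rw [h2 x p.mem_O]; exact p.map_F x p.mem_O
  refine ((p.smooth_G.contDiffAt (p.isOpen_W.mem_nhds hx)).contDiffWithinAt
    (s := range (𝓡∂ d))).congr_of_eventuallyEq_of_mem ?_ (mem_range_self _)
  filter_upwards [mem_nhdsWithin_of_mem_nhds (p.isOpen_W.mem_nhds hx), self_mem_nhdsWithin]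
    with z hz h0
  rw [range_modelWithCornersEuclideanHalfSpace] at h0
  exact h4 z hz h0

/-- In the chart at `f a` the map `f` is `p.F` applied to `c ∘ f`, and `p.F` is smooth near `c (f
a)` in the ambient space. -/
lemma contMDiffWithinAt_of_comp (hc : IsPatchEmbedding d c ρ) {f : N' → N} {s : Set N'} {a : N'}
    (hf : ContMDiffWithinAt I' 𝓘(ℝ, E) ∞ (fun y => c (f y)) s a) :
    ContMDiffWithinAt I' (𝓡∂ d) ∞ f s a := by
  obtain ⟨p, h1, h2, h3, h4⟩ := hc.exists_patch (f a)
  have hcont : ContinuousWithinAt f s a :=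
    hc.isEmbedding.isInducing.continuousWithinAt_iff.2 hf.continuousWithinAt
  rw [contMDiffWithinAt_iff_target]
  refine ⟨hcont, ?_⟩
  have h5 : ContMDiffWithinAt I' 𝓘(ℝ, EuclideanSpace ℝ (Fin d)) ∞ (p.F ∘ fun y => c (f y)) s a :=
    ((p.smooth_F.contDiffAt (p.isOpen_O.mem_nhds p.mem_O)).contMDiffAt).comp_contMDiffWithinAt a hf
  refine h5.congr_of_eventuallyEq ?_ (h2 _ p.mem_O)
  filter_upwards [hf.continuousWithinAt (p.isOpen_O.mem_nhds p.mem_O)] with y hy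
  exact h2 _ hy

lemma contMDiffAt_of_comp (hc : IsPatchEmbedding d c ρ) {f : N' → N} {a : N'}
    (hf : ContMDiffAt I' 𝓘(ℝ, E) ∞ (fun y => c (f y)) a) :
    ContMDiffAt I' (𝓡∂ d) ∞ f a :=
  hc.contMDiffWithinAt_of_comp hf

lemma contMDiff_of_comp (hc : IsPatchEmbedding d c ρ) {f : N' → N}
    (hf : ContMDiff I' 𝓘(ℝ, E) ∞ (fun y => c (f y))) :
    ContMDiff I' (𝓡∂ d) ∞ f := fun a => hc.contMDiffAt_of_comp (hf a)

lemma contMDiffOn_of_comp (hc : IsPatchEmbedding d c ρ) {f : N' → N} {s : Set N'}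
    (hf : ContMDiffOn I' 𝓘(ℝ, E) ∞ (fun y => c (f y)) s) :
    ContMDiffOn I' (𝓡∂ d) ∞ f s := fun a ha => hc.contMDiffWithinAt_of_comp (hf a ha)

lemma mdifferentiableAt (hc : IsPatchEmbedding d c ρ) (x : N) :
    MDifferentiableAt (𝓡∂ d) 𝓘(ℝ, E) c x :=
  (hc.contMDiff x).mdifferentiableAt (by simp)

lemma boundary_eq (hc : IsPatchEmbedding d c ρ) : (𝓡∂ d).boundary N = {x | ρ x = 0} := by
  ext x
  obtain ⟨p, h1, h2, h3, h4⟩ := hc.exists_patch x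
  rw [ModelWithCorners.boundary, mem_ofPred_eq, ModelWithCorners.isBoundaryPoint_iff,
    frontier_range_modelWithCornersEuclideanHalfSpace, mem_ofPred_eq, mem_ofPred_eq,
    h2 x p.mem_O, ← p.zero_iff x p.mem_O, eq_comm]
  rfl

lemma interior_eq (hc : IsPatchEmbedding d c ρ) : (𝓡∂ d).interior N = {x | ρ x ≠ 0} := by
  rw [← ModelWithCorners.compl_boundary, hc.boundary_eq]; rfl

lemma mfderiv_extChartAt_eq (hc : IsPatchEmbedding d c ρ) {x y : N}
    (p : HalfPatch c ρ (firstCoord d) x)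
    (h2 : ∀ y, c y ∈ p.O → extChartAt (𝓡∂ d) x y = p.F (c y)) (hy : c y ∈ p.O)
    (v : TangentSpace (𝓡∂ d) y) :
    mfderiv (𝓡∂ d) 𝓘(ℝ, EuclideanSpace ℝ (Fin d)) (extChartAt (𝓡∂ d) x) y v =
      fderiv ℝ p.F (c y) (mvderiv (𝓡∂ d) c y v) := by
  have hF : MDifferentiableAt 𝓘(ℝ, E) 𝓘(ℝ, EuclideanSpace ℝ (Fin d)) p.F (c y) :=
    ((p.smooth_F.contDiffAt (p.isOpen_O.mem_nhds hy)).differentiableAt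
      (by simp)).mdifferentiableAt
  have h : extChartAt (𝓡∂ d) x =ᶠ[𝓝 y] p.F ∘ c := by
    filter_upwards [(p.isOpen_O.preimage hc.isEmbedding.continuous).mem_nhds hy] with z hz
    exact h2 z hz
  rw [h.mfderiv_eq, mfderiv_comp y hF (hc.mdifferentiableAt y), mfderiv_eq_fderiv]
  rfl

variable [IsManifold (𝓡∂ d) ∞ N]

/-- Near `x` the chart is `p.F ∘ c`, so its invertible derivative factors through that of `c`. -/
lemma mvderiv_injective (hc : IsPatchEmbedding d c ρ) (x : N) :
    Function.Injective (mvderiv (𝓡∂ d) c x) := by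
  obtain ⟨p, h1, h2, h3, h4⟩ := hc.exists_patch x
  intro v w hvw
  have hinv := (isInvertible_mfderiv_extChartAt (I := 𝓡∂ d) (mem_extChartAt_source x))
  apply hinv.injective
  rw [hc.mfderiv_extChartAt_eq p h2 p.mem_O, hvw, hc.mfderiv_extChartAt_eq p h2 p.mem_O]

/-- Smoothness of a map to the tangent bundle can be checked after the embedding. -/
lemma contMDiffAt_tangent_of_comp (hc : IsPatchEmbedding d c ρ) {f : N' → N}
    {v : ∀ a, TangentSpace (𝓡∂ d) (f a)} {a : N'}
    (hf : ContMDiffAt I' 𝓘(ℝ, E) ∞ (fun y => c (f y)) a)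
    (hv : ContMDiffAt I' 𝓘(ℝ, E) ∞ (fun y => mvderiv (𝓡∂ d) c (f y) (v y)) a) :
    ContMDiffAt I' (𝓡∂ d).tangent ∞ (fun y => (⟨f y, v y⟩ : TangentBundle (𝓡∂ d) N)) a := by
  obtain ⟨p, h1, h2, h3, h4⟩ := hc.exists_patch (f a)
  have hfa := hc.contMDiffAt_of_comp hf
  refine Bundle.contMDiffAt_totalSpace.2 ⟨hfa, ?_⟩
  have hF : ContDiffAt ℝ ∞ (fun z => fderiv ℝ p.F z) (c (f a)) :=
    (p.smooth_F.contDiffAt (p.isOpen_O.mem_nhds p.mem_O)).fderiv_right (m := ∞) (by simp)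
  have h5 : ContMDiffAt I' 𝓘(ℝ, EuclideanSpace ℝ (Fin d)) ∞
      (fun y => fderiv ℝ p.F (c (f y)) (mvderiv (𝓡∂ d) c (f y) (v y))) a := by
    have := (hF.contMDiffAt).comp a hf
    exact ContMDiffAt.clm_apply this hv
  refine h5.congr_of_eventuallyEq ?_
  filter_upwards [hf.continuousAt (p.isOpen_O.mem_nhds p.mem_O)] with y hy
  have hy' : f y ∈ (chartAt (EuclideanHalfSpace d) (f a)).source := by
    rw [← extChartAt_source (𝓡∂ d), h1]; exact hy
  -- Over the source of the chart, the fibre coordinate of the tangent bundle is the derivative of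
  -- the chart, that is, `fderiv ℝ p.F` after the derivative of `c`.
  have e1 : (trivializationAt (EuclideanSpace ℝ (Fin d)) (TangentSpace (𝓡∂ d))
      (f a)).continuousLinearMapAt ℝ (f y) (v y) =
      (trivializationAt (EuclideanSpace ℝ (Fin d)) (TangentSpace (𝓡∂ d)) (f a) ⟨f y, v y⟩).2 := by
    rw [Bundle.Trivialization.continuousLinearMapAt_apply,
      Bundle.Trivialization.coe_linearMapAt_of_mem]
    simpa using hy'
  have e2 := congrArg (fun L => L (v y))
    (TangentBundle.continuousLinearMapAt_trivializationAt (I := 𝓡∂ d) hy')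
  exact e1.symm.trans (e2.trans (hc.mfderiv_extChartAt_eq p h2 hy (v y)))

lemma contMDiff_tangent_of_comp (hc : IsPatchEmbedding d c ρ) {f : N' → N}
    {v : ∀ a, TangentSpace (𝓡∂ d) (f a)}
    (hf : ContMDiff I' 𝓘(ℝ, E) ∞ (fun y => c (f y)))
    (hv : ContMDiff I' 𝓘(ℝ, E) ∞ (fun y => mvderiv (𝓡∂ d) c (f y) (v y))) :
    ContMDiff I' (𝓡∂ d).tangent ∞ (fun y => (⟨f y, v y⟩ : TangentBundle (𝓡∂ d) N)) :=
  fun a => hc.contMDiffAt_tangent_of_comp (hf a) (hv a)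

end IsPatchEmbedding

/-! ### Derivatives of functions along smooth families of tangent vectors. -/

section General

variable {E : Type*} [NormedAddCommGroup E] [NormedSpace ℝ E] {H : Type*} [TopologicalSpace H]
  {I : ModelWithCorners ℝ E H} {N : Type*} [TopologicalSpace N] [ChartedSpace H N]
  [IsManifold I ∞ N]
  {E' : Type*} [NormedAddCommGroup E'] [NormedSpace ℝ E'] {H' : Type*} [TopologicalSpace H']
  {I' : ModelWithCorners ℝ E' H'} {N' : Type*} [TopologicalSpace N'] [ChartedSpace H' N']
  {F : Type*} [NormedAddCommGroup F] [NormedSpace ℝ F]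

/-- The derivative of a smooth vector valued function along smooth tangent vectors is smooth. -/
lemma contMDiff_mvderiv_apply {g : N → F} (hg : ContMDiff I 𝓘(ℝ, F) ∞ g) {f : N' → N}
    {v : ∀ a, TangentSpace I (f a)}
    (hv : ContMDiff I' I.tangent ∞ (fun a => (⟨f a, v a⟩ : TangentBundle I N))) :
    ContMDiff I' 𝓘(ℝ, F) ∞ (fun a => mvderiv I g (f a) (v a)) :=
  (contMDiff_snd_tangentBundle_modelSpace F 𝓘(ℝ, F)).comp
    ((hg.contMDiff_tangentMap (m := ∞) (by simp)).comp hv)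

end General

/-! ### Lie brackets tested on vector valued functions. -/

section Bracket

open VectorField

variable {E : Type*} [NormedAddCommGroup E] [NormedSpace ℝ E]
  {H : Type*} [TopologicalSpace H]
  {I : ModelWithCorners ℝ E H} {N : Type*} [TopologicalSpace N] [ChartedSpace H N]
  [IsManifold I ∞ N]
  {F : Type*} [NormedAddCommGroup F] [NormedSpace ℝ F]

/-- A vector field read in the chart at `x`. -/
def fieldInChart (x : N) (V : ∀ y : N, TangentSpace I y) : E → E :=
  mpullbackWithin 𝓘(ℝ, E) I (extChartAt I x).symm V (range I)

lemma fieldInChart_apply (x : N) (V : ∀ y : N, TangentSpace I y) {z : E}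
    (hz : z ∈ (extChartAt I x).target) :
    fieldInChart x V z = mvderiv I (extChartAt I x) ((extChartAt I x).symm z)
      (V ((extChartAt I x).symm z)) := by
  have h1 := (isInvertible_mfderivWithin_extChartAt_symm (I := I) hz).self_apply_inverse
    (V ((extChartAt I x).symm z))
  have h2 := mfderiv_extChartAt_comp_mfderivWithin_extChartAt_symm (I := I) hz
  have h3 := congrArg (fun L : E →L[ℝ] E => L (fieldInChart x V z)) h2
  exact (h3.symm.trans (congrArg (mvderiv I (extChartAt I x) ((extChartAt I x).symm z)) h1))

lemma fieldInChart_self (x : N) (V : ∀ y : N, TangentSpace I y) :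
    fieldInChart x V (extChartAt I x x) = mvderiv I (extChartAt I x) x (V x) := by
  rw [fieldInChart_apply x V (mem_extChartAt_target x), extChartAt_to_inv]

lemma mvderiv_symm_eq_fderivWithin {g : N → F} (hg : MDifferentiable I 𝓘(ℝ, F) g)
    (x : N) (V : ∀ y : N, TangentSpace I y) {z : E} (hz : z ∈ (extChartAt I x).target) :
    mvderiv I g ((extChartAt I x).symm z) (V ((extChartAt I x).symm z)) =
      fderivWithin ℝ (g ∘ (extChartAt I x).symm) (range I) z (fieldInChart x V z) := by
  have hz' : z ∈ range I := extChartAt_target_subset_range x hz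
  have hu : UniqueMDiffWithinAt 𝓘(ℝ, E) (range I) z := I.uniqueMDiffOn z hz'
  have h1 : MDifferentiableWithinAt 𝓘(ℝ, E) I (extChartAt I x).symm (range I) z :=
    mdifferentiableWithinAt_extChartAt_symm hz
  have h2 := mfderiv_comp_mfderivWithin z (hg ((extChartAt I x).symm z)) h1 hu
  have h3 := (isInvertible_mfderivWithin_extChartAt_symm (I := I) hz).self_apply_inverse
    (V ((extChartAt I x).symm z))
  rw [mfderivWithin_eq_fderivWithin] at h2
  have h4 := congrArg (fun L : E →L[ℝ] F => L (fieldInChart x V z)) h2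
  exact ((congrArg (mvderiv I g ((extChartAt I x).symm z)) h3).symm.trans h4.symm)

lemma mvderiv_eq_fderivWithin {g : N → F} (hg : MDifferentiable I 𝓘(ℝ, F) g)
    (x : N) (V : ∀ y : N, TangentSpace I y) :
    mvderiv I g x (V x) = fderivWithin ℝ (g ∘ (extChartAt I x).symm) (range I) (extChartAt I x x)
      (fieldInChart x V (extChartAt I x x)) := by
  have := mvderiv_symm_eq_fderivWithin hg x V (mem_extChartAt_target (I := I) x)
  rw [← this, extChartAt_to_inv]

variable [CompleteSpace E]

lemma differentiableWithinAt_fieldInChart {V : ∀ y : N, TangentSpace I y}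
    (hV : ContMDiff I I.tangent ∞ (fun y => (⟨y, V y⟩ : TangentBundle I N))) (x : N) :
    DifferentiableWithinAt ℝ (fieldInChart x V) (range I) (extChartAt I x x) := by
  have : IsManifold I 2 N := IsManifold.of_le (n := ∞) (ENat.LEInfty.out)
  have := (((hV.mdifferentiable (by simp)) x).mdifferentiableWithinAt
      (s := univ)).differentiableWithinAt_mpullbackWithin_vectorField
  rw [preimage_univ, univ_inter] at this
  exact this

omit [CompleteSpace E] in
lemma fieldInChart_mlieBracket (V W : ∀ y : N, TangentSpace I y) (x : N) :
    fieldInChart x (mlieBracket I V W) (extChartAt I x x) =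
      lieBracketWithin ℝ (fieldInChart x V) (fieldInChart x W) (range I) (extChartAt I x x) := by
  have hb := mlieBracketWithin_apply (I := I) (V := V) (W := W) (s := univ) (x₀ := x)
  rw [mlieBracketWithin_univ, preimage_univ, univ_inter] at hb
  rw [fieldInChart_self, hb]
  exact (isInvertible_mfderiv_extChartAt (I := I) (mem_extChartAt_source x)).self_apply_inverse _

/-- The differential of a vector valued function along a Lie bracket. -/
lemma mvderiv_mlieBracket {g : N → F} (hg : ContMDiff I 𝓘(ℝ, F) ∞ g)
    {V W : ∀ y : N, TangentSpace I y}
    (hV : ContMDiff I I.tangent ∞ (fun y => (⟨y, V y⟩ : TangentBundle I N)))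
    (hW : ContMDiff I I.tangent ∞ (fun y => (⟨y, W y⟩ : TangentBundle I N))) (x : N) :
    mvderiv I g x (mlieBracket I V W x) =
      mvderiv I (fun y => mvderiv I g y (W y)) x (V x) -
      mvderiv I (fun y => mvderiv I g y (V y)) x (W x) := by
  have hgd : MDifferentiable I 𝓘(ℝ, F) g := hg.mdifferentiable (by simp)
  have hgV := (contMDiff_mvderiv_apply hg hV).mdifferentiable (by simp)
  have hgW := (contMDiff_mvderiv_apply hg hW).mdifferentiable (by simp)
  rw [mvderiv_eq_fderivWithin hgd, fieldInChart_mlieBracket, mvderiv_eq_fderivWithin hgW,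
    mvderiv_eq_fderivWithin hgV]
  have hz₀ : extChartAt I x x ∈ (extChartAt I x).target := mem_extChartAt_target x
  have hz₀s : extChartAt I x x ∈ range I := mem_range_self _
  have hus : UniqueDiffOn ℝ (range I) := I.uniqueDiffOn
  have dV := differentiableWithinAt_fieldInChart hV x
  have dW := differentiableWithinAt_fieldInChart hW x
  set g' : E → F := g ∘ (extChartAt I x).symm with hg'
  have cg : ContDiffWithinAt ℝ ∞ g' (range I) (extChartAt I x x) :=
    (contMDiffAt_iff.1 (hg x)).2
  -- The range of the model lies in the closure of its interior, so the second derivative is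
  -- symmetric at boundary points too. This cancels the second order terms of `VWg - WVg`.
  have hsymm : IsSymmSndFDerivWithinAt ℝ g' (range I) (extChartAt I x x) :=
    cg.isSymmSndFDerivWithinAt (by simp [minSmoothness_of_isRCLikeNormedField, ENat.LEInfty.out])
      hus (I.range_subset_closure_interior hz₀s) hz₀s
  have dg' : DifferentiableWithinAt ℝ (fderivWithin ℝ g' (range I)) (range I) (extChartAt I x x) :=
    ((cg.fderivWithin_right hus (m := 1) (by norm_num; exact ENat.LEInfty.out) hz₀s)).differentiableWithinAt
      (by simp)
  have hev : ∀ U : ∀ y : N, TangentSpace I y,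
      ((fun y => mvderiv I g y (U y)) ∘ (extChartAt I x).symm) =ᶠ[𝓝[range I] (extChartAt I x x)]
        fun z => fderivWithin ℝ g' (range I) z (fieldInChart x U z) := by
    intro U
    filter_upwards [extChartAt_target_mem_nhdsWithin (I := I) x] with z hz
    exact mvderiv_symm_eq_fderivWithin hgd x U hz
  rw [(hev W).fderivWithin_eq_of_mem hz₀s, (hev V).fderivWithin_eq_of_mem hz₀s,
    fderivWithin_clm_apply (hus _ hz₀s) dg' dW, fderivWithin_clm_apply (hus _ hz₀s) dg' dV]
  have hs := hsymm (fieldInChart x V (extChartAt I x x)) (fieldInChart x W (extChartAt I x x))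
  simp only [lieBracketWithin, map_sub, add_apply,
    ContinuousLinearMap.comp_apply, ContinuousLinearMap.flip_apply]
  rw [hs]
  abel

lemma contMDiff_mlieBracket {V W : ∀ y : N, TangentSpace I y}
    (hV : ContMDiff I I.tangent ∞ (fun y => (⟨y, V y⟩ : TangentBundle I N)))
    (hW : ContMDiff I I.tangent ∞ (fun y => (⟨y, W y⟩ : TangentBundle I N))) :
    ContMDiff I I.tangent ∞
      (fun y => (⟨y, mlieBracket I V W y⟩ : TangentBundle I N)) := fun x =>
  have : IsManifold I (minSmoothness ℝ 3) N := by
    rw [minSmoothness_of_isRCLikeNormedField]; exact IsManifold.of_le (n := ∞) ENat.LEInfty.out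
  have : IsManifold I (((⊤ : ℕ∞) : WithTop ℕ∞) + 1) N := inferInstanceAs (IsManifold I ∞ N)
  ContMDiffAt.mlieBracket_vectorField (m := ⊤) (n := ⊤) (hV x) (hW x)
    (by simp [minSmoothness_of_isRCLikeNormedField])

end Bracket

/-! ### Smoothness of integrals depending on a parameter, and Hadamard's lemma -/

section Hadamard

open intervalIntegral MeasureTheory

universe u

variable {E : Type u} [NormedAddCommGroup E] [NormedSpace ℝ E] {S : Set E}

omit [NormedSpace ℝ E] in
lemma ContinuousOn.intervalIntegrable_slice {F : Type*} [NormedAddCommGroup F] {k : ℝ × E → F}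
    (hk : ContinuousOn k (Icc (0 : ℝ) 1 ×ˢ S)) {p : E} (hp : p ∈ S) :
    IntervalIntegrable (fun t => k (t, p)) volume 0 1 := by
  apply ContinuousOn.intervalIntegrable
  rw [uIcc_of_le zero_le_one]
  exact hk.comp (by fun_prop) fun t ht => ⟨ht, hp⟩

/-- Differentiation under the integral sign on a convex set that need not be open. By compactness of
`[0, 1]` the derivative `k'` is within `ε` of its value at `p`, uniformly in `t`, on a ball around
`p`; the mean value inequality on the convex set `ball p δ ∩ S` bounds the remainder of the
integrand by `ε ‖q - p‖`. -/
lemma hasFDerivWithinAt_integral_of_continuousOn {F : Type*} [NormedAddCommGroup F]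
    [NormedSpace ℝ F] [CompleteSpace F] (hS : Convex ℝ S) {k : ℝ × E → F} {k' : ℝ × E → E →L[ℝ] F}
    (hk : ContinuousOn k (Icc (0 : ℝ) 1 ×ˢ S)) (hk' : ContinuousOn k' (Icc (0 : ℝ) 1 ×ˢ S))
    (hd : ∀ t ∈ Icc (0 : ℝ) 1, ∀ p ∈ S, HasFDerivWithinAt (fun q => k (t, q)) (k' (t, p)) S p)
    {p : E} (hp : p ∈ S) :
    HasFDerivWithinAt (fun q => ∫ t in (0 : ℝ)..1, k (t, q)) (∫ t in (0 : ℝ)..1, k' (t, p)) S p := by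
  refine HasFDerivWithinAt.of_isLittleO (Asymptotics.isLittleO_iff.2 fun ε hε => ?_)
  have hc : ContinuousOn (Function.uncurry fun (q : E) (t : ℝ) => k' (t, q))
      (S ×ˢ Icc (0 : ℝ) 1) := hk'.comp continuous_swap.continuousOn fun q hq => ⟨hq.2, hq.1⟩
  obtain ⟨v, hv, hv'⟩ := isCompact_Icc.mem_uniformity_of_prod hc hp (Metric.dist_mem_uniformity hε)
  obtain ⟨δ, hδ, hball⟩ := Metric.mem_nhdsWithin_iff.1 hv
  filter_upwards [inter_mem_nhdsWithin S (Metric.ball_mem_nhds p hδ)] with q hq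
  have hT : Convex ℝ (ball p δ ∩ S) := (convex_ball p δ).inter hS
  have hpT : p ∈ ball p δ ∩ S := ⟨mem_ball_self hδ, hp⟩
  have hqT : q ∈ ball p δ ∩ S := ⟨hq.2, hq.1⟩
  have hbound : ∀ t ∈ Icc (0 : ℝ) 1,
      ‖k (t, q) - k (t, p) - k' (t, p) (q - p)‖ ≤ ε * ‖q - p‖ := by
    intro t ht
    refine hT.norm_image_sub_le_of_norm_hasFDerivWithin_le' (f := fun q => k (t, q))
      (f' := fun q => k' (t, q))
      (fun x hx => (hd t ht x hx.2).mono inter_subset_right) (fun x hx => ?_) hpT hqT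
    have := hv' x (hball hx) t ht
    rw [← dist_eq_norm]
    exact this.le
  have h1 := hk.intervalIntegrable_slice hp
  have h2 := hk.intervalIntegrable_slice hq.1
  have h3 := hk'.intervalIntegrable_slice hp
  have h4 : (∫ t in (0 : ℝ)..1, k' (t, p)) (q - p) = ∫ t in (0 : ℝ)..1, k' (t, p) (q - p) :=
    ContinuousLinearMap.intervalIntegral_apply h3 _
  have h5 : IntervalIntegrable (fun t => k' (t, p) (q - p)) volume 0 1 := by
    apply ContinuousOn.intervalIntegrable
    rw [uIcc_of_le zero_le_one]
    exact (hk'.comp (by fun_prop) fun t ht => ⟨ht, hp⟩ : ContinuousOn (fun t => k' (t, p))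
      (Icc 0 1)).clm_apply continuousOn_const
  rw [h4, ← integral_sub h2 h1, ← integral_sub (h2.sub h1) h5]
  have h6 := norm_integral_le_of_norm_le_const (a := (0 : ℝ)) (b := 1) (C := ε * ‖q - p‖)
    (f := fun t => k (t, q) - k (t, p) - k' (t, p) (q - p)) (fun t ht => hbound t (by
      rw [uIoc_of_le zero_le_one] at ht; exact ⟨ht.1.le, ht.2⟩))
  simpa using h6

/-- Integrals over `[0, 1]` depend smoothly on parameters in a convex set. -/
lemma contDiffOn_intervalIntegral {F : Type u} [NormedAddCommGroup F]
    [NormedSpace ℝ F] [CompleteSpace F] (hS : Convex ℝ S) (hu : UniqueDiffOn ℝ S) {k : ℝ × E → F}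
    (hk : ContDiffOn ℝ ∞ k (Icc (0 : ℝ) 1 ×ˢ S)) :
    ContDiffOn ℝ ∞ (fun q => ∫ t in (0 : ℝ)..1, k (t, q)) S := by
  rw [contDiffOn_infty]
  intro n
  -- The derivative is again an integral of this form, with values in `E →L[ℝ] F`, so the induction
  -- must allow all targets of one universe.
  induction n generalizing F with
  | zero =>
    refine contDiffOn_zero.2 fun p hp => ?_
    have hU : UniqueDiffOn ℝ (Icc (0 : ℝ) 1 ×ˢ S) := (uniqueDiffOn_Icc zero_lt_one).prod hu
    have hk1 := hk.fderivWithin (m := ∞) hU (by simp)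
    refine (hasFDerivWithinAt_integral_of_continuousOn hS hk.continuousOn
      (k' := fun q => (fderivWithin ℝ k (Icc (0 : ℝ) 1 ×ˢ S) q).comp (.inr ℝ ℝ E))
      (hk1.continuousOn.clm_comp continuousOn_const) ?_ hp).continuousWithinAt
    intro t ht q hq
    exact ((hk.differentiableOn (by simp)) (t, q) ⟨ht, hq⟩).hasFDerivWithinAt.comp q
      (hasFDerivAt_prodMk_right t q).hasFDerivWithinAt (fun q hq => ⟨ht, hq⟩)
  | succ n ih =>
    have hU : UniqueDiffOn ℝ (Icc (0 : ℝ) 1 ×ˢ S) := (uniqueDiffOn_Icc zero_lt_one).prod hu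
    have hk1 := hk.fderivWithin (m := ∞) hU (by simp)
    have hk2 : ContDiffOn ℝ ∞
        (fun q => (fderivWithin ℝ k (Icc (0 : ℝ) 1 ×ˢ S) q).comp (.inr ℝ ℝ E))
        (Icc (0 : ℝ) 1 ×ˢ S) := hk1.clm_comp contDiffOn_const
    refine (contDiffOn_succ_iff_hasFDerivWithinAt_of_uniqueDiffOn hu).2 ⟨by simp, _, ih hk2, ?_⟩
    intro p hp
    refine hasFDerivWithinAt_integral_of_continuousOn hS hk.continuousOn hk2.continuousOn ?_ hp
    intro t ht q hq
    exact ((hk.differentiableOn (by simp)) (t, q) ⟨ht, hq⟩).hasFDerivWithinAt.comp q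
      (hasFDerivAt_prodMk_right t q).hasFDerivWithinAt (fun q hq => ⟨ht, hq⟩)

/-- Hadamard's lemma along the segments from `p - T p` to `p`. -/
lemma ContDiffOn.exists_hadamard {F : Type u} [NormedAddCommGroup F]
    [NormedSpace ℝ F] [CompleteSpace F] (hS : Convex ℝ S) (hu : UniqueDiffOn ℝ S) {f : E → F}
    (hf : ContDiffOn ℝ ∞ f S) (T : E →L[ℝ] E) (hT : ∀ p ∈ S, p - T p ∈ S) :
    ∃ A : E → E →L[ℝ] F, ContDiffOn ℝ ∞ A S ∧ (∀ p ∈ S, f p = f (p - T p) + A p (T p)) ∧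
      ∀ p ∈ S, T p = 0 → A p = fderivWithin ℝ f S p := by
  have hmem : ∀ t ∈ Icc (0 : ℝ) 1, ∀ p ∈ S, (p - T p) + t • T p ∈ S := by
    intro t ht p hp
    have := hS.add_smul_sub_mem (hT p hp) hp ht
    simpa using this
  -- `A p` is the mean of the derivative of `f` over the segment from `p - T p` to `p`; the
  -- fundamental theorem of calculus gives the formula. If `T p = 0` the segment is a point and the
  -- integrand is constant.
  set k : ℝ × E → E →L[ℝ] F := fun q => fderivWithin ℝ f S ((q.2 - T q.2) + q.1 • T q.2) with hk
  have hk1 : ContDiffOn ℝ ∞ k (Icc (0 : ℝ) 1 ×ˢ S) := by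
    refine (hf.fderivWithin (m := ∞) hu (by simp)).comp ?_ fun q hq => hmem q.1 hq.1 q.2 hq.2
    apply ContDiff.contDiffOn
    fun_prop
  refine ⟨fun p => ∫ t in (0 : ℝ)..1, k (t, p), contDiffOn_intervalIntegral hS hu hk1, ?_, ?_⟩
  · intro p hp
    have hi := hk1.continuousOn.intervalIntegrable_slice hp
    rw [ContinuousLinearMap.intervalIntegral_apply hi]
    have hcont : ContinuousOn (fun t : ℝ => (p - T p) + t • T p) (Icc 0 1) := by fun_prop
    have h := integral_eq_sub_of_hasDeriv_right (a := (0 : ℝ)) (b := 1)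
      (f := fun t => f ((p - T p) + t • T p)) (f' := fun t => k (t, p) (T p)) ?_ ?_ ?_
    · rw [h]; simp
    · rw [uIcc_of_le zero_le_one]
      exact hf.continuousOn.comp hcont fun t ht => hmem t ht p hp
    · intro t ht
      rw [min_eq_left zero_le_one, max_eq_right zero_le_one] at ht
      have h1 : HasDerivWithinAt (fun t : ℝ => (p - T p) + t • T p) (T p) (Icc 0 1) t := by
        simpa using (((hasDerivAt_id t).smul_const (T p)).const_add (p - T p)).hasDerivWithinAt
      have h2 := ((hf.differentiableOn (by simp)) _
        (hmem t (Ioo_subset_Icc_self ht) p hp)).hasFDerivWithinAt.comp_hasDerivWithinAt t h1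
        (fun t ht => hmem t ht p hp)
      exact (h2.hasDerivAt (Icc_mem_nhds ht.1 ht.2)).hasDerivWithinAt
    · apply ContinuousOn.intervalIntegrable
      rw [uIcc_of_le zero_le_one]
      exact (hk1.continuousOn.comp (by fun_prop) fun t ht => ⟨ht, hp⟩ :
        ContinuousOn (fun t => k (t, p)) (Icc 0 1)).clm_apply continuousOn_const
  · intro p hp h0
    simp [hk, h0]

end Hadamard

/-! ## Vector fields tangent to the boundary -/

namespace IsPatchEmbedding

universe u

variable {E : Type u} [NormedAddCommGroup E] [NormedSpace ℝ E] {N : Type*} [TopologicalSpace N]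
  {d : ℕ} [NeZero d] [ChartedSpace (EuclideanHalfSpace d) N] {c : N → E} {ρ : N → ℝ}

/-- From a boundary point one moves inwards along the first coordinate axis of the patch. -/
lemma dense_interior (hc : IsPatchEmbedding d c ρ) : Dense {x | ρ x ≠ 0} := by
  intro x
  by_cases hx : ρ x ≠ 0
  · exact subset_closure hx
  push Not at hx
  obtain ⟨p, h1, h2, h3, h4⟩ := hc.exists_patch x
  set φ := extChartAt (𝓡∂ d) x
  have hz : φ x ∈ p.W := by rw [h2 x p.mem_O]; exact p.map_F x p.mem_O
  have hz0 : φ x 0 = 0 := by rw [h2 x p.mem_O]; exact (p.zero_iff x p.mem_O).2 hx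
  set γ : ℝ → EuclideanSpace ℝ (Fin d) := fun t => φ x + t • EuclideanSpace.single 0 1 with hγ
  have hγc : Continuous γ := by fun_prop
  have hγ0 : γ 0 = φ x := by simp [hγ]
  have hγt : ∀ t, γ t 0 = t := fun t => by simp [hγ, hz0]
  have hmem : ∀ᶠ t in 𝓝[>] (0 : ℝ), γ t ∈ φ.target := by
    have : ∀ᶠ t in 𝓝[>] (0 : ℝ), γ t ∈ p.W := by
      apply nhdsWithin_le_nhds
      apply hγc.continuousAt
      rw [hγ0]; exact p.isOpen_W.mem_nhds hz
    filter_upwards [this, self_mem_nhdsWithin] with t ht h0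
    rw [h3]
    exact ⟨ht, by rw [hγt]; exact le_of_lt h0⟩
  have hlim : Filter.Tendsto (fun t => φ.symm (γ t)) (𝓝[>] (0 : ℝ)) (𝓝 x) := by
    have h5 := (continuousOn_extChartAt_symm (I := 𝓡∂ d) x) (φ x) (mem_extChartAt_target x)
    have h6 : Filter.Tendsto γ (𝓝[>] (0 : ℝ)) (𝓝[φ.target] (φ x)) := by
      refine tendsto_nhdsWithin_iff.2 ⟨?_, hmem⟩
      rw [← hγ0]
      exact hγc.continuousAt.tendsto.mono_left nhdsWithin_le_nhds
    have h7 := h5.tendsto.comp h6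
    rwa [extChartAt_to_inv] at h7
  refine mem_closure_of_tendsto hlim ?_
  filter_upwards [hmem, self_mem_nhdsWithin] with t ht h0
  have h5 : φ.symm (γ t) ∈ c ⁻¹' p.O := by rw [← h1]; exact φ.map_target ht
  have h6 := h2 _ h5
  rw [φ.right_inv ht] at h6
  intro h7
  have h8 := (p.zero_iff _ h5).2 h7
  rw [← h6] at h8
  have h9 : γ t 0 = 0 := h8
  rw [hγt] at h9
  exact (ne_of_gt h0) h9

/-- Quotients by `ρ` are unique among continuous functions, because `ρ ≠ 0` on a dense set. This
makes local quotients glue and identifies factors. -/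
lemma eq_of_mul_rho_eq (hc : IsPatchEmbedding d c ρ) {U : Set N} (hU : IsOpen U) {f g : N → ℝ}
    (hf : ContinuousOn f U) (hg : ContinuousOn g U) (h : ∀ x ∈ U, f x * ρ x = g x * ρ x) {x : N}
    (hx : x ∈ U) : f x = g x := by
  have h1 : x ∈ closure (U ∩ {x | ρ x ≠ 0}) := hU.inter_closure ⟨hx, hc.dense_interior x⟩
  have h2 : EqOn f g (U ∩ {x | ρ x ≠ 0}) := fun y hy => mul_right_cancel₀ hy.2 (h y hy.1)
  have h3 := mem_closure_iff_nhdsWithin_neBot.1 h1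
  have h4 : Filter.Tendsto f (𝓝[U ∩ {x | ρ x ≠ 0}] x) (𝓝 (f x)) :=
    (hf x hx).mono_left (nhdsWithin_mono _ inter_subset_left)
  have h5 : Filter.Tendsto g (𝓝[U ∩ {x | ρ x ≠ 0}] x) (𝓝 (g x)) :=
    (hg x hx).mono_left (nhdsWithin_mono _ inter_subset_left)
  refine tendsto_nhds_unique h4 (h5.congr' ?_)
  filter_upwards [self_mem_nhdsWithin] with y hy using (h2 hy).symm

variable [IsManifold (𝓡∂ d) ∞ N]

/-- Off the boundary one divides. In a patch at a boundary point `ρ` is the first coordinate, and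
Hadamard's lemma in that direction gives `g(z) = g(z - z₀ e₀) + z₀ A(z) e₀`. The first term vanishes
because its argument lies on the boundary. -/
lemma exists_div_near (hc : IsPatchEmbedding d c ρ) (hρ : ContMDiff (𝓡∂ d) 𝓘(ℝ, ℝ) ∞ ρ)
    {g : N → ℝ} (hg : ContMDiff (𝓡∂ d) 𝓘(ℝ, ℝ) ∞ g) (h0 : ∀ x, ρ x = 0 → g x = 0) (x : N) :
    ∃ U : Set N, IsOpen U ∧ x ∈ U ∧ ∃ h : N → ℝ, ContMDiffOn (𝓡∂ d) 𝓘(ℝ, ℝ) ∞ h U ∧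
      ∀ y ∈ U, g y = h y * ρ y := by
  by_cases hx : ρ x ≠ 0
  · refine ⟨{y | ρ y ≠ 0}, isOpen_ne_fun hρ.continuous continuous_const, hx,
      fun y => g y * (ρ y)⁻¹, ?_, fun y hy => by
        rw [mul_assoc, inv_mul_cancel₀ hy, mul_one]⟩
    intro y hy
    have h1 : ContMDiffAt (𝓡∂ d) 𝓘(ℝ, ℝ) ∞ (fun y => (ρ y)⁻¹) y :=
      ((contDiffAt_inv ℝ hy).contMDiffAt).comp y (hρ y)
    exact ((hg y).mul h1).contMDiffWithinAt
  push Not at hx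
  obtain ⟨p, h1, h2, h3, h4⟩ := hc.exists_patch x
  set φ := extChartAt (𝓡∂ d) x with hφ
  have hz : φ x ∈ p.W := by rw [h2 x p.mem_O]; exact p.map_F x p.mem_O
  have hz0 : φ x 0 = 0 := by rw [h2 x p.mem_O]; exact (p.zero_iff x p.mem_O).2 hx
  obtain ⟨r, hr, hball⟩ := Metric.isOpen_iff.1 p.isOpen_W _ hz
  set e₀ : EuclideanSpace ℝ (Fin d) := EuclideanSpace.single 0 1 with he₀
  set T : EuclideanSpace ℝ (Fin d) →L[ℝ] EuclideanSpace ℝ (Fin d) :=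
    (firstCoord d).smulRight e₀ with hT
  have hTz : ∀ z, T z = z 0 • e₀ := fun z => rfl
  have hTT : ∀ z, (z - T z) 0 = 0 := fun z => by simp [hTz, he₀]
  -- A convex neighbourhood that is stable under `z ↦ z - T z`, as Hadamard's lemma requires; a ball
  -- about `φ x` is intersected with its preimage under this projection.
  set B : Set (EuclideanSpace ℝ (Fin d)) :=
    ball (φ x) r ∩ (fun z => z - T z) ⁻¹' ball (φ x) r with hB
  have hBo : IsOpen B := isOpen_ball.inter (isOpen_ball.preimage (by fun_prop))
  have hBx : φ x ∈ B := ⟨mem_ball_self hr, by simp [hTz, hz0, hr]⟩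
  set S : Set (EuclideanSpace ℝ (Fin d)) := {z | 0 ≤ z 0} ∩ B with hS
  have hlin : IsLinearMap ℝ fun z => z - T z :=
    ⟨fun z w => by rw [map_add]; abel, fun a z => by rw [map_smul, smul_sub]⟩
  have hconv : Convex ℝ S := by
    refine Convex.inter ?_ ((convex_ball (φ x) r).inter ?_)
    · exact convex_halfSpace_ge (f := fun z : EuclideanSpace ℝ (Fin d) => z 0) ⟨fun z w => rfl, fun a z => rfl⟩ 0
    · exact (convex_ball (φ x) r).is_linear_preimage hlin
  have hint : (interior S).Nonempty := by
    have hγ : Continuous fun t : ℝ => φ x + t • e₀ := by fun_prop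
    have h5 : ∀ᶠ t in 𝓝[>] (0 : ℝ), φ x + t • e₀ ∈ B :=
      nhdsWithin_le_nhds (hγ.continuousAt (hBo.mem_nhds (by simpa using hBx)))
    obtain ⟨t, ht, ht0⟩ := (h5.and self_mem_nhdsWithin).exists
    have h6 : IsOpen ({z : EuclideanSpace ℝ (Fin d) | 0 < z 0} ∩ B) :=
      (isOpen_lt continuous_const (firstCoord d).continuous).inter hBo
    have h7 : {z : EuclideanSpace ℝ (Fin d) | 0 < z 0} ∩ B ⊆ S :=
      inter_subset_inter_left _ fun z hz => le_of_lt (show (0 : ℝ) < z 0 from hz)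
    refine ⟨φ x + t • e₀, interior_maximal h7 h6 ⟨?_, ht⟩⟩
    have : (0 : ℝ) < t := ht0
    simpa [he₀, hz0] using this
  have hgc : ContDiffOn ℝ ∞ (g ∘ φ.symm) S := by
    have h5 : ContMDiffOn 𝓘(ℝ, EuclideanSpace ℝ (Fin d)) 𝓘(ℝ, ℝ) ∞ (g ∘ φ.symm) φ.target :=
      hg.comp_contMDiffOn (contMDiffOn_extChartAt_symm x)
    refine h5.contDiffOn.mono fun z hz => ?_
    rw [h3]
    exact ⟨hball hz.2.1, hz.1⟩
  have hTS : ∀ z ∈ S, z - T z ∈ S := by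
    intro z hz
    refine ⟨by rw [mem_ofPred_eq, hTT], hz.2.2, ?_⟩
    have : T (z - T z) = 0 := by rw [hTz, hTT, zero_smul]
    rw [mem_preimage, this, sub_zero]
    exact hz.2.2
  obtain ⟨A, hA1, hA2, -⟩ := hgc.exists_hadamard hconv (uniqueDiffOn_convex hconv hint) T hTS
  have hmem : ∀ z ∈ S, z ∈ φ.target := fun z hz => by rw [h3]; exact ⟨hball hz.2.1, hz.1⟩
  refine ⟨φ.source ∩ φ ⁻¹' B, (continuousOn_extChartAt x).isOpen_inter_preimage
    (isOpen_extChartAt_source x) hBo, ⟨mem_extChartAt_source x, hBx⟩,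
    fun y => A (φ y) e₀, ?_, ?_⟩
  · have h5 : ContDiffOn ℝ ∞ (fun z => A z e₀) S := hA1.clm_apply contDiffOn_const
    refine h5.contMDiffOn.comp ((contMDiffOn_extChartAt (I := 𝓡∂ d) (n := ∞)).mono fun y hy => ?_)
      fun y hy => ?_
    · rw [← extChartAt_source (𝓡∂ d)]; exact hy.1
    · refine ⟨?_, hy.2⟩
      have := φ.map_source hy.1
      rw [h3] at this
      exact this.2
  · intro y hy
    have hyS : φ y ∈ S := by
      refine ⟨?_, hy.2⟩
      have := φ.map_source hy.1
      rw [h3] at this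
      exact this.2
    have hyO : c y ∈ p.O := by have := hy.1; rw [h1] at this; exact this
    have h5 := hA2 _ hyS
    have h6 : g (φ.symm (φ y - T (φ y))) = 0 := by
      apply h0
      have h7 := hmem _ (hTS _ hyS)
      have h8 : φ.symm (φ y - T (φ y)) ∈ c ⁻¹' p.O := by rw [← h1]; exact φ.map_target h7
      rw [← p.zero_iff _ h8, ← h2 _ h8, φ.right_inv h7]
      exact hTT _
    have h7 : φ y 0 = ρ y := by rw [h2 _ hyO]; exact p.eq_rho hx y hyO
    rw [Function.comp_apply, Function.comp_apply, φ.left_inv hy.1, h6, zero_add, hTz, h7] at h5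
    rw [h5, map_smul, smul_eq_mul, mul_comm]

/-- A smooth function vanishing on the boundary is divisible by the boundary defining function. -/
lemma exists_div (hc : IsPatchEmbedding d c ρ) (hρ : ContMDiff (𝓡∂ d) 𝓘(ℝ, ℝ) ∞ ρ)
    {g : N → ℝ} (hg : ContMDiff (𝓡∂ d) 𝓘(ℝ, ℝ) ∞ g) (h0 : ∀ x, ρ x = 0 → g x = 0) :
    ∃ h : N → ℝ, ContMDiff (𝓡∂ d) 𝓘(ℝ, ℝ) ∞ h ∧ ∀ y, g y = h y * ρ y := by
  choose U hU hxU h hh hgh using hc.exists_div_near hρ hg h0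
  -- The local quotients agree on overlaps by density of the interior, so the diagonal choice `y ↦ h
  -- y y` is locally one of them.
  have key : ∀ x y, y ∈ U x → h y y = h x y := fun x y hy =>
    hc.eq_of_mul_rho_eq ((hU x).inter (hU y)) ((hh y).continuousOn.mono inter_subset_right)
      ((hh x).continuousOn.mono inter_subset_left)
      (fun z hz => by rw [← hgh y z hz.2, ← hgh x z hz.1]) ⟨hy, hxU y⟩
  refine ⟨fun y => h y y, fun x => ?_, fun y => hgh y y (hxU y)⟩
  refine ((hh x).contMDiffAt ((hU x).mem_nhds (hxU x))).congr_of_eventuallyEq ?_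
  filter_upwards [(hU x).mem_nhds (hxU x)] with y hy using key x y hy

/-- One direction tests on `ρ` itself. Conversely, if `dρ(v) = 0`, the straight line with velocity
`v` in a patch at `x` stays on the boundary near `x`; a function vanishing there vanishes along the
line, and its derivative along the line is its differential at `v`. -/
lemma isTangentToBoundary_iff (hc : IsPatchEmbedding d c ρ) (hρ : ContMDiff (𝓡∂ d) 𝓘(ℝ, ℝ) ∞ ρ)
    {x : N} (hx : ρ x = 0) (v : TangentSpace (𝓡∂ d) x) :
    IsTangentToBoundary (𝓡∂ d) x v ↔ mvderiv (𝓡∂ d) ρ x v = 0 := by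
  constructor
  · intro h
    refine h ρ (hρ x) (Filter.Eventually.of_forall fun y hy => ?_)
    rwa [hc.boundary_eq] at hy
  intro hv f hf hf0
  obtain ⟨p, h1, h2, h3, h4⟩ := hc.exists_patch x
  set φ := extChartAt (𝓡∂ d) x with hφ
  have hz : φ x ∈ p.W := by rw [h2 x p.mem_O]; exact p.map_F x p.mem_O
  have hz0 : φ x 0 = 0 := by rw [h2 x p.mem_O]; exact (p.zero_iff x p.mem_O).2 hx
  set w : EuclideanSpace ℝ (Fin d) := mvderiv (𝓡∂ d) φ x v with hw
  have hφd : MDifferentiableAt (𝓡∂ d) 𝓘(ℝ, EuclideanSpace ℝ (Fin d)) φ x :=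
    mdifferentiableAt_extChartAt (mem_chart_source _ x)
  have hw0 : w 0 = 0 := by
    have h5 : mvderiv (𝓡∂ d) (fun y => firstCoord d (φ y)) x v = firstCoord d w :=
      mvderiv_clm_comp _ hφd v
    have h6 : (fun y => firstCoord d (φ y)) =ᶠ[𝓝 x] ρ := by
      filter_upwards [(p.isOpen_O.preimage hc.isEmbedding.continuous).mem_nhds p.mem_O] with y hy
      rw [h2 y hy]
      exact p.eq_rho hx y hy
    rw [h6.mvderiv_eq, hv] at h5
    exact h5.symm
  have hd : HasFDerivWithinAt (f ∘ φ.symm) (fderivWithin ℝ (f ∘ φ.symm) (range (𝓡∂ d)) (φ x))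
      (range (𝓡∂ d)) (φ x) :=
    (((contMDiffAt_iff.1 hf).2).differentiableWithinAt (by simp)).hasFDerivWithinAt
  have hmain : mvderiv (𝓡∂ d) f x v =
      fderivWithin ℝ (f ∘ φ.symm) (range (𝓡∂ d)) (φ x) w := by
    have h5 : f =ᶠ[𝓝 x] fun y => (f ∘ φ.symm) (φ y) := by
      filter_upwards [extChartAt_source_mem_nhds (I := 𝓡∂ d) x] with y hy
      exact congrArg f (φ.left_inv hy).symm
    rw [h5.mvderiv_eq]
    have h6 := HasMFDerivWithinAt.comp x hd.hasMFDerivWithinAt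
      (hφd.hasMFDerivAt_mvderiv.hasMFDerivWithinAt (s := univ)) fun y _ => mem_range_self _
    rw [hasMFDerivWithinAt_univ] at h6
    exact congrArg (fun L : TangentSpace (𝓡∂ d) x →L[ℝ] ℝ => L v) h6.mvderiv_eq
  have hγ : HasDerivAt (fun t : ℝ => φ x + t • w) w 0 := by
    simpa using ((hasDerivAt_id (0 : ℝ)).smul_const w).const_add (φ x)
  have hγr : ∀ t : ℝ, φ x + t • w ∈ range (𝓡∂ d) := fun t => by
    rw [range_modelWithCornersEuclideanHalfSpace]
    simp [hz0, hw0]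
  have h7 : HasDerivAt (fun t : ℝ => (f ∘ φ.symm) (φ x + t • w))
      (fderivWithin ℝ (f ∘ φ.symm) (range (𝓡∂ d)) (φ x) w) 0 := by
    have := HasFDerivWithinAt.comp_hasDerivAt_of_eq (x := (0 : ℝ))
      (f := fun t : ℝ => φ x + t • w) hd hγ (Filter.Eventually.of_forall hγr) (by simp)
    exact this
  have h8 : (fun t : ℝ => (f ∘ φ.symm) (φ x + t • w)) =ᶠ[𝓝 0] fun _ => 0 := by
    have hct : Filter.Tendsto (fun t : ℝ => φ x + t • w) (𝓝 0) (𝓝[range (𝓡∂ d)] (φ x)) := by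
      refine tendsto_nhdsWithin_iff.2 ⟨?_, Filter.Eventually.of_forall hγr⟩
      simpa using hγ.continuousAt.tendsto
    have h9 : ∀ᶠ z in 𝓝[range (𝓡∂ d)] (φ x), φ.symm z ∈ {y | y ∈ (𝓡∂ d).boundary N → f y = 0} := by
      have h10 := (continuousAt_extChartAt_symm (I := 𝓡∂ d) x).tendsto
      rw [extChartAt_to_inv] at h10
      exact nhdsWithin_le_nhds (h10 hf0)
    filter_upwards [hct h9, hct (extChartAt_target_mem_nhdsWithin (I := 𝓡∂ d) x)] with t ht ht'
    apply ht
    rw [hc.boundary_eq, mem_ofPred_eq]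
    have h11 : φ.symm (φ x + t • w) ∈ c ⁻¹' p.O := by rw [← h1]; exact φ.map_target ht'
    rw [← p.zero_iff _ h11, ← h2 _ h11, φ.right_inv ht']
    simp [hz0, hw0]
  have h9 := h7.unique ((hasDerivAt_const (0 : ℝ) (0 : ℝ)).congr_of_eventuallyEq h8)
  exact hmain.trans h9

end IsPatchEmbedding

/-! ### Fibres of the b-tangent bundle: a tangent vector together with a factor. -/

namespace IsPatchEmbedding

universe u

variable {E : Type u} [NormedAddCommGroup E] [NormedSpace ℝ E] {N : Type*} [TopologicalSpace N]
  {d : ℕ} [NeZero d] [ChartedSpace (EuclideanHalfSpace d) N] {c : N → E} {ρ : N → ℝ}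

/-- A bump function of the finite dimensional ambient space, restricted along the embedding. -/
lemma exists_cutoff [FiniteDimensional ℝ E] (hc : IsPatchEmbedding d c ρ) {U : Set N}
    (hU : IsOpen U) {x : N} (hx : x ∈ U) :
    ∃ χ : N → ℝ, ContMDiff (𝓡∂ d) 𝓘(ℝ, ℝ) ∞ χ ∧ tsupport χ ⊆ U ∧ χ x = 1 := by
  obtain ⟨O, hO, rfl⟩ := hc.isEmbedding.isInducing.isOpen_iff.1 hU
  obtain ⟨r, hr, hball⟩ := Metric.isOpen_iff.1 hO _ hx
  let b : ContDiffBump (c x) := ⟨r / 4, r / 2, by positivity, by linarith⟩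
  refine ⟨fun y => b (c y), (b.contDiff.contMDiff).comp hc.contMDiff, ?_, ?_⟩
  · refine (tsupport_comp_subset_preimage b hc.isEmbedding.continuous).trans ?_
    rw [b.tsupport_eq]
    exact preimage_mono ((closedBall_subset_ball (show r / 2 < r by linarith)).trans hball)
  · exact b.one_of_mem_closedBall (mem_closedBall_self (by positivity))

variable [IsManifold (𝓡∂ d) ∞ N]

lemma mem_bVectorFields_iff (hc : IsPatchEmbedding d c ρ) (hρ : ContMDiff (𝓡∂ d) 𝓘(ℝ, ℝ) ∞ ρ)
    {V : ∀ x : N, TangentSpace (𝓡∂ d) x} :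
    V ∈ bVectorFields (𝓡∂ d) N ↔
      ContMDiff (𝓡∂ d) (𝓡∂ d).tangent ∞ (fun x => (⟨x, V x⟩ : TangentBundle (𝓡∂ d) N)) ∧
      ∀ x, ρ x = 0 → mvderiv (𝓡∂ d) ρ x (V x) = 0 := by
  refine and_congr_right fun _ => ?_
  rw [hc.boundary_eq]
  exact forall₂_congr fun x hx => hc.isTangentToBoundary_iff hρ hx (V x)

/-- Tangency says that `Vρ` vanishes on the boundary, so `ρ` divides it. The sign makes the factor
match the logarithmic derivative of `s`: along a fibre of `d` the product `s · (ρ ∘ r)` is constant.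
-/
lemma exists_bFactor (hc : IsPatchEmbedding d c ρ) (hρ : ContMDiff (𝓡∂ d) 𝓘(ℝ, ℝ) ∞ ρ)
    (V : bVectorFields (𝓡∂ d) N) :
    ∃ f : N → ℝ, ContMDiff (𝓡∂ d) 𝓘(ℝ, ℝ) ∞ f ∧
      ∀ x, mvderiv (𝓡∂ d) ρ x (V.1 x) = -(f x * ρ x) := by
  obtain ⟨h1, h2⟩ := (hc.mem_bVectorFields_iff hρ).1 V.2
  obtain ⟨f, hf, hfV⟩ := hc.exists_div hρ (contMDiff_mvderiv_apply hρ h1) h2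
  exact ⟨fun x => -f x, hf.neg, fun x => by rw [hfV]; ring⟩

/-- The smooth function `- V ρ / ρ` for a vector field `V` tangent to the boundary. -/
def bFactor (hc : IsPatchEmbedding d c ρ) (hρ : ContMDiff (𝓡∂ d) 𝓘(ℝ, ℝ) ∞ ρ)
    (V : bVectorFields (𝓡∂ d) N) : N → ℝ := (hc.exists_bFactor hρ V).choose

section

variable (hc : IsPatchEmbedding d c ρ) (hρ : ContMDiff (𝓡∂ d) 𝓘(ℝ, ℝ) ∞ ρ)

lemma contMDiff_bFactor (V : bVectorFields (𝓡∂ d) N) :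
    ContMDiff (𝓡∂ d) 𝓘(ℝ, ℝ) ∞ (hc.bFactor hρ V) := (hc.exists_bFactor hρ V).choose_spec.1

lemma mvderiv_rho_eq (V : bVectorFields (𝓡∂ d) N) (x : N) :
    mvderiv (𝓡∂ d) ρ x (V.1 x) = -(hc.bFactor hρ V x * ρ x) :=
  (hc.exists_bFactor hρ V).choose_spec.2 x

lemma bFactor_unique (V : bVectorFields (𝓡∂ d) N) {f : N → ℝ} (hf : Continuous f)
    (h : ∀ x, mvderiv (𝓡∂ d) ρ x (V.1 x) = -(f x * ρ x)) (x : N) : hc.bFactor hρ V x = f x := by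
  refine hc.eq_of_mul_rho_eq isOpen_univ (hc.contMDiff_bFactor hρ V).continuous.continuousOn
    hf.continuousOn (fun y _ => ?_) (mem_univ x)
  have := hc.mvderiv_rho_eq hρ V y
  rw [h y] at this
  linarith

/-- The value and the factor at a point of a vector field tangent to the boundary. -/
def bEval (x : N) : bVectorFields (𝓡∂ d) N →ₗ[ℝ] TangentSpace (𝓡∂ d) x × ℝ where
  toFun V := (V.1 x, hc.bFactor hρ V x)
  map_add' V W := by
    refine Prod.ext rfl ?_
    refine hc.bFactor_unique hρ (V + W) ((hc.contMDiff_bFactor hρ V).continuous.add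
      (hc.contMDiff_bFactor hρ W).continuous) (fun y => ?_) x
    have h : (V + W).1 y = V.1 y + W.1 y := rfl
    rw [h, map_add, hc.mvderiv_rho_eq hρ, hc.mvderiv_rho_eq hρ, Pi.add_apply]
    ring
  map_smul' a V := by
    refine Prod.ext rfl ?_
    refine hc.bFactor_unique hρ (a • V) ((hc.contMDiff_bFactor hρ V).continuous.const_smul a)
      (fun y => ?_) x
    have h : (a • V).1 y = a • V.1 y := rfl
    rw [h, map_smul, hc.mvderiv_rho_eq hρ, Pi.smul_apply, smul_eq_mul, smul_eq_mul]
    ring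

end

/-- The linear functional cutting out the values of `bEval`. -/
def bConstraint (ρ : N → ℝ) (x : N) : TangentSpace (𝓡∂ d) x × ℝ →ₗ[ℝ] ℝ :=
  (mvderiv (𝓡∂ d) ρ x).toLinearMap ∘ₗ LinearMap.fst ℝ _ _ + ρ x • LinearMap.snd ℝ _ _

omit [IsManifold (𝓡∂ d) ∞ N] in
lemma mem_ker_bConstraint {x : N} {q : TangentSpace (𝓡∂ d) x × ℝ} :
    q ∈ LinearMap.ker (bConstraint ρ x) ↔ mvderiv (𝓡∂ d) ρ x q.1 = -(q.2 * ρ x) := by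
  rw [LinearMap.mem_ker, eq_neg_iff_add_eq_zero, mul_comm]
  rfl

open Classical in
/-- The vector field with prescribed coordinates in the chart at `x`. -/
def localField (x : N) (Z : N → EuclideanSpace ℝ (Fin d)) (y : N) : TangentSpace (𝓡∂ d) y :=
  if y ∈ (extChartAt (𝓡∂ d) x).source then
    (mfderiv (𝓡∂ d) 𝓘(ℝ, EuclideanSpace ℝ (Fin d)) (extChartAt (𝓡∂ d) x) y).inverse (Z y)
  else 0

omit [IsManifold (𝓡∂ d) ∞ N] in
lemma localField_eq_zero {x y : N} {Z : N → EuclideanSpace ℝ (Fin d)} (hy : Z y = 0) :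
    localField x Z y = 0 := by
  rw [localField, hy]
  split_ifs
  · exact map_zero
      (mfderiv (𝓡∂ d) 𝓘(ℝ, EuclideanSpace ℝ (Fin d)) (extChartAt (𝓡∂ d) x) y).inverse
  · rfl

lemma mvderiv_extChartAt_localField {x y : N} (Z : N → EuclideanSpace ℝ (Fin d))
    (hy : y ∈ (extChartAt (𝓡∂ d) x).source) :
    mvderiv (𝓡∂ d) (extChartAt (𝓡∂ d) x) y (localField x Z y) = Z y := by
  rw [localField, if_pos hy]
  exact (isInvertible_mfderiv_extChartAt (I := 𝓡∂ d) hy).self_apply_inverse _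

lemma eq_of_mvderiv_extChartAt {x y : N} (hy : y ∈ (extChartAt (𝓡∂ d) x).source)
    {v w : TangentSpace (𝓡∂ d) y}
    (h : mvderiv (𝓡∂ d) (extChartAt (𝓡∂ d) x) y v = mvderiv (𝓡∂ d) (extChartAt (𝓡∂ d) x) y w) :
    v = w := (isInvertible_mfderiv_extChartAt (I := 𝓡∂ d) hy).injective h

lemma mdifferentiableAt_extChartAt_of_mem {x y : N} (hy : y ∈ (extChartAt (𝓡∂ d) x).source) :
    MDifferentiableAt (𝓡∂ d) 𝓘(ℝ, EuclideanSpace ℝ (Fin d)) (extChartAt (𝓡∂ d) x) y :=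
  mdifferentiableAt_extChartAt (by rwa [← extChartAt_source (𝓡∂ d)])

lemma mvderiv_rho_eq_coord (hc : IsPatchEmbedding d c ρ) {x y : N} (hx : ρ x = 0)
    (hy : y ∈ (extChartAt (𝓡∂ d) x).source) (v : TangentSpace (𝓡∂ d) y) :
    mvderiv (𝓡∂ d) ρ y v = mvderiv (𝓡∂ d) (extChartAt (𝓡∂ d) x) y v 0 := by
  obtain ⟨p, h1, h2, h3, h4⟩ := hc.exists_patch x
  have h5 : mvderiv (𝓡∂ d) (fun y => firstCoord d (extChartAt (𝓡∂ d) x y)) y v =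
      firstCoord d (mvderiv (𝓡∂ d) (extChartAt (𝓡∂ d) x) y v) :=
    mvderiv_clm_comp _ (mdifferentiableAt_extChartAt_of_mem hy) v
  have h6 : (fun y => firstCoord d (extChartAt (𝓡∂ d) x y)) =ᶠ[𝓝 y] ρ := by
    filter_upwards [(isOpen_extChartAt_source (I := 𝓡∂ d) x).mem_nhds hy] with z hz
    rw [h1] at hz
    rw [h2 z hz]
    exact p.eq_rho hx z hz
  rw [h6.mvderiv_eq] at h5
  exact h5

/-- On the source of the chart `c` is `p.G` of the chart, so `c` has derivative `fderiv ℝ p.G` of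
`Z` along the field; elsewhere the field vanishes near each point. -/
lemma contMDiff_localField (hc : IsPatchEmbedding d c ρ) {x : N} {Z : N → EuclideanSpace ℝ (Fin d)}
    (hZ : ContMDiff (𝓡∂ d) 𝓘(ℝ, EuclideanSpace ℝ (Fin d)) ∞ Z)
    (hs : tsupport Z ⊆ (extChartAt (𝓡∂ d) x).source) :
    ContMDiff (𝓡∂ d) (𝓡∂ d).tangent ∞
      (fun y => (⟨y, localField x Z y⟩ : TangentBundle (𝓡∂ d) N)) := by
  obtain ⟨p, h1, h2, h3, h4⟩ := hc.exists_patch x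
  refine hc.contMDiff_tangent_of_comp (f := fun y => y) hc.contMDiff fun y => ?_
  by_cases hy : y ∈ (extChartAt (𝓡∂ d) x).source
  · have hW : ∀ z ∈ (extChartAt (𝓡∂ d) x).source, extChartAt (𝓡∂ d) x z ∈ p.W := by
      intro z hz
      have := (extChartAt (𝓡∂ d) x).map_source hz
      rw [h3] at this
      exact this.1
    have key : ∀ z ∈ (extChartAt (𝓡∂ d) x).source, mvderiv (𝓡∂ d) c z (localField x Z z) =
        fderiv ℝ p.G (extChartAt (𝓡∂ d) x z) (Z z) := by
      intro z hz
      have h5 : c =ᶠ[𝓝 z] fun y => p.G (extChartAt (𝓡∂ d) x y) := by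
        filter_upwards [(isOpen_extChartAt_source (I := 𝓡∂ d) x).mem_nhds hz] with w hw
        have hw' := (extChartAt (𝓡∂ d) x).map_source hw
        rw [h3] at hw'
        rw [← h4 _ hw'.1 hw'.2, (extChartAt (𝓡∂ d) x).left_inv hw]
      rw [h5.mvderiv_eq, mvderiv_fderiv_comp
        ((p.smooth_G.contDiffAt (p.isOpen_W.mem_nhds (hW z hz))).differentiableAt (by simp))
        (mdifferentiableAt_extChartAt_of_mem hz), mvderiv_extChartAt_localField Z hz]
    have h6 : ContMDiffAt (𝓡∂ d) 𝓘(ℝ, E) ∞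
        (fun z => fderiv ℝ p.G (extChartAt (𝓡∂ d) x z) (Z z)) y := by
      have h7 : ContDiffAt ℝ ∞ (fderiv ℝ p.G) (extChartAt (𝓡∂ d) x y) :=
        (p.smooth_G.contDiffAt (p.isOpen_W.mem_nhds (hW y hy))).fderiv_right (m := ∞) (by simp)
      have h8 : ContMDiffAt (𝓡∂ d) 𝓘(ℝ, EuclideanSpace ℝ (Fin d)) ∞ (extChartAt (𝓡∂ d) x) y :=
        contMDiffAt_extChartAt' (by rwa [← extChartAt_source (𝓡∂ d)])
      exact (h7.contMDiffAt.comp y h8).clm_apply (hZ y)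
    refine h6.congr_of_eventuallyEq ?_
    filter_upwards [(isOpen_extChartAt_source (I := 𝓡∂ d) x).mem_nhds hy] with z hz using key z hz
  · have h5 : ∀ᶠ z in 𝓝 y, Z z = 0 := by
      filter_upwards [(isClosed_tsupport Z).isOpen_compl.mem_nhds fun h => hy (hs h)] with z hz
      exact image_eq_zero_of_notMem_tsupport hz
    refine (contMDiffAt_const (c := (0 : E))).congr_of_eventuallyEq ?_
    filter_upwards [h5] with z hz
    rw [localField_eq_zero hz, map_zero]

/-- If the coordinates of `V` near `x` are `a k * r k`, with `a k` vanishing at `x` and the fields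
`r k ∂_k` tangent to the boundary, then `V` is a combination of such fields with coefficients
vanishing at `x`. -/
lemma mem_bVanishing_of_coord {x : N} (V : bVectorFields (𝓡∂ d) N) {χ : N → ℝ} (hχ : ContMDiff (𝓡∂ d) 𝓘(ℝ, ℝ) ∞ χ)
    (hχs : tsupport χ ⊆ (extChartAt (𝓡∂ d) x).source) (hχ1 : χ x = 1)
    (r a : Fin d → N → ℝ) (ha : ∀ k, ContMDiff (𝓡∂ d) 𝓘(ℝ, ℝ) ∞ (fun y => χ y * a k y))
    (ha0 : ∀ k, a k x = 0)
    (hr : ∀ k, localField x (fun y => χ y • r k y • EuclideanSpace.single k 1) ∈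
      bVectorFields (𝓡∂ d) N)
    (hV : ∀ y ∈ (extChartAt (𝓡∂ d) x).source, ∀ k,
      mvderiv (𝓡∂ d) (extChartAt (𝓡∂ d) x) y (V.1 y) k = a k y * r k y) :
    V ∈ bVanishing (𝓡∂ d) N x := by
  set X : Fin d → bVectorFields (𝓡∂ d) N := fun k => ⟨_, hr k⟩ with hX
  have hsmul : ∀ (f : N → ℝ), ContMDiff (𝓡∂ d) 𝓘(ℝ, ℝ) ∞ f → ∀ U : bVectorFields (𝓡∂ d) N,
      (fun y => f y • U.1 y) ∈ bVectorFields (𝓡∂ d) N := by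
    intro f hf U
    refine ⟨hf.smul_section U.2.1, fun y hy g hg h0 => ?_⟩
    have := U.2.2 y hy g hg h0
    rw [map_smul, this, smul_zero]
  have h1 : ContMDiff (𝓡∂ d) 𝓘(ℝ, ℝ) ∞ (fun y => 1 - χ y * χ y) :=
    contMDiff_const.sub (hχ.mul hχ)
  -- With `X k = χ r_k ∂_k` this is the identity `V = (1 - χ²) V + ∑ (χ a_k) X_k`. The square of the
  -- cutoff appears because one `χ` makes the field global and the other makes its coefficient
  -- global. All coefficients vanish at `x`.
  have hsum : V = ⟨_, hsmul _ h1 V⟩ + ∑ k, (⟨_, hsmul _ (ha k) (X k)⟩ : bVectorFields (𝓡∂ d) N) := by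
    apply Subtype.ext
    funext y
    rw [Submodule.coe_add, Submodule.coe_sum, Pi.add_apply, Finset.sum_apply]
    by_cases hy : y ∈ (extChartAt (𝓡∂ d) x).source
    · apply eq_of_mvderiv_extChartAt hy
      rw [map_add, map_sum]
      ext j
      have h2 : ∀ k, mvderiv (𝓡∂ d) (extChartAt (𝓡∂ d) x) y ((χ y * a k y) • (X k).1 y) =
          (χ y * a k y) • χ y • r k y • EuclideanSpace.single k 1 := by
        intro k
        rw [map_smul]
        exact congrArg _ (mvderiv_extChartAt_localField
          (fun y => χ y • r k y • EuclideanSpace.single k (1 : ℝ)) hy)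
      rw [Finset.sum_congr rfl fun k _ => h2 k, map_smul]
      have h3 := hV y hy j
      simp only [PiLp.add_apply, PiLp.smul_apply, smul_eq_mul, h3]
      rw [WithLp.ofLp_sum, Finset.sum_apply, Finset.sum_eq_single j]
      · simp; ring
      · intro k _ hk
        simp [hk.symm]
      · simp
    · have h0 : χ y = 0 := image_eq_zero_of_notMem_tsupport fun h => hy (hχs h)
      simp [h0]
  rw [hsum]
  refine Submodule.add_mem _ (Submodule.subset_span ⟨_, h1, by simp [hχ1], V, fun y => rfl⟩)
    (Submodule.sum_mem _ fun k _ => Submodule.subset_span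
      ⟨_, ha k, by simp [ha0], X k, fun y => rfl⟩)

variable [FiniteDimensional ℝ E]

/-- At a boundary point the constraint forces `w 0 = 0`, so the field with coordinates `w - a ρ e₀`,
cut off, has factor `χ a` and the prescribed value. Off the boundary any field with value `v` that
is supported away from the boundary will do, since dividing by `ρ x` determines the factor at `x`.
-/
lemma exists_bEval_eq (hc : IsPatchEmbedding d c ρ) (hρ : ContMDiff (𝓡∂ d) 𝓘(ℝ, ℝ) ∞ ρ) {x : N}
    (v : TangentSpace (𝓡∂ d) x) (a : ℝ) (h : mvderiv (𝓡∂ d) ρ x v = -(a * ρ x)) :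
    ∃ V : bVectorFields (𝓡∂ d) N, hc.bEval hρ x V = (v, a) := by
  set w := mvderiv (𝓡∂ d) (extChartAt (𝓡∂ d) x) x v with hw
  have hxs := mem_extChartAt_source (I := 𝓡∂ d) x
  have hso := isOpen_extChartAt_source (I := 𝓡∂ d) x
  by_cases hx : ρ x = 0
  · obtain ⟨χ, hχ, hχs, hχ1⟩ := hc.exists_cutoff hso hxs
    set Z : N → EuclideanSpace ℝ (Fin d) :=
      fun y => χ y • (w - (a * ρ y) • EuclideanSpace.single 0 1) with hZ
    have hw0 : w 0 = 0 := by
      rw [hw, ← hc.mvderiv_rho_eq_coord hx hxs, h, hx]; simp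
    have hZs : ContMDiff (𝓡∂ d) 𝓘(ℝ, EuclideanSpace ℝ (Fin d)) ∞ Z :=
      hχ.smul (contMDiff_const.sub ((contMDiff_const.mul hρ).smul contMDiff_const))
    have hZt : tsupport Z ⊆ (extChartAt (𝓡∂ d) x).source :=
      (tsupport_smul_subset_left χ _).trans hχs
    have hdZ : ∀ y, mvderiv (𝓡∂ d) ρ y (localField x Z y) = -((χ y * a) * ρ y) := by
      intro y
      by_cases hy : y ∈ (extChartAt (𝓡∂ d) x).source
      · rw [hc.mvderiv_rho_eq_coord hx hy, mvderiv_extChartAt_localField Z hy]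
        simp [hZ, hw0]; ring
      · have : χ y = 0 := image_eq_zero_of_notMem_tsupport fun h => hy (hχs h)
        rw [localField, if_neg hy, map_zero, this]; ring
    set V : bVectorFields (𝓡∂ d) N := ⟨localField x Z, (hc.mem_bVectorFields_iff hρ).2
      ⟨hc.contMDiff_localField hZs hZt, fun y hy => by rw [hdZ, hy]; ring⟩⟩
    refine ⟨V, Prod.ext ?_ ?_⟩
    · apply eq_of_mvderiv_extChartAt hxs
      refine (mvderiv_extChartAt_localField Z hxs).trans ?_
      simp [hZ, hχ1, hx, hw]
    · refine (hc.bFactor_unique hρ V (hχ.continuous.mul continuous_const) hdZ x).trans ?_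
      simp [hχ1]
  · obtain ⟨χ, hχ, hχs, hχ1⟩ := hc.exists_cutoff
      (hso.inter (isOpen_ne_fun hρ.continuous continuous_const)) ⟨hxs, hx⟩
    set Z : N → EuclideanSpace ℝ (Fin d) := fun y => χ y • w with hZ
    have hZs : ContMDiff (𝓡∂ d) 𝓘(ℝ, EuclideanSpace ℝ (Fin d)) ∞ Z := hχ.smul contMDiff_const
    have hZt : tsupport Z ⊆ (extChartAt (𝓡∂ d) x).source :=
      (tsupport_smul_subset_left χ _).trans (hχs.trans inter_subset_left)
    set V : bVectorFields (𝓡∂ d) N := ⟨localField x Z, (hc.mem_bVectorFields_iff hρ).2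
      ⟨hc.contMDiff_localField hZs hZt, fun y hy => by
        have h0 : χ y = 0 := image_eq_zero_of_notMem_tsupport fun h => (hχs h).2 hy
        rw [localField_eq_zero (by simp [hZ, h0]), map_zero]⟩⟩ with hV
    have hVx : V.1 x = v := by
      apply eq_of_mvderiv_extChartAt hxs
      refine (mvderiv_extChartAt_localField Z hxs).trans ?_
      simp [hZ, hχ1, hw]
    refine ⟨V, Prod.ext hVx ?_⟩
    have h1 := hc.mvderiv_rho_eq hρ V x
    rw [hVx, h, neg_inj] at h1
    exact (mul_right_cancel₀ hx h1).symm

/-- Near a boundary point the fields tangent to the boundary are generated by `ρ ∂_0` and the `∂_k`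
with `k ≠ 0`. The coefficients of `V` are minus its factor and its coordinates, and the hypothesis
says that these vanish at `x`. Near other points all the `∂_k` serve. -/
lemma mem_bVanishing_of_bEval_eq_zero (hc : IsPatchEmbedding d c ρ)
    (hρ : ContMDiff (𝓡∂ d) 𝓘(ℝ, ℝ) ∞ ρ) {x : N} {V : bVectorFields (𝓡∂ d) N}
    (h : hc.bEval hρ x V = 0) : V ∈ bVanishing (𝓡∂ d) N x := by
  have hVx : V.1 x = 0 := congrArg Prod.fst h
  have hfx : hc.bFactor hρ V x = 0 := congrArg Prod.snd h
  have hxs := mem_extChartAt_source (I := 𝓡∂ d) x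
  have hso := isOpen_extChartAt_source (I := 𝓡∂ d) x
  have hcoord : ∀ (χ : N → ℝ), ContMDiff (𝓡∂ d) 𝓘(ℝ, ℝ) ∞ χ →
      tsupport χ ⊆ (extChartAt (𝓡∂ d) x).source → ∀ k, ContMDiff (𝓡∂ d) 𝓘(ℝ, ℝ) ∞
        (fun y => χ y * mvderiv (𝓡∂ d) (extChartAt (𝓡∂ d) x) y (V.1 y) k) := by
    intro χ hχ hχs k y
    by_cases hy : y ∈ (extChartAt (𝓡∂ d) x).source
    · obtain ⟨p, h1, h2, h3, h4⟩ := hc.exists_patch x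
      have hyO : c y ∈ p.O := by rw [h1] at hy; exact hy
      have h5 : ContDiffAt ℝ ∞ (fderiv ℝ p.F) (c y) :=
        (p.smooth_F.contDiffAt (p.isOpen_O.mem_nhds hyO)).fderiv_right (m := ∞) (by simp)
      have h6 : ContMDiffAt (𝓡∂ d) 𝓘(ℝ, EuclideanSpace ℝ (Fin d)) ∞
          (fun z => fderiv ℝ p.F (c z) (mvderiv (𝓡∂ d) c z (V.1 z))) y :=
        (h5.contMDiffAt.comp y (hc.contMDiff y)).clm_apply
          (contMDiff_mvderiv_apply hc.contMDiff V.2.1 y)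
      have h7 : ContMDiffAt (𝓡∂ d) 𝓘(ℝ, ℝ) ∞
          (fun z => EuclideanSpace.proj (𝕜 := ℝ) k
            (fderiv ℝ p.F (c z) (mvderiv (𝓡∂ d) c z (V.1 z)))) y :=
        (EuclideanSpace.proj (𝕜 := ℝ) k).contDiff.contMDiff.contMDiffAt.comp y h6
      refine ((hχ y).mul h7).congr_of_eventuallyEq ?_
      filter_upwards [hso.mem_nhds hy] with z hz
      rw [h1] at hz
      exact congrArg (fun w : EuclideanSpace ℝ (Fin d) => χ z * w k)
        (hc.mfderiv_extChartAt_eq p h2 hz (V.1 z))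
    · refine (contMDiffAt_const (c := (0 : ℝ))).congr_of_eventuallyEq ?_
      filter_upwards [(isClosed_tsupport χ).isOpen_compl.mem_nhds fun h => hy (hχs h)] with z hz
      have : χ z = 0 := image_eq_zero_of_notMem_tsupport hz
      simp [this]
  have hcoord0 : mvderiv (𝓡∂ d) (extChartAt (𝓡∂ d) x) x (V.1 x) = 0 := by rw [hVx, map_zero]
  have hZt : ∀ (χ : N → ℝ) (Y : N → EuclideanSpace ℝ (Fin d)),
      tsupport χ ⊆ (extChartAt (𝓡∂ d) x).source →
      tsupport (fun y => χ y • Y y) ⊆ (extChartAt (𝓡∂ d) x).source :=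
    fun χ Y hχs => (tsupport_smul_subset_left χ _).trans hχs
  by_cases hx : ρ x = 0
  · obtain ⟨χ, hχ, hχs, hχ1⟩ := hc.exists_cutoff hso hxs
    refine mem_bVanishing_of_coord V hχ hχs hχ1 (fun k => if k = 0 then ρ else fun _ => 1)
      (fun k => if k = 0 then fun y => -hc.bFactor hρ V y else
        fun y => mvderiv (𝓡∂ d) (extChartAt (𝓡∂ d) x) y (V.1 y) k) ?_ ?_ ?_ ?_
    · intro k
      by_cases hk : k = 0
      · simp only [hk, if_true]
        exact hχ.mul (hc.contMDiff_bFactor hρ V).neg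
      · simp only [hk, if_false]
        exact hcoord χ hχ hχs k
    · intro k
      by_cases hk : k = 0
      · simp [hk, hfx]
      · simp only [hk, if_false]
        exact congrArg (fun w : EuclideanSpace ℝ (Fin d) => w k) hcoord0
    · intro k
      have hrs : ContMDiff (𝓡∂ d) 𝓘(ℝ, ℝ) ∞ (if k = 0 then ρ else fun _ => 1) := by
        split_ifs
        · exact hρ
        · exact contMDiff_const
      refine (hc.mem_bVectorFields_iff hρ).2
        ⟨hc.contMDiff_localField (hχ.smul (hrs.smul contMDiff_const)) (hZt χ _ hχs),
          fun y hy => ?_⟩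
      by_cases hys : y ∈ (extChartAt (𝓡∂ d) x).source
      · rw [hc.mvderiv_rho_eq_coord hx hys, mvderiv_extChartAt_localField _ hys]
        by_cases hk : k = 0
        · simp [hk, hy]
        · simp [Ne.symm hk]
      · have h0 : χ y = 0 := image_eq_zero_of_notMem_tsupport fun h => hys (hχs h)
        rw [localField_eq_zero (by simp [h0]), map_zero]
    · intro y hy k
      by_cases hk : k = 0
      · simp only [hk, if_true]
        rw [← hc.mvderiv_rho_eq_coord hx hy, hc.mvderiv_rho_eq hρ]
        ring
      · simp [hk]
  · obtain ⟨χ, hχ, hχs, hχ1⟩ := hc.exists_cutoff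
      (hso.inter (isOpen_ne_fun hρ.continuous continuous_const)) ⟨hxs, hx⟩
    have hχs' := hχs.trans inter_subset_left
    refine mem_bVanishing_of_coord V hχ hχs' hχ1 (fun _ _ => 1)
      (fun k y => mvderiv (𝓡∂ d) (extChartAt (𝓡∂ d) x) y (V.1 y) k) (hcoord χ hχ hχs') ?_ ?_ ?_
    · intro k
      exact congrArg (fun w : EuclideanSpace ℝ (Fin d) => w k) hcoord0
    · intro k
      refine (hc.mem_bVectorFields_iff hρ).2
        ⟨hc.contMDiff_localField (hχ.smul contMDiff_const) (hZt χ _ hχs'), fun y hy => ?_⟩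
      have h0 : χ y = 0 := image_eq_zero_of_notMem_tsupport fun h => (hχs h).2 hy
      rw [localField_eq_zero (by simp [h0]), map_zero]
    · intro y _ k
      rw [mul_one]

variable (hc : IsPatchEmbedding d c ρ) (hρ : ContMDiff (𝓡∂ d) 𝓘(ℝ, ℝ) ∞ ρ)

omit [FiniteDimensional ℝ E] in
lemma bEval_eq_zero_of_mem_bVanishing {x : N} {W : bVectorFields (𝓡∂ d) N}
    (hW : W ∈ bVanishing (𝓡∂ d) N x) : hc.bEval hρ x W = 0 := by
  suffices h : bVanishing (𝓡∂ d) N x ≤ LinearMap.ker (hc.bEval hρ x) from h hW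
  refine Submodule.span_le.2 ?_
  rintro W ⟨f, hf, hfx, V, hV⟩
  refine Prod.ext ?_ ?_
  · exact (hV x).trans (by rw [hfx, zero_smul]; rfl)
  · refine (hc.bFactor_unique hρ W (hf.continuous.mul (hc.contMDiff_bFactor hρ V).continuous)
      (fun y => ?_) x).trans (by simp [hfx])
    rw [hV, map_smul, hc.mvderiv_rho_eq hρ, smul_eq_mul, Pi.mul_apply]
    ring

omit [FiniteDimensional ℝ E] in
lemma bEval_mem_ker (x : N) (V : bVectorFields (𝓡∂ d) N) :
    hc.bEval hρ x V ∈ LinearMap.ker (bConstraint ρ x) :=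
  mem_ker_bConstraint.2 (hc.mvderiv_rho_eq hρ V x)

/-- The fibre of the b-tangent bundle at `x`: a tangent vector and a factor. -/
def bIso (x : N) : bTangentFibre (𝓡∂ d) x ≃ₗ[ℝ] LinearMap.ker (bConstraint (d := d) ρ x) :=
  LinearEquiv.ofBijective
    ((bVanishing (𝓡∂ d) N x).liftQ
      ((hc.bEval hρ x).codRestrict (LinearMap.ker (bConstraint ρ x))
        (hc.bEval_mem_ker hρ x))
      fun W hW => Subtype.ext (hc.bEval_eq_zero_of_mem_bVanishing hρ hW)) (by
    constructor
    · refine (injective_iff_map_eq_zero _).2 fun q hq => ?_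
      obtain ⟨V, rfl⟩ := (bVanishing (𝓡∂ d) N x).mkQ_surjective q
      exact (Submodule.Quotient.mk_eq_zero _).2
        (hc.mem_bVanishing_of_bEval_eq_zero hρ (congrArg Subtype.val hq))
    · rintro ⟨⟨v, a⟩, h⟩
      obtain ⟨V, hV⟩ := hc.exists_bEval_eq hρ v a (mem_ker_bConstraint.1 h)
      exact ⟨bValue (𝓡∂ d) V x, Subtype.ext hV⟩)

lemma bIso_bValue (V : bVectorFields (𝓡∂ d) N) (x : N) :
    (hc.bIso hρ x (bValue (𝓡∂ d) V x)).1 = (V.1 x, hc.bFactor hρ V x) := rfl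

lemma bAnchor_eq (x : N) (q : bTangentFibre (𝓡∂ d) x) :
    bAnchor (𝓡∂ d) x q = (hc.bIso hρ x q).1.1 := by
  obtain ⟨V, rfl⟩ := (bVanishing (𝓡∂ d) N x).mkQ_surjective q
  rfl

end IsPatchEmbedding

/-! ### Curves with prescribed velocity. -/

namespace IsPatchEmbedding

universe u

variable {E : Type u} [NormedAddCommGroup E] [NormedSpace ℝ E] {N : Type*} [TopologicalSpace N]
  {d : ℕ} [NeZero d] [ChartedSpace (EuclideanHalfSpace d) N] {c : N → E} {ρ : N → ℝ}
  [IsManifold (𝓡∂ d) ∞ N]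

lemma exists_mvderiv_rho_eq_one (hc : IsPatchEmbedding d c ρ) {x : N} (hx : ρ x = 0) :
    ∃ v : TangentSpace (𝓡∂ d) x, mvderiv (𝓡∂ d) ρ x v = 1 := by
  have hxs := mem_extChartAt_source (I := 𝓡∂ d) x
  refine ⟨localField x (fun _ => EuclideanSpace.single 0 1) x, ?_⟩
  rw [hc.mvderiv_rho_eq_coord hx hxs, mvderiv_extChartAt_localField _ hxs]
  simp

/-- A curve in the manifold with prescribed velocity, staying on the boundary if the velocity is
tangent to it. -/
lemma exists_curve (hc : IsPatchEmbedding d c ρ) {x : N} (v : TangentSpace (𝓡∂ d) x)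
    (hv : ρ x = 0 → mvderiv (𝓡∂ d) ρ x v = 0) :
    ∃ μ : ℝ → N, μ 0 = x ∧ ContDiffAt ℝ ∞ (fun t => c (μ t)) 0 ∧
      HasDerivAt (fun t => c (μ t)) (mvderiv (𝓡∂ d) c x v) 0 ∧
      (ρ x = 0 → ∀ᶠ t in 𝓝 0, ρ (μ t) = 0) := by
  obtain ⟨p, h1, h2, h3, h4⟩ := hc.exists_patch x
  set φ := extChartAt (𝓡∂ d) x with hφ
  have hxs : x ∈ φ.source := mem_extChartAt_source (I := 𝓡∂ d) x
  have hz : φ x ∈ p.W := by rw [h2 x p.mem_O]; exact p.map_F x p.mem_O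
  set w : EuclideanSpace ℝ (Fin d) := mvderiv (𝓡∂ d) φ x v with hw
  have hγc : Continuous (fun t : ℝ => φ x + t • w) := by fun_prop
  have hW : ∀ᶠ t in 𝓝 (0 : ℝ), φ x + t • w ∈ p.W :=
    hγc.continuousAt (p.isOpen_W.mem_nhds (by simpa using hz))
  -- A curve defined on both sides of `0` must not leave the half space: at a boundary point the
  -- line remains in the boundary because `v` is tangent to it, and at an interior point the first
  -- coordinate stays positive for small times.
  have hnn : ∀ᶠ t in 𝓝 (0 : ℝ), 0 ≤ (φ x + t • w) 0 ∧
      (ρ x = 0 → (φ x + t • w) 0 = 0) := by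
    have hxz : ρ x = 0 ↔ φ x 0 = 0 := by rw [h2 x p.mem_O]; exact (p.zero_iff x p.mem_O).symm
    by_cases hx : ρ x = 0
    · have hw0 : w 0 = 0 := by rw [hw, ← hc.mvderiv_rho_eq_coord hx hxs, hv hx]
      have : ∀ t : ℝ, (φ x + t • w) 0 = 0 := fun t => by simp [hw0, hxz.1 hx]
      exact Filter.Eventually.of_forall fun t => ⟨(this t).ge, fun _ => this t⟩
    · have h0 : 0 < φ x 0 := by
        have h5 : 0 ≤ φ x 0 := by rw [h2 x p.mem_O]; exact p.nonneg x p.mem_O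
        exact lt_of_le_of_ne h5 fun h => hx (hxz.2 h.symm)
      have hc' : ContinuousAt (fun t : ℝ => (φ x + t • w) 0) 0 :=
        ((EuclideanSpace.proj (𝕜 := ℝ) 0).continuous.comp hγc).continuousAt
      filter_upwards [hc' (lt_mem_nhds (by simpa using h0))] with t ht
      exact ⟨le_of_lt ht, fun h => absurd h hx⟩
  have hev : (fun t => c (φ.symm (φ x + t • w))) =ᶠ[𝓝 0] fun t : ℝ => p.G (φ x + t • w) := by
    filter_upwards [hW, hnn] with t ht hn using h4 _ ht hn.1
  have hG : ContDiffAt ℝ ∞ p.G (φ x) := p.smooth_G.contDiffAt (p.isOpen_W.mem_nhds hz)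
  have hderiv : mvderiv (𝓡∂ d) c x v = fderiv ℝ p.G (φ x) w := by
    have h5 : c =ᶠ[𝓝 x] fun y => p.G (φ y) := by
      filter_upwards [(isOpen_extChartAt_source (I := 𝓡∂ d) x).mem_nhds hxs] with y hy
      have hy' := φ.map_source hy
      rw [h3] at hy'
      rw [← h4 _ hy'.1 hy'.2, φ.left_inv hy]
    rw [h5.mvderiv_eq, mvderiv_fderiv_comp (hG.differentiableAt (by simp))
      (mdifferentiableAt_extChartAt_of_mem hxs)]
  refine ⟨fun t => φ.symm (φ x + t • w), ?_, ?_, ?_, ?_⟩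
  · change φ.symm (φ x + (0 : ℝ) • w) = x
    rw [zero_smul, add_zero]; exact extChartAt_to_inv x
  · refine ContDiffAt.congr_of_eventuallyEq ?_ hev
    exact ContDiffAt.comp (0 : ℝ) (by simpa using hG) (by fun_prop)
  · refine HasDerivAt.congr_of_eventuallyEq ?_ hev
    have h6 : HasDerivAt (fun t : ℝ => φ x + t • w) w 0 := by
      simpa using ((hasDerivAt_id (0 : ℝ)).smul_const w).const_add (φ x)
    rw [hderiv]
    exact HasFDerivAt.comp_hasDerivAt_of_eq (0 : ℝ) (hG.differentiableAt (by simp)).hasFDerivAt h6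
      (by simp)
  · intro hx
    filter_upwards [hW, hnn] with t ht hn
    have h5 : φ x + t • w ∈ φ.target := by rw [h3]; exact ⟨ht, hn.1⟩
    have h6 : φ.symm (φ x + t • w) ∈ c ⁻¹' p.O := by rw [← h1]; exact φ.map_target h5
    rw [← p.zero_iff _ h6, ← h2 _ h6, φ.right_inv h5]
    exact hn.2 hx

end IsPatchEmbedding

/-! ### Groupoids embedded by range, domain and ratio: structure maps and tangent spaces. -/

namespace GroupoidData

universe u

variable {E : Type u} [NormedAddCommGroup E] [NormedSpace ℝ E]
  {k k' : ℕ} [NeZero k] [NeZero k']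
  {M : Type*} [TopologicalSpace M] [ChartedSpace (EuclideanHalfSpace k) M]
  {G : Type*} [TopologicalSpace G] [ChartedSpace (EuclideanHalfSpace k') G]

/-- The data `(r, d, s)` of an arrow, after embedding the units by `e`. -/
def arrowEmbedding (𝒢 : GroupoidData G M) (e : M → E) (s : G → ℝ) (g : G) : (E × E) × ℝ :=
  ((e (𝒢.r g), e (𝒢.d g)), s g)

variable (k k') in
/-- A groupoid whose arrows are determined by their range, domain, and the ratio `s` of the
values of the boundary defining function `ρ` at the domain and the range. -/
structure IsBGroupoid (𝒢 : GroupoidData G M) (e : M → E) (ρ : M → ℝ) (s : G → ℝ) : Prop where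
  patch_units : IsPatchEmbedding k e ρ
  patch_arrows : IsPatchEmbedding k' (𝒢.arrowEmbedding e s) (fun g => ρ (𝒢.r g))
  dim_eq : k' = 2 * k
  smooth_rho : ContMDiff (𝓡∂ k) 𝓘(ℝ, ℝ) ∞ ρ
  isGroupoid : 𝒢.IsGroupoid
  s_pos : ∀ g, 0 < s g
  rho_d : ∀ g, ρ (𝒢.d g) = s g * ρ (𝒢.r g)
  s_mul : ∀ g h, 𝒢.d g = 𝒢.r h → s (𝒢.mul g h) = s g * s h
  -- The next two conditions say that arrows fill enough of the locus `ρ(d) = s ρ(r)`: off the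
  -- boundary every pair of units occurs, with `s` then forced; over the boundary, with `d` fixed,
  -- all nearby boundary ranges and all `s > 0` occur. They provide curves in the fibres of `d`.
  exists_interior : ∀ a b, ρ a ≠ 0 → ρ b ≠ 0 → ∃ g, 𝒢.r g = a ∧ 𝒢.d g = b
  exists_boundary : ∀ h, ρ (𝒢.r h) = 0 → ∀ᶠ a in 𝓝 (𝒢.r h), ρ a = 0 → ∀ σ > 0,
    ∃ g, 𝒢.r g = a ∧ 𝒢.d g = 𝒢.d h ∧ s g = σ

namespace IsBGroupoid

variable {𝒢 : GroupoidData G M} {e : M → E} {ρ : M → ℝ} {s : G → ℝ}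
  (H : IsBGroupoid k k' 𝒢 e ρ s)

include H

lemma contMDiff_e_r : ContMDiff (𝓡∂ k') 𝓘(ℝ, E) ∞ (fun g => e (𝒢.r g)) :=
  ((contDiff_fst.comp contDiff_fst).contMDiff (n := ∞)).comp H.patch_arrows.contMDiff

lemma contMDiff_e_d : ContMDiff (𝓡∂ k') 𝓘(ℝ, E) ∞ (fun g => e (𝒢.d g)) :=
  ((contDiff_snd.comp contDiff_fst).contMDiff (n := ∞)).comp H.patch_arrows.contMDiff

lemma contMDiff_s : ContMDiff (𝓡∂ k') 𝓘(ℝ, ℝ) ∞ s :=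
  (contDiff_snd.contMDiff (n := ∞)).comp H.patch_arrows.contMDiff

lemma contMDiff_r : ContMDiff (𝓡∂ k') (𝓡∂ k) ∞ 𝒢.r :=
  H.patch_units.contMDiff_of_comp H.contMDiff_e_r

lemma contMDiff_d : ContMDiff (𝓡∂ k') (𝓡∂ k) ∞ 𝒢.d :=
  H.patch_units.contMDiff_of_comp H.contMDiff_e_d

lemma s_unit (x : M) : s (𝒢.u x) = 1 := by
  have hg := H.isGroupoid
  have h1 := hg.unit_mul (𝒢.u x)
  have h2 := H.s_mul (𝒢.u (𝒢.r (𝒢.u x))) (𝒢.u x) (hg.d_unit _)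
  rw [h1, hg.r_unit] at h2
  have := H.s_pos (𝒢.u x)
  nlinarith

lemma s_inv (g : G) : s (𝒢.inv g) = (s g)⁻¹ := by
  have hg := H.isGroupoid
  have h2 := H.s_mul (𝒢.inv g) g (hg.d_inv g)
  rw [hg.inv_mul, H.s_unit] at h2
  exact eq_inv_of_mul_eq_one_left h2.symm

lemma contMDiff_u : ContMDiff (𝓡∂ k) (𝓡∂ k') ∞ 𝒢.u := by
  refine H.patch_arrows.contMDiff_of_comp ?_
  have hg := H.isGroupoid
  simp only [arrowEmbedding, hg.r_unit, hg.d_unit, H.s_unit]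
  exact (H.patch_units.contMDiff.prodMk_space H.patch_units.contMDiff).prodMk_space contMDiff_const

lemma contMDiff_inv : ContMDiff (𝓡∂ k') (𝓡∂ k') ∞ 𝒢.inv := by
  refine H.patch_arrows.contMDiff_of_comp ?_
  have hg := H.isGroupoid
  simp only [arrowEmbedding, hg.r_inv, hg.d_inv, H.s_inv]
  refine (H.contMDiff_e_d.prodMk_space H.contMDiff_e_r).prodMk_space fun g => ?_
  exact ((contDiffAt_inv ℝ (H.s_pos g).ne').contMDiffAt).comp g (H.contMDiff_s g)

lemma contMDiffOn_mul : ContMDiffOn ((𝓡∂ k').prod (𝓡∂ k')) (𝓡∂ k') ∞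
    (fun p : G × G => 𝒢.mul p.1 p.2) {p | 𝒢.d p.1 = 𝒢.r p.2} := by
  refine H.patch_arrows.contMDiffOn_of_comp ?_
  have hg := H.isGroupoid
  have h1 : ContMDiff ((𝓡∂ k').prod (𝓡∂ k')) 𝓘(ℝ, (E × E) × ℝ) ∞
      (fun p : G × G => ((e (𝒢.r p.1), e (𝒢.d p.2)), s p.1 * s p.2)) :=
    ((H.contMDiff_e_r.comp contMDiff_fst).prodMk_space
      (H.contMDiff_e_d.comp contMDiff_snd)).prodMk_space
      ((H.contMDiff_s.comp contMDiff_fst).mul (H.contMDiff_s.comp contMDiff_snd))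
  refine h1.contMDiffOn.congr fun p hp => ?_
  simp only [arrowEmbedding, hg.r_mul _ _ hp, hg.d_mul _ _ hp, H.s_mul _ _ hp]

lemma rho_d_eq_zero_iff (g : G) : ρ (𝒢.d g) = 0 ↔ ρ (𝒢.r g) = 0 := by
  rw [H.rho_d, mul_eq_zero, or_iff_right (H.s_pos g).ne']

variable [IsManifold (𝓡∂ k) ∞ M] [IsManifold (𝓡∂ k') ∞ G]

omit [IsManifold (𝓡∂ k) ∞ M] [IsManifold (𝓡∂ k') ∞ G] in
lemma mvderiv_arrowEmbedding (g : G) (w : TangentSpace (𝓡∂ k') g) :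
    mvderiv (𝓡∂ k') (𝒢.arrowEmbedding e s) g w =
      ((mvderiv (𝓡∂ k) e (𝒢.r g) (mfderiv (𝓡∂ k') (𝓡∂ k) 𝒢.r g w),
        mvderiv (𝓡∂ k) e (𝒢.d g) (mfderiv (𝓡∂ k') (𝓡∂ k) 𝒢.d g w)), mvderiv (𝓡∂ k') s g w) := by
  have hr := (H.contMDiff_e_r.mdifferentiable (by simp)) g
  have hd := (H.contMDiff_e_d.mdifferentiable (by simp)) g
  have hs := (H.contMDiff_s.mdifferentiable (by simp)) g
  have h1 := mvderiv_prodMk (hr.prodMk_space hd) hs w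
  rw [mvderiv_prodMk hr hd,
    mvderiv_comp (H.patch_units.mdifferentiableAt _) ((H.contMDiff_r.mdifferentiable (by simp)) g),
    mvderiv_comp (H.patch_units.mdifferentiableAt _)
      ((H.contMDiff_d.mdifferentiable (by simp)) g)] at h1
  exact h1

omit [IsManifold (𝓡∂ k) ∞ M] in
lemma tangent_ext {g : G} {w w' : TangentSpace (𝓡∂ k') g}
    (h1 : mfderiv (𝓡∂ k') (𝓡∂ k) 𝒢.r g w = mfderiv (𝓡∂ k') (𝓡∂ k) 𝒢.r g w')
    (h2 : mfderiv (𝓡∂ k') (𝓡∂ k) 𝒢.d g w = mfderiv (𝓡∂ k') (𝓡∂ k) 𝒢.d g w')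
    (h3 : mvderiv (𝓡∂ k') s g w = mvderiv (𝓡∂ k') s g w') : w = w' := by
  apply H.patch_arrows.mvderiv_injective g
  rw [H.mvderiv_arrowEmbedding, H.mvderiv_arrowEmbedding, h1, h2, h3]

omit [IsManifold (𝓡∂ k) ∞ M] [IsManifold (𝓡∂ k') ∞ G] in
lemma mvderiv_rho_d (g : G) (w : TangentSpace (𝓡∂ k') g) :
    mvderiv (𝓡∂ k) ρ (𝒢.d g) (mfderiv (𝓡∂ k') (𝓡∂ k) 𝒢.d g w) =
      s g * mvderiv (𝓡∂ k) ρ (𝒢.r g) (mfderiv (𝓡∂ k') (𝓡∂ k) 𝒢.r g w) +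
        mvderiv (𝓡∂ k') s g w * ρ (𝒢.r g) := by
  have hr := (H.contMDiff_r.mdifferentiable (by simp)) g
  have hd := (H.contMDiff_d.mdifferentiable (by simp)) g
  have hs := (H.contMDiff_s.mdifferentiable (by simp)) g
  have hρ := H.smooth_rho.mdifferentiable (by simp)
  rw [← mvderiv_comp (hρ _) hd, ← mvderiv_comp (hρ _) hr]
  have h1 : (fun g => ρ (𝒢.d g)) = fun g => s g * ρ (𝒢.r g) := funext H.rho_d
  rw [h1]
  exact mvderiv_mul hs ((hρ _).comp g hr) w

/-- The map `(r_*, d_*, ds)` is injective, and its image lies in the kernel of the nonzero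
functional obtained by differentiating `ρ(d) = s ρ(r)`. That kernel has dimension `2k + 1 - 1 = k'`,
so it is the whole image. -/
lemma exists_tangent (g : G) (v₁ : TangentSpace (𝓡∂ k) (𝒢.r g)) (v₂ : TangentSpace (𝓡∂ k) (𝒢.d g))
    (a : ℝ) (h : mvderiv (𝓡∂ k) ρ (𝒢.d g) v₂ = s g * mvderiv (𝓡∂ k) ρ (𝒢.r g) v₁ + a * ρ (𝒢.r g)) :
    ∃ w : TangentSpace (𝓡∂ k') g, mfderiv (𝓡∂ k') (𝓡∂ k) 𝒢.r g w = v₁ ∧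
      mfderiv (𝓡∂ k') (𝓡∂ k) 𝒢.d g w = v₂ ∧ mvderiv (𝓡∂ k') s g w = a := by
  let T₁ := TangentSpace (𝓡∂ k) (𝒢.r g)
  let T₂ := TangentSpace (𝓡∂ k) (𝒢.d g)
  let τ : TangentSpace (𝓡∂ k') g →ₗ[ℝ] (T₁ × T₂) × ℝ :=
    ((mfderiv (𝓡∂ k') (𝓡∂ k) 𝒢.r g).toLinearMap.prod
      (mfderiv (𝓡∂ k') (𝓡∂ k) 𝒢.d g).toLinearMap).prod (mvderiv (𝓡∂ k') s g).toLinearMap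
  let Λ : (T₁ × T₂) × ℝ →ₗ[ℝ] ℝ :=
    s g • ((mvderiv (𝓡∂ k) ρ (𝒢.r g)).toLinearMap ∘ₗ LinearMap.fst ℝ _ _ ∘ₗ LinearMap.fst ℝ _ _) +
      ρ (𝒢.r g) • LinearMap.snd ℝ _ _ -
      (mvderiv (𝓡∂ k) ρ (𝒢.d g)).toLinearMap ∘ₗ LinearMap.snd ℝ _ _ ∘ₗ LinearMap.fst ℝ _ _
  have hΛ : ∀ q, Λ q = s g * mvderiv (𝓡∂ k) ρ (𝒢.r g) q.1.1 + ρ (𝒢.r g) * q.2 -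
      mvderiv (𝓡∂ k) ρ (𝒢.d g) q.1.2 := fun q => rfl
  have hτ : Function.Injective τ := fun w w' hw => H.tangent_ext
    (congrArg (fun q => q.1.1) hw) (congrArg (fun q => q.1.2) hw) (congrArg (fun q => q.2) hw)
  have hle : LinearMap.range τ ≤ LinearMap.ker Λ := by
    rintro _ ⟨w, rfl⟩
    rw [LinearMap.mem_ker, hΛ]
    have := H.mvderiv_rho_d g w
    change s g * mvderiv (𝓡∂ k) ρ (𝒢.r g) (mfderiv (𝓡∂ k') (𝓡∂ k) 𝒢.r g w) +
      ρ (𝒢.r g) * mvderiv (𝓡∂ k') s g w -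
      mvderiv (𝓡∂ k) ρ (𝒢.d g) (mfderiv (𝓡∂ k') (𝓡∂ k) 𝒢.d g w) = 0
    rw [this]; ring
  -- The functional is not zero: on the boundary because `dρ` does not vanish there, elsewhere
  -- because the coefficient `ρ (r g)` of `a` does not.
  have hΛs : Function.Surjective Λ := by
    refine LinearMap.surjective fun h0 => ?_
    by_cases hρ : ρ (𝒢.r g) = 0
    · obtain ⟨v, hv⟩ := H.patch_units.exists_mvderiv_rho_eq_one ((H.rho_d_eq_zero_iff g).2 hρ)
      have := hΛ ((0, v), 0)
      rw [h0] at this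
      simp [hv] at this
    · have := hΛ ((0, 0), 1)
      rw [h0] at this
      simp [Ne.symm hρ] at this
  have hf₁ : Module.finrank ℝ T₁ = k := finrank_euclideanSpace_fin
  have hf₂ : Module.finrank ℝ T₂ = k := finrank_euclideanSpace_fin
  have hfG : Module.finrank ℝ (TangentSpace (𝓡∂ k') g) = k' := finrank_euclideanSpace_fin
  have : FiniteDimensional ℝ T₁ := inferInstanceAs (FiniteDimensional ℝ (EuclideanSpace ℝ (Fin k)))
  have : FiniteDimensional ℝ T₂ := inferInstanceAs (FiniteDimensional ℝ (EuclideanSpace ℝ (Fin k)))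
  have hfr : Module.finrank ℝ (LinearMap.range τ) = k' := by
    rw [LinearMap.finrank_range_of_inj hτ, hfG]
  have hfk : Module.finrank ℝ (LinearMap.ker Λ) = k' := by
    have h1 := LinearMap.finrank_range_add_finrank_ker Λ
    rw [LinearMap.range_eq_top.2 hΛs, finrank_top, Module.finrank_self, Module.finrank_prod,
      Module.finrank_prod, hf₁, hf₂, Module.finrank_self] at h1
    have := H.dim_eq
    omega
  have heq := Submodule.eq_of_le_of_finrank_eq hle (hfr.trans hfk.symm)
  have hmem : ((v₁, v₂), a) ∈ LinearMap.range τ := by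
    rw [heq, LinearMap.mem_ker, hΛ, h]; ring
  obtain ⟨w, hw⟩ := hmem
  exact ⟨w, congrArg (fun q => q.1.1) hw, congrArg (fun q => q.1.2) hw, congrArg (fun q => q.2) hw⟩

/-- Given `v₂`, the tangent constraint is solved for `v₁` at a boundary arrow, where `dρ ≠ 0`, and
for `a` at the others, where `ρ (r g) ≠ 0`. -/
lemma submersion_d (g : G) : Function.Surjective (mfderiv (𝓡∂ k') (𝓡∂ k) 𝒢.d g) := by
  intro v
  by_cases hρ : ρ (𝒢.r g) = 0
  · obtain ⟨v₀, hv₀⟩ := H.patch_units.exists_mvderiv_rho_eq_one hρ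
    obtain ⟨w, -, hw, -⟩ := H.exists_tangent g
      ((mvderiv (𝓡∂ k) ρ (𝒢.d g) v / s g) • v₀) v 0 (by
        rw [map_smul, hv₀, smul_eq_mul]
        field_simp [(H.s_pos g).ne']
        ring)
    exact ⟨w, hw⟩
  · obtain ⟨w, -, hw, -⟩ := H.exists_tangent g 0 v (mvderiv (𝓡∂ k) ρ (𝒢.d g) v / ρ (𝒢.r g)) (by
        rw [map_zero]
        field_simp
        ring)
    exact ⟨w, hw⟩

lemma isLieGroupoid [FiniteDimensional ℝ E] : 𝒢.IsLieGroupoid (𝓡∂ k) (𝓡∂ k') where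
  isGroupoid := H.isGroupoid
  manifold_units := inferInstance
  manifold_arrows := inferInstance
  secondCountable_units := H.patch_units.isEmbedding.secondCountableTopology
  secondCountable_arrows := H.patch_arrows.isEmbedding.secondCountableTopology
  smooth_d := H.contMDiff_d
  smooth_r := H.contMDiff_r
  smooth_u := H.contMDiff_u
  smooth_inv := H.contMDiff_inv
  smooth_mul := H.contMDiffOn_mul
  submersion_d := H.submersion_d
  boundary_d g := by
    have h1 := Set.ext_iff.1 H.patch_arrows.boundary_eq g
    have h2 := Set.ext_iff.1 H.patch_units.boundary_eq (𝒢.d g)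
    exact h1.trans ((H.rho_d_eq_zero_iff g).symm.trans h2.symm)
  hausdorff_units := H.patch_units.isEmbedding.t2Space
  hausdorff_fibres x := by
    have : T2Space G := H.patch_arrows.isEmbedding.t2Space
    infer_instance

end IsBGroupoid

end GroupoidData

/-! ### Right translations on the fibres of the domain map. -/

namespace GroupoidData

universe u

variable {E : Type u} [NormedAddCommGroup E] [NormedSpace ℝ E]
  {k k' : ℕ} [NeZero k] [NeZero k']
  {M : Type*} [TopologicalSpace M] [ChartedSpace (EuclideanHalfSpace k) M]
  {G : Type*} [TopologicalSpace G] [ChartedSpace (EuclideanHalfSpace k') G]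

lemma mvderiv_eq_of_eq {F : Type*} [NormedAddCommGroup F] [NormedSpace ℝ F] (g : M → F) {x y : M}
    (h : x = y) (v : EuclideanSpace ℝ (Fin k)) :
    mvderiv (𝓡∂ k) g x v = mvderiv (𝓡∂ k) g y v := by
  subst h; rfl

lemma mvderiv_const {F : Type*} [NormedAddCommGroup F] [NormedSpace ℝ F] (a : F) (x : M)
    (v : TangentSpace (𝓡∂ k) x) : mvderiv (𝓡∂ k) (fun _ : M => a) x v = 0 := by
  have h : mvderiv (𝓡∂ k) (fun _ : M => a) x = 0 := mfderiv_const
  rw [h]; rfl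

/-- The unit tangent vector of the line. -/
def unitTangent (t : ℝ) : TangentSpace 𝓘(ℝ, ℝ) t := (1 : ℝ)

lemma mvderiv_unitTangent {F : Type*} [NormedAddCommGroup F] [NormedSpace ℝ F] {f : ℝ → F} {f' : F}
    {t : ℝ} (h : HasDerivAt f f' t) : mvderiv 𝓘(ℝ, ℝ) f t (unitTangent t) = f' := by
  rw [h.hasFDerivAt.hasMFDerivAt.mvderiv_eq]
  exact one_smul ℝ _

namespace IsBGroupoid

variable {𝒢 : GroupoidData G M} {e : M → E} {ρ : M → ℝ} {s : G → ℝ}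
  (H : IsBGroupoid k k' 𝒢 e ρ s)

include H

variable [IsManifold (𝓡∂ k) ∞ M] [IsManifold (𝓡∂ k') ∞ G]

omit [IsManifold (𝓡∂ k) ∞ M] [IsManifold (𝓡∂ k') ∞ G] in
-- The differential `L` of a right translation is a derivative within a fibre of `d`, so it is
-- tested on curves in that fibre. Along such a curve translation by `g` keeps the range, makes the
-- domain constant and multiplies `s` by `s g`.
lemma mvderiv_mul_right_curve {γ : ℝ → G} {g : G}
    (hγ : MDifferentiableAt 𝓘(ℝ, ℝ) (𝓡∂ k') γ 0) (hd : ∀ᶠ t in 𝓝 0, 𝒢.d (γ t) = 𝒢.d (γ 0))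
    (hg : 𝒢.d (γ 0) = 𝒢.r g)
    {L : TangentSpace (𝓡∂ k') (γ 0) →L[ℝ] TangentSpace (𝓡∂ k') (𝒢.mul (γ 0) g)}
    (hL : HasMFDerivWithinAt (𝓡∂ k') (𝓡∂ k') (fun k => 𝒢.mul k g) (𝒢.d ⁻¹' {𝒢.d (γ 0)}) (γ 0) L)
    (v : TangentSpace 𝓘(ℝ, ℝ) (0 : ℝ)) :
    mvderiv (𝓡∂ k') (𝒢.arrowEmbedding e s) (𝒢.mul (γ 0) g)
        (L (mfderiv 𝓘(ℝ, ℝ) (𝓡∂ k') γ 0 v)) =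
      ((mvderiv (𝓡∂ k) e (𝒢.r (γ 0)) (mfderiv (𝓡∂ k') (𝓡∂ k) 𝒢.r (γ 0)
          (mfderiv 𝓘(ℝ, ℝ) (𝓡∂ k') γ 0 v)), 0),
        mvderiv (𝓡∂ k') s (γ 0) (mfderiv 𝓘(ℝ, ℝ) (𝓡∂ k') γ 0 v) * s g) := by
  have hgr := H.isGroupoid
  set S := 𝒢.d ⁻¹' {𝒢.d (γ 0)} with hS
  have h1 : HasMFDerivAt 𝓘(ℝ, ℝ) (𝓡∂ k') (fun t => 𝒢.mul (γ t) g) 0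
      (L.comp (mfderiv 𝓘(ℝ, ℝ) (𝓡∂ k') γ 0)) :=
    (hL.comp 0 (hγ.hasMFDerivAt.hasMFDerivWithinAt (s := γ ⁻¹' S)) subset_rfl).hasMFDerivAt hd
  have h2 := (H.patch_arrows.mdifferentiableAt (𝒢.mul (γ 0) g)).hasMFDerivAt.comp (0 : ℝ) h1
  have h3 : mvderiv 𝓘(ℝ, ℝ) (fun t => 𝒢.arrowEmbedding e s (𝒢.mul (γ t) g)) 0 v =
      mvderiv (𝓡∂ k') (𝒢.arrowEmbedding e s) (𝒢.mul (γ 0) g)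
        (L (mfderiv 𝓘(ℝ, ℝ) (𝓡∂ k') γ 0 v)) := congrArg (fun L => L v) h2.mfderiv
  rw [← h3]
  have h4 : (fun t => 𝒢.arrowEmbedding e s (𝒢.mul (γ t) g)) =ᶠ[𝓝 0]
      fun t => ((e (𝒢.r (γ t)), e (𝒢.d g)), s (γ t) * s g) := by
    filter_upwards [hd] with t ht
    have h5 : 𝒢.d (γ t) = 𝒢.r g := ht.trans hg
    simp only [arrowEmbedding, hgr.r_mul _ _ h5, hgr.d_mul _ _ h5, H.s_mul _ _ h5]
  rw [h4.mvderiv_eq]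
  have hr := (H.contMDiff_r.mdifferentiable (by simp)) (γ 0)
  have her : MDifferentiableAt (𝓡∂ k') 𝓘(ℝ, E) (fun g => e (𝒢.r g)) (γ 0) :=
    (H.contMDiff_e_r.mdifferentiable (by simp)) (γ 0)
  have hs := (H.contMDiff_s.mdifferentiable (by simp)) (γ 0)
  have hc1 : MDifferentiableAt (𝓡∂ k') 𝓘(ℝ, E) (fun _ : G => e (𝒢.d g)) (γ 0) :=
    mdifferentiableAt_const
  have hc2 : MDifferentiableAt (𝓡∂ k') 𝓘(ℝ, ℝ) (fun _ : G => s g) (γ 0) := mdifferentiableAt_const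
  have hsm : MDifferentiableAt (𝓡∂ k') 𝓘(ℝ, ℝ) (fun k => s k * s g) (γ 0) := hs.mul hc2
  have h6 := mvderiv_comp (g := fun k => ((e (𝒢.r k), e (𝒢.d g)), s k * s g)) (f := γ) (x := (0 : ℝ))
    ((her.prodMk_space hc1).prodMk_space hsm) hγ v
  rw [h6, mvderiv_prodMk (her.prodMk_space hc1) hsm, mvderiv_prodMk her hc1,
    mvderiv_const, mvderiv_mul hs hc2, mvderiv_const, mul_zero, zero_add,
    mvderiv_comp (H.patch_units.mdifferentiableAt _) hr]

omit [IsManifold (𝓡∂ k') ∞ G] in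
-- Every `d`-vertical vector is the velocity of a curve in the fibre. The range follows a curve `μ`
-- with velocity `r_* w`. Off the boundary `s` is forced to be `ρ (d h) / ρ (μ t)`; over the
-- boundary verticality makes `r_* w` tangent to the boundary, `μ` stays there and `s` may move
-- affinely.
lemma exists_fibre_curve (h : G) (w : TangentSpace (𝓡∂ k') h)
    (hw : mfderiv (𝓡∂ k') (𝓡∂ k) 𝒢.d h w = 0) :
    ∃ γ : ℝ → G, γ 0 = h ∧ MDifferentiableAt 𝓘(ℝ, ℝ) (𝓡∂ k') γ 0 ∧
      (∀ᶠ t in 𝓝 0, 𝒢.d (γ t) = 𝒢.d h) ∧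
      HasDerivAt (fun t => 𝒢.arrowEmbedding e s (γ t))
        (mvderiv (𝓡∂ k') (𝒢.arrowEmbedding e s) h w) 0 := by
  classical
  have hconstr := H.mvderiv_rho_d h w
  rw [hw, map_zero] at hconstr
  set v := mfderiv (𝓡∂ k') (𝓡∂ k) 𝒢.r h w with hv
  set σ := mvderiv (𝓡∂ k') s h w with hσ
  have hê : mvderiv (𝓡∂ k') (𝒢.arrowEmbedding e s) h w =
      ((mvderiv (𝓡∂ k) e (𝒢.r h) v, 0), σ) := by
    rw [H.mvderiv_arrowEmbedding, hw, map_zero]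
  have hρd : MDifferentiableAt (𝓡∂ k) 𝓘(ℝ, ℝ) ρ (𝒢.r h) :=
    (H.smooth_rho.mdifferentiable (by simp)) _
  obtain ⟨μ, hμ0, hμs, hμd, hμρ⟩ : ∃ μ : ℝ → M, μ 0 = 𝒢.r h ∧
      ContDiffAt ℝ ∞ (fun t => e (μ t)) 0 ∧
      HasDerivAt (fun t => e (μ t)) (mvderiv (𝓡∂ k) e (𝒢.r h) v) 0 ∧
      (ρ (𝒢.r h) = 0 → ∀ᶠ t in 𝓝 0, ρ (μ t) = 0) := by
    refine H.patch_units.exists_curve v fun h0 => ?_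
    rw [h0, mul_zero, add_zero] at hconstr
    exact (mul_eq_zero.1 hconstr.symm).resolve_left (H.s_pos h).ne'
  have hμm : ContMDiffAt 𝓘(ℝ, ℝ) (𝓡∂ k) ∞ μ 0 :=
    H.patch_units.contMDiffAt_of_comp hμs.contMDiffAt
  have hμr : Filter.Tendsto μ (𝓝 0) (𝓝 (𝒢.r h)) := by
    have := hμm.continuousAt.tendsto; rwa [hμ0] at this
  obtain ⟨S, hS0, hSs, hSd, hex⟩ : ∃ S : ℝ → ℝ, S 0 = s h ∧ ContDiffAt ℝ ∞ S 0 ∧ HasDerivAt S σ 0 ∧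
      ∀ᶠ t in 𝓝 0, ∃ g, 𝒢.r g = μ t ∧ 𝒢.d g = 𝒢.d h ∧ s g = S t := by
    by_cases h0 : ρ (𝒢.r h) = 0
    · refine ⟨fun t => s h + t * σ, by simp, by fun_prop, ?_, ?_⟩
      · simpa using ((hasDerivAt_id (0 : ℝ)).mul_const σ).const_add (s h)
      · have hpos : ∀ᶠ t : ℝ in 𝓝 0, 0 < s h + t * σ := by
          have : ContinuousAt (fun t : ℝ => s h + t * σ) 0 := by fun_prop
          exact this.eventually_const_lt (by simpa using H.s_pos h)
        filter_upwards [hμr.eventually (H.exists_boundary h h0), hμρ h0, hpos] with t h1 h2 h3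
        exact h1 h2 _ h3
    · have hρμ : ContMDiffAt 𝓘(ℝ, ℝ) 𝓘(ℝ, ℝ) ∞ (fun t => ρ (μ t)) 0 :=
        (H.smooth_rho _).comp (0 : ℝ) hμm
      have hρμ' : ContDiffAt ℝ ∞ (fun t => ρ (μ t)) 0 := contMDiffAt_iff_contDiffAt.1 hρμ
      have hne : ρ (μ 0) ≠ 0 := by rwa [hμ0]
      have hd' : HasDerivAt (fun t => ρ (μ t)) (mvderiv (𝓡∂ k) ρ (𝒢.r h) v) 0 := by
        have h2 : mvderiv (𝓡∂ k) e (μ 0) (mfderiv 𝓘(ℝ, ℝ) (𝓡∂ k) μ 0 (unitTangent 0)) =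
            mvderiv (𝓡∂ k) e (μ 0) v := by
          rw [← mvderiv_comp (H.patch_units.mdifferentiableAt _)
            (hμm.mdifferentiableAt (by simp)), mvderiv_unitTangent hμd]
          exact (mvderiv_eq_of_eq e hμ0 v).symm
        have h3 := H.patch_units.mvderiv_injective (μ 0) h2
        have h6 := (hρμ'.differentiableAt (by simp)).hasDerivAt
        refine h6.congr_deriv ?_
        rw [← mvderiv_unitTangent h6, mvderiv_comp (g := ρ) (f := μ)
          ((H.smooth_rho.mdifferentiable (by simp)) _) (hμm.mdifferentiableAt (by simp))]
        exact (congrArg (mvderiv (𝓡∂ k) ρ (μ 0)) h3).trans (mvderiv_eq_of_eq ρ hμ0 v)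
      refine ⟨fun t => ρ (𝒢.d h) / ρ (μ t), ?_, contDiffAt_const.div hρμ' hne, ?_, ?_⟩
      · change ρ (𝒢.d h) / ρ (μ 0) = s h
        rw [hμ0, H.rho_d]; field_simp
      -- The derivative of `ρ (d h) / ρ (μ t)` at `0` is `σ` by the differentiated constraint `s
      -- dρ(v) + σ ρ = 0`.
      · have h5 := (hasDerivAt_const (0 : ℝ) (ρ (𝒢.d h))).div hd' hne
        refine h5.congr_deriv ?_
        rw [hμ0, H.rho_d, zero_mul, zero_sub]
        have : σ * ρ (𝒢.r h) = -(s h * mvderiv (𝓡∂ k) ρ (𝒢.r h) v) := by linarith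
        field_simp
        linarith
      · have h6 : ∀ᶠ t in 𝓝 0, ρ (μ t) ≠ 0 := hρμ'.continuousAt.eventually_ne hne
        filter_upwards [h6] with t ht
        obtain ⟨g, hg1, hg2⟩ := H.exists_interior (μ t) (𝒢.d h) ht
          (fun h7 => h0 ((H.rho_d_eq_zero_iff h).1 h7))
        refine ⟨g, hg1, hg2, ?_⟩
        rw [eq_div_iff ht, ← hg1, ← H.rho_d, hg2]
  -- The default `h` is not used near `0`, and nothing is claimed about `γ` elsewhere.
  let γ : ℝ → G := fun t =>
    if ht : ∃ g, 𝒢.r g = μ t ∧ 𝒢.d g = 𝒢.d h ∧ s g = S t then ht.choose else h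
  have hγ : ∀ᶠ t in 𝓝 0, 𝒢.r (γ t) = μ t ∧ 𝒢.d (γ t) = 𝒢.d h ∧ s (γ t) = S t := by
    filter_upwards [hex] with t ht
    simp only [γ, dif_pos ht]
    exact ht.choose_spec
  have hγe : (fun t => 𝒢.arrowEmbedding e s (γ t)) =ᶠ[𝓝 0]
      fun t => ((e (μ t), e (𝒢.d h)), S t) := by
    filter_upwards [hγ] with t ⟨h1, h2, h3⟩
    rw [arrowEmbedding, h1, h2, h3]
  refine ⟨γ, ?_, ?_, ?_, ?_⟩
  · obtain ⟨h1, h2, h3⟩ := hγ.self_of_nhds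
    apply H.patch_arrows.isEmbedding.injective
    rw [arrowEmbedding, arrowEmbedding, h1, h2, h3, hμ0, hS0]
  · have h1 : ContDiffAt ℝ ∞ (fun t => ((e (μ t), e (𝒢.d h)), S t)) 0 :=
      (hμs.prodMk contDiffAt_const).prodMk hSs
    exact (H.patch_arrows.contMDiffAt_of_comp
      (h1.congr_of_eventuallyEq hγe).contMDiffAt).mdifferentiableAt (by simp)
  · filter_upwards [hγ] with t ht using ht.2.1
  · rw [hê]
    exact ((hμd.prodMk (hasDerivAt_const _ _)).prodMk hSd).congr_of_eventuallyEq hγe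

lemma mvderiv_mul_right {h g : G} (hg : 𝒢.d h = 𝒢.r g)
    {L : TangentSpace (𝓡∂ k') h →L[ℝ] TangentSpace (𝓡∂ k') (𝒢.mul h g)}
    (hL : HasMFDerivWithinAt (𝓡∂ k') (𝓡∂ k') (fun k => 𝒢.mul k g) (𝒢.d ⁻¹' {𝒢.d h}) h L)
    {w : TangentSpace (𝓡∂ k') h} (hw : mfderiv (𝓡∂ k') (𝓡∂ k) 𝒢.d h w = 0) :
    mvderiv (𝓡∂ k') (𝒢.arrowEmbedding e s) (𝒢.mul h g) (L w) =
      ((mvderiv (𝓡∂ k) e (𝒢.r h) (mfderiv (𝓡∂ k') (𝓡∂ k) 𝒢.r h w), 0),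
        mvderiv (𝓡∂ k') s h w * s g) := by
  obtain ⟨γ, h0, hm, hd, hγ⟩ := H.exists_fibre_curve h w hw
  subst h0
  have h1 : mfderiv 𝓘(ℝ, ℝ) (𝓡∂ k') γ 0 (unitTangent 0) = w := by
    apply H.patch_arrows.mvderiv_injective (γ 0)
    rw [← mvderiv_comp (H.patch_arrows.mdifferentiableAt _) hm, mvderiv_unitTangent hγ]
  rw [← h1]
  exact H.mvderiv_mul_right_curve hm hd hg hL _

end IsBGroupoid

end GroupoidData

/-! ### The Lie algebroid and its isomorphism with the b-tangent bundle. -/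

namespace GroupoidData

universe u

variable {E : Type u} [NormedAddCommGroup E] [NormedSpace ℝ E]
  {k k' : ℕ} [NeZero k] [NeZero k']
  {M : Type*} [TopologicalSpace M] [ChartedSpace (EuclideanHalfSpace k) M]
  {G : Type*} [TopologicalSpace G] [ChartedSpace (EuclideanHalfSpace k') G]
  {𝒢 : GroupoidData G M} {e : M → E} {ρ : M → ℝ} {s : G → ℝ}

/-- The identity of the model space, between tangent spaces at two points. -/
def tangentCast (x y : M) : TangentSpace (𝓡∂ k) x →ₗ[ℝ] TangentSpace (𝓡∂ k) y :=
  (LinearMap.id : EuclideanSpace ℝ (Fin k) →ₗ[ℝ] EuclideanSpace ℝ (Fin k))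

lemma mvderiv_tangentCast {F : Type*} [NormedAddCommGroup F] [NormedSpace ℝ F] (g : M → F) {x y : M}
    (h : x = y) (v : TangentSpace (𝓡∂ k) x) :
    mvderiv (𝓡∂ k) g y (tangentCast x y v) = mvderiv (𝓡∂ k) g x v := by
  subst h; rfl

variable (k k' 𝒢 s) in
/-- The anchor and the derivative of `s`, on the fibre of the algebroid at `x`. -/
def fibreMap (x : M) : 𝒢.algebroidFibre (𝓡∂ k) (𝓡∂ k') x →ₗ[ℝ] TangentSpace (𝓡∂ k) x × ℝ :=
  LinearMap.prod
    (tangentCast (𝒢.r (𝒢.u x)) x ∘ₗ (mfderiv (𝓡∂ k') (𝓡∂ k) 𝒢.r (𝒢.u x)).toLinearMap ∘ₗ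
      (𝒢.algebroidFibre (𝓡∂ k) (𝓡∂ k') x).subtype)
    ((mvderiv (𝓡∂ k') s (𝒢.u x)).toLinearMap ∘ₗ
      (𝒢.algebroidFibre (𝓡∂ k) (𝓡∂ k') x).subtype)

namespace IsBGroupoid

variable (H : IsBGroupoid k k' 𝒢 e ρ s)

include H

lemma mvderiv_algebroidFibre (x : M) (a : 𝒢.algebroidFibre (𝓡∂ k) (𝓡∂ k') x) :
    mvderiv (𝓡∂ k') (𝒢.arrowEmbedding e s) (𝒢.u x) a =
      ((mvderiv (𝓡∂ k) e x (fibreMap k k' 𝒢 s x a).1, 0), (fibreMap k k' 𝒢 s x a).2) := by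
  have h0 : mfderiv (𝓡∂ k') (𝓡∂ k) 𝒢.d (𝒢.u x) a = 0 := a.2
  rw [H.mvderiv_arrowEmbedding, h0, map_zero]
  refine Prod.ext (Prod.ext ?_ rfl) rfl
  exact (mvderiv_tangentCast e (H.isGroupoid.r_unit x) _).symm

/-- At a unit `s = 1`, and the vector is killed by `d_*`, so the tangent constraint reads `dρ(v) + a
ρ = 0`. This is the equation that cuts out the fibre of the b-tangent bundle. -/
lemma fibreMap_mem (x : M) (a : 𝒢.algebroidFibre (𝓡∂ k) (𝓡∂ k') x) :
    fibreMap k k' 𝒢 s x a ∈ LinearMap.ker (IsPatchEmbedding.bConstraint (d := k) ρ x) := by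
  rw [IsPatchEmbedding.mem_ker_bConstraint]
  have h0 : mfderiv (𝓡∂ k') (𝓡∂ k) 𝒢.d (𝒢.u x) a = 0 := a.2
  have h1 := H.mvderiv_rho_d (𝒢.u x) a
  rw [h0, map_zero, H.s_unit, one_mul] at h1
  have h2 : mvderiv (𝓡∂ k) ρ x (fibreMap k k' 𝒢 s x a).1 =
    mvderiv (𝓡∂ k) ρ (𝒢.r (𝒢.u x)) (mfderiv (𝓡∂ k') (𝓡∂ k) 𝒢.r (𝒢.u x) a) :=
    mvderiv_tangentCast ρ (H.isGroupoid.r_unit x) _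
  have h3 : (fibreMap k k' 𝒢 s x a).2 = mvderiv (𝓡∂ k') s (𝒢.u x) a := rfl
  rw [h2, h3]
  rw [H.isGroupoid.r_unit x] at h1 ⊢
  linarith

variable [IsManifold (𝓡∂ k) ∞ M] [IsManifold (𝓡∂ k') ∞ G]

/-- The fibre of the algebroid at `x`: a tangent vector and a factor. -/
def fibreIso (x : M) : 𝒢.algebroidFibre (𝓡∂ k) (𝓡∂ k') x ≃ₗ[ℝ]
    LinearMap.ker (IsPatchEmbedding.bConstraint (d := k) ρ x) :=
  LinearEquiv.ofBijective ((fibreMap k k' 𝒢 s x).codRestrict _ (H.fibreMap_mem x)) (by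
    constructor
    · intro a b hab
      have h1 : fibreMap k k' 𝒢 s x a = fibreMap k k' 𝒢 s x b := congrArg Subtype.val hab
      apply Subtype.ext
      apply H.patch_arrows.mvderiv_injective
      rw [H.mvderiv_algebroidFibre, H.mvderiv_algebroidFibre, h1]
    · rintro ⟨⟨v, a⟩, hv⟩
      rw [IsPatchEmbedding.mem_ker_bConstraint] at hv
      have hx := H.isGroupoid.r_unit x
      obtain ⟨w, hw1, hw2, hw3⟩ := H.exists_tangent (𝒢.u x) (tangentCast x _ v) 0 a (by
        rw [map_zero, mvderiv_tangentCast ρ hx.symm, hv, H.s_unit, hx]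
        change 0 = 1 * -(a * ρ x) + a * ρ x
        ring)
      refine ⟨⟨w, hw2⟩, Subtype.ext (Prod.ext ?_ hw3)⟩
      exact congrArg (tangentCast (k := k) (𝒢.r (𝒢.u x)) x) hw1)

lemma fibreIso_apply (x : M) (a : 𝒢.algebroidFibre (𝓡∂ k) (𝓡∂ k') x) :
    (H.fibreIso x a).1 = fibreMap k k' 𝒢 s x a := rfl

variable [FiniteDimensional ℝ E]

/-- The isomorphism of the fibre of the algebroid at `x` with that of the b-tangent bundle. -/
def algebroidIso (x : M) : 𝒢.algebroidFibre (𝓡∂ k) (𝓡∂ k') x ≃ₗ[ℝ] bTangentFibre (𝓡∂ k) x :=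
  (H.fibreIso x).trans (H.patch_units.bIso H.smooth_rho x).symm

lemma algebroidIso_eq_bValue_iff {x : M} {a : 𝒢.algebroidFibre (𝓡∂ k) (𝓡∂ k') x}
    {V : bVectorFields (𝓡∂ k) M} : H.algebroidIso x a = bValue (𝓡∂ k) V x ↔
      fibreMap k k' 𝒢 s x a = (V.1 x, H.patch_units.bFactor H.smooth_rho V x) := by
  rw [← H.patch_units.bIso_bValue H.smooth_rho, ← H.fibreIso_apply, ← Subtype.ext_iff,
    algebroidIso, LinearEquiv.trans_apply, LinearEquiv.symm_apply_eq]

/-- Both kinds of smoothness amount to smoothness of the tangent vector and of the factor as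
functions of `x`. A smooth section of the algebroid gives a field tangent to the boundary, and its
second component is the factor of that field by uniqueness of factors. -/
lemma smooth_iff (σ : ∀ x : M, 𝒢.algebroidFibre (𝓡∂ k) (𝓡∂ k') x) :
    𝒢.IsSmoothAlgebroidSection (𝓡∂ k) (𝓡∂ k') σ ↔
      IsSmoothBSection (𝓡∂ k) (fun x => H.algebroidIso x (σ x)) := by
  constructor
  · intro hσ
    have h1 := contMDiff_mvderiv_apply H.patch_arrows.contMDiff hσ
    simp only [H.mvderiv_algebroidFibre] at h1
    have h2 : ContMDiff (𝓡∂ k) 𝓘(ℝ, E) ∞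
        (fun x => mvderiv (𝓡∂ k) e x (fibreMap k k' 𝒢 s x (σ x)).1) :=
      ((contDiff_fst.comp contDiff_fst).contMDiff (n := ∞)).comp h1
    have h3 : ContMDiff (𝓡∂ k) 𝓘(ℝ, ℝ) ∞ (fun x => (fibreMap k k' 𝒢 s x (σ x)).2) :=
      ((contDiff_snd (E := E × E) (F := ℝ)).contMDiff (n := ∞)).comp h1
    have h4 := H.patch_units.contMDiff_tangent_of_comp (f := fun x => x)
      (v := fun x => (fibreMap k k' 𝒢 s x (σ x)).1) H.patch_units.contMDiff h2
    have h5 := fun x => IsPatchEmbedding.mem_ker_bConstraint.1 (H.fibreMap_mem x (σ x))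
    let V : bVectorFields (𝓡∂ k) M := ⟨fun x => (fibreMap k k' 𝒢 s x (σ x)).1,
      (H.patch_units.mem_bVectorFields_iff H.smooth_rho).2 ⟨h4, fun x hx => by
        rw [h5, hx, mul_zero, neg_zero]⟩⟩
    refine ⟨V, fun x => H.algebroidIso_eq_bValue_iff.2 ?_⟩
    refine Prod.ext rfl ?_
    exact (H.patch_units.bFactor_unique H.smooth_rho V h3.continuous h5 x).symm
  · rintro ⟨V, hV⟩
    refine H.patch_arrows.contMDiff_tangent_of_comp
      (H.patch_arrows.contMDiff.comp H.contMDiff_u) ?_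
    simp only [H.mvderiv_algebroidFibre, H.algebroidIso_eq_bValue_iff.1 (hV _)]
    exact ((contMDiff_mvderiv_apply H.patch_units.contMDiff
      ((H.patch_units.mem_bVectorFields_iff H.smooth_rho).1 V.2).1).prodMk_space
        contMDiff_const).prodMk_space (H.patch_units.contMDiff_bFactor H.smooth_rho V)

lemma anchor (x : M) (a : 𝒢.algebroidFibre (𝓡∂ k) (𝓡∂ k') x) :
    (⟨𝒢.r (𝒢.u x), mfderiv (𝓡∂ k') (𝓡∂ k) 𝒢.r (𝒢.u x) a⟩ : TangentBundle (𝓡∂ k) M) =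
      ⟨x, bAnchor (𝓡∂ k) x (H.algebroidIso x a)⟩ := by
  have h1 : bAnchor (𝓡∂ k) x (H.algebroidIso x a) = (fibreMap k k' 𝒢 s x a).1 := by
    rw [H.patch_units.bAnchor_eq H.smooth_rho, algebroidIso, LinearEquiv.trans_apply,
      LinearEquiv.apply_symm_apply]
    rfl
  rw [h1]
  have h2 : ∀ (y : M) (v : TangentSpace (𝓡∂ k) y), y = x →
      (⟨y, v⟩ : TangentBundle (𝓡∂ k) M) = ⟨x, tangentCast y x v⟩ := by
    rintro y v rfl; rfl
  exact h2 _ _ (H.isGroupoid.r_unit x)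

omit [FiniteDimensional ℝ E] in
/-- A right invariant field is determined by its values on the units. -/
lemma mvderiv_rightInvariant {X : ∀ g : G, TangentSpace (𝓡∂ k') g}
    (hX : 𝒢.IsRightInvariantField (𝓡∂ k) (𝓡∂ k') X)
    {σ : ∀ x : M, 𝒢.algebroidFibre (𝓡∂ k) (𝓡∂ k') x} (hσ : ∀ x, X (𝒢.u x) = σ x) (g : G) :
    mvderiv (𝓡∂ k') (𝒢.arrowEmbedding e s) g (X g) =
      ((mvderiv (𝓡∂ k) e (𝒢.r g) (fibreMap k k' 𝒢 s (𝒢.r g) (σ (𝒢.r g))).1, 0),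
        (fibreMap k k' 𝒢 s (𝒢.r g) (σ (𝒢.r g))).2 * s g) := by
  have hd := H.isGroupoid.d_unit (𝒢.r g)
  obtain ⟨L, hL, hLX⟩ := hX.invariant (𝒢.u (𝒢.r g)) g hd
  have h1 := H.mvderiv_mul_right hd hL (hX.vertical (𝒢.u (𝒢.r g)))
  rw [hLX, hσ] at h1
  have h2 := congrArg (fun g => mvderiv (𝓡∂ k') (𝒢.arrowEmbedding e s) g (X g))
    (H.isGroupoid.unit_mul g)
  refine h2.symm.trans (h1.trans ?_)
  refine Prod.ext (Prod.ext ?_ rfl) rfl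
  exact (mvderiv_tangentCast e (H.isGroupoid.r_unit _) _).symm

omit [FiniteDimensional ℝ E] in
-- The triple `(V (r g), 0, f (r g) s g)` satisfies the tangent constraint at `g` because `Vρ =
-- -fρ`. It is right invariant because right translation keeps `r` and multiplies `s` by a constant.
lemma exists_rightInvariant (V : bVectorFields (𝓡∂ k) M) :
    ∃ X : ∀ g : G, TangentSpace (𝓡∂ k') g, 𝒢.IsRightInvariantField (𝓡∂ k) (𝓡∂ k') X ∧
      ∀ g, mvderiv (𝓡∂ k') (𝒢.arrowEmbedding e s) g (X g) =
        ((mvderiv (𝓡∂ k) e (𝒢.r g) (V.1 (𝒢.r g)), 0),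
          H.patch_units.bFactor H.smooth_rho V (𝒢.r g) * s g) := by
  set f := H.patch_units.bFactor H.smooth_rho V with hf
  have hV := ((H.patch_units.mem_bVectorFields_iff H.smooth_rho).1 V.2).1
  have hex : ∀ g, ∃ w : TangentSpace (𝓡∂ k') g, mfderiv (𝓡∂ k') (𝓡∂ k) 𝒢.r g w = V.1 (𝒢.r g) ∧
      mfderiv (𝓡∂ k') (𝓡∂ k) 𝒢.d g w = 0 ∧ mvderiv (𝓡∂ k') s g w = f (𝒢.r g) * s g := by
    intro g
    refine H.exists_tangent g _ 0 _ ?_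
    rw [map_zero, H.patch_units.mvderiv_rho_eq H.smooth_rho]
    ring
  choose X hX1 hX2 hX3 using hex
  have hX : ∀ g, mvderiv (𝓡∂ k') (𝒢.arrowEmbedding e s) g (X g) =
      ((mvderiv (𝓡∂ k) e (𝒢.r g) (V.1 (𝒢.r g)), 0), f (𝒢.r g) * s g) := fun g => by
    rw [H.mvderiv_arrowEmbedding, hX1, hX2, hX3, map_zero]
  refine ⟨X, ⟨?_, hX2, ?_⟩, hX⟩
  · refine H.patch_arrows.contMDiff_tangent_of_comp (f := fun g => g) H.patch_arrows.contMDiff ?_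
    simp only [hX]
    refine (ContMDiff.prodMk_space ?_ contMDiff_const).prodMk_space ?_
    · exact (contMDiff_mvderiv_apply H.patch_units.contMDiff hV).comp H.contMDiff_r
    · exact ((H.patch_units.contMDiff_bFactor H.smooth_rho V).comp H.contMDiff_r).mul H.contMDiff_s
  · intro h g hg
    have h1 : MDifferentiableWithinAt (𝓡∂ k') (𝓡∂ k') (fun k => 𝒢.mul k g) (𝒢.d ⁻¹' {𝒢.d h}) h := by
      have h2 : ContMDiffOn (𝓡∂ k') ((𝓡∂ k').prod (𝓡∂ k')) ∞ (fun k : G => (k, g))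
        (𝒢.d ⁻¹' {𝒢.d h}) := (contMDiff_id.prodMk contMDiff_const).contMDiffOn
      exact ((H.contMDiffOn_mul.comp h2 fun k hk => hk.trans hg) h rfl).mdifferentiableWithinAt
        (by simp)
    refine ⟨_, h1.hasMFDerivWithinAt, ?_⟩
    apply H.patch_arrows.mvderiv_injective
    rw [H.mvderiv_mul_right hg h1.hasMFDerivWithinAt (hX2 h), hX, hX1, hX3, H.s_mul _ _ hg]
    have h3 := H.isGroupoid.r_mul h g hg
    refine Prod.ext (Prod.ext ?_ rfl) ?_
    · exact congrArg (fun y => mvderiv (𝓡∂ k) e y (V.1 y)) h3.symm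
    · rw [h3]
      ring

lemma extension (σ : ∀ x : M, 𝒢.algebroidFibre (𝓡∂ k) (𝓡∂ k') x)
    (hσ : 𝒢.IsSmoothAlgebroidSection (𝓡∂ k) (𝓡∂ k') σ) :
    ∃! X : ∀ g : G, TangentSpace (𝓡∂ k') g,
      𝒢.IsRightInvariantField (𝓡∂ k) (𝓡∂ k') X ∧ ∀ x, X (𝒢.u x) = σ x := by
  obtain ⟨V, hV⟩ := (H.smooth_iff σ).1 hσ
  obtain ⟨X, hX, hXV⟩ := H.exists_rightInvariant V
  refine ⟨X, ⟨hX, fun x => ?_⟩, fun Y hY => funext fun g => ?_⟩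
  · apply H.patch_arrows.mvderiv_injective
    rw [hXV, H.mvderiv_algebroidFibre, H.algebroidIso_eq_bValue_iff.1 (hV x), H.s_unit, mul_one]
    exact congrArg (fun y => ((mvderiv (𝓡∂ k) e y (V.1 y), (0 : E)),
      H.patch_units.bFactor H.smooth_rho V y)) (H.isGroupoid.r_unit x)
  · apply H.patch_arrows.mvderiv_injective
    rw [hXV, H.mvderiv_rightInvariant hY.1 hY.2, H.algebroidIso_eq_bValue_iff.1 (hV _)]

omit H [IsManifold (𝓡∂ k) ∞ M] [FiniteDimensional ℝ E] in
lemma smooth_of_isRightInvariantField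
    (hu : ContMDiff (𝓡∂ k) (𝓡∂ k') ∞ 𝒢.u) {X : ∀ g : G, TangentSpace (𝓡∂ k') g}
    (hX : 𝒢.IsRightInvariantField (𝓡∂ k) (𝓡∂ k') X)
    {σ : ∀ x : M, 𝒢.algebroidFibre (𝓡∂ k) (𝓡∂ k') x} (hσ : ∀ x, X (𝒢.u x) = σ x) :
    𝒢.IsSmoothAlgebroidSection (𝓡∂ k) (𝓡∂ k') σ := by
  have h := hX.smooth.comp hu
  have h2 : (fun x => (⟨𝒢.u x, (σ x : TangentSpace (𝓡∂ k') (𝒢.u x))⟩ : TangentBundle (𝓡∂ k') G)) =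
      (fun g => (⟨g, X g⟩ : TangentBundle (𝓡∂ k') G)) ∘ 𝒢.u := by
    funext x
    simp only [Function.comp, hσ]
  rw [IsSmoothAlgebroidSection, h2]
  exact h

omit [FiniteDimensional ℝ E] in
-- The bracket is computed on the components of `arrowEmbedding`. In the last one `X((w ∘ r) s) -
-- Y((f ∘ r) s) = (Vw - Wf) s`, since the terms `f w s` cancel.
lemma mvderiv_mlieBracket_rightInvariant {V W : bVectorFields (𝓡∂ k) M}
    {X Y : ∀ g : G, TangentSpace (𝓡∂ k') g}
    (hX : ContMDiff (𝓡∂ k') (𝓡∂ k').tangent ∞ (fun g => (⟨g, X g⟩ : TangentBundle (𝓡∂ k') G)))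
    (hY : ContMDiff (𝓡∂ k') (𝓡∂ k').tangent ∞ (fun g => (⟨g, Y g⟩ : TangentBundle (𝓡∂ k') G)))
    (hXV : ∀ g, mvderiv (𝓡∂ k') (𝒢.arrowEmbedding e s) g (X g) =
        ((mvderiv (𝓡∂ k) e (𝒢.r g) (V.1 (𝒢.r g)), 0),
          H.patch_units.bFactor H.smooth_rho V (𝒢.r g) * s g))
    (hYW : ∀ g, mvderiv (𝓡∂ k') (𝒢.arrowEmbedding e s) g (Y g) =
        ((mvderiv (𝓡∂ k) e (𝒢.r g) (W.1 (𝒢.r g)), 0),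
          H.patch_units.bFactor H.smooth_rho W (𝒢.r g) * s g)) (g : G) :
    mvderiv (𝓡∂ k') (𝒢.arrowEmbedding e s) g (VectorField.mlieBracket (𝓡∂ k') X Y g) =
      ((mvderiv (𝓡∂ k) e (𝒢.r g) (VectorField.mlieBracket (𝓡∂ k) V.1 W.1 (𝒢.r g)), 0),
        (mvderiv (𝓡∂ k) (H.patch_units.bFactor H.smooth_rho W) (𝒢.r g) (V.1 (𝒢.r g)) -
          mvderiv (𝓡∂ k) (H.patch_units.bFactor H.smooth_rho V) (𝒢.r g) (W.1 (𝒢.r g))) * s g) := by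
  set f := H.patch_units.bFactor H.smooth_rho V with hf
  set w := H.patch_units.bFactor H.smooth_rho W with hw
  have hfs := H.patch_units.contMDiff_bFactor H.smooth_rho V
  have hws := H.patch_units.contMDiff_bFactor H.smooth_rho W
  have hV := ((H.patch_units.mem_bVectorFields_iff H.smooth_rho).1 V.2).1
  have hW := ((H.patch_units.mem_bVectorFields_iff H.smooth_rho).1 W.2).1
  have hEV := contMDiff_mvderiv_apply H.patch_units.contMDiff hV
  have hEW := contMDiff_mvderiv_apply H.patch_units.contMDiff hW
  have hrd := H.contMDiff_r.mdifferentiable (by simp) g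
  have hsd := H.contMDiff_s.mdifferentiable (by simp) g
  have hr : ∀ Z : ∀ x : M, TangentSpace (𝓡∂ k) x, ∀ (T : TangentSpace (𝓡∂ k') g) (b : ℝ),
      mvderiv (𝓡∂ k') (𝒢.arrowEmbedding e s) g T =
        ((mvderiv (𝓡∂ k) e (𝒢.r g) (Z (𝒢.r g)), 0), b) →
      mfderiv (𝓡∂ k') (𝓡∂ k) 𝒢.r g T = Z (𝒢.r g) ∧ mvderiv (𝓡∂ k') s g T = b := by
    intro Z T b hT
    rw [H.mvderiv_arrowEmbedding] at hT
    exact ⟨H.patch_units.mvderiv_injective _ (congrArg (fun q => q.1.1) hT),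
      congrArg (fun q => q.2) hT⟩
  obtain ⟨hX1, hX2⟩ := hr V.1 _ _ (hXV g)
  obtain ⟨hY1, hY2⟩ := hr W.1 _ _ (hYW g)
  have hpair : ∀ {A : M → E} {b : M → ℝ}, ContMDiff (𝓡∂ k) 𝓘(ℝ, E) ∞ A →
      ContMDiff (𝓡∂ k) 𝓘(ℝ, ℝ) ∞ b → ∀ T : TangentSpace (𝓡∂ k') g,
      mvderiv (𝓡∂ k') (fun g => ((A (𝒢.r g), (0 : E)), b (𝒢.r g) * s g)) g T =
        ((mvderiv (𝓡∂ k) A (𝒢.r g) (mfderiv (𝓡∂ k') (𝓡∂ k) 𝒢.r g T), 0),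
          b (𝒢.r g) * mvderiv (𝓡∂ k') s g T +
            mvderiv (𝓡∂ k) b (𝒢.r g) (mfderiv (𝓡∂ k') (𝓡∂ k) 𝒢.r g T) * s g) := by
    intro A b hA hb T
    have hAr : MDifferentiableAt (𝓡∂ k') 𝓘(ℝ, E) (fun g => A (𝒢.r g)) g :=
      (hA.comp H.contMDiff_r).mdifferentiable (by simp) g
    have hbr : MDifferentiableAt (𝓡∂ k') 𝓘(ℝ, ℝ) (fun g => b (𝒢.r g)) g :=
      (hb.comp H.contMDiff_r).mdifferentiable (by simp) g
    have hc : MDifferentiableAt (𝓡∂ k') 𝓘(ℝ, E) (fun _ : G => (0 : E)) g := mdifferentiableAt_const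
    have hbs : MDifferentiableAt (𝓡∂ k') 𝓘(ℝ, ℝ) (fun g => b (𝒢.r g) * s g) g :=
      MDifferentiableAt.mul hbr hsd
    rw [mvderiv_prodMk (hAr.prodMk_space hc) hbs, mvderiv_mul (g := fun g => b (𝒢.r g)) hbr hsd]
    have h1 := mvderiv_prodMk hAr hc T
    rw [mvderiv_const, mvderiv_comp ((hA.mdifferentiable (by simp)) _) hrd] at h1
    rw [mvderiv_comp ((hb.mdifferentiable (by simp)) _) hrd]
    exact Prod.ext h1 rfl
  rw [mvderiv_mlieBracket H.patch_arrows.contMDiff hX hY g]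
  simp only [hXV, hYW]
  rw [hpair hEV hfs, hpair hEW hws, hX1, hX2, hY1, hY2,
    mvderiv_mlieBracket H.patch_units.contMDiff hV hW]
  refine Prod.ext (Prod.ext rfl (sub_zero _)) ?_
  simp only [Prod.snd_sub]
  ring

omit [IsManifold (𝓡∂ k') ∞ G] [FiniteDimensional ℝ E] in
-- From `Vρ = -fρ` and `Wρ = -wρ` one gets `[V, W] ρ = -(Vw - Wf) ρ`: the bracket is tangent to the
-- boundary, with the same factor as the bracket of the right invariant fields.
lemma exists_bracket (V W : bVectorFields (𝓡∂ k) M) :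
    ∃ U : bVectorFields (𝓡∂ k) M,
      (∀ x, U.1 x = VectorField.mlieBracket (𝓡∂ k) V.1 W.1 x) ∧
      ∀ x, H.patch_units.bFactor H.smooth_rho U x =
        mvderiv (𝓡∂ k) (H.patch_units.bFactor H.smooth_rho W) x (V.1 x) -
          mvderiv (𝓡∂ k) (H.patch_units.bFactor H.smooth_rho V) x (W.1 x) := by
  set f := H.patch_units.bFactor H.smooth_rho V with hf
  set w := H.patch_units.bFactor H.smooth_rho W with hw
  have hfs := H.patch_units.contMDiff_bFactor H.smooth_rho V
  have hws := H.patch_units.contMDiff_bFactor H.smooth_rho W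
  have hV := ((H.patch_units.mem_bVectorFields_iff H.smooth_rho).1 V.2).1
  have hW := ((H.patch_units.mem_bVectorFields_iff H.smooth_rho).1 W.2).1
  have hρd := H.smooth_rho.mdifferentiable (by simp)
  have key : ∀ x, mvderiv (𝓡∂ k) ρ x (VectorField.mlieBracket (𝓡∂ k) V.1 W.1 x) =
      -((mvderiv (𝓡∂ k) w x (V.1 x) - mvderiv (𝓡∂ k) f x (W.1 x)) * ρ x) := by
    intro x
    have hV' : (fun x => mvderiv (𝓡∂ k) ρ x (V.1 x)) = fun x => (-f x) * ρ x := by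
      funext y; rw [H.patch_units.mvderiv_rho_eq H.smooth_rho]; ring
    have hW' : (fun x => mvderiv (𝓡∂ k) ρ x (W.1 x)) = fun x => (-w x) * ρ x := by
      funext y; rw [H.patch_units.mvderiv_rho_eq H.smooth_rho]; ring
    have hneg : ∀ {b : M → ℝ}, ContMDiff (𝓡∂ k) 𝓘(ℝ, ℝ) ∞ b → ∀ T : TangentSpace (𝓡∂ k) x,
        mvderiv (𝓡∂ k) (fun x => -b x) x T = -mvderiv (𝓡∂ k) b x T := fun hb T =>
      mvderiv_clm_comp (-ContinuousLinearMap.id ℝ ℝ) (hb.mdifferentiable (by simp) x) T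
    rw [mvderiv_mlieBracket H.smooth_rho hV hW, hV', hW',
      mvderiv_mul (hws.neg.mdifferentiable (by simp) x) (hρd x),
      mvderiv_mul (hfs.neg.mdifferentiable (by simp) x) (hρd x), hneg hws, hneg hfs,
      H.patch_units.mvderiv_rho_eq H.smooth_rho, H.patch_units.mvderiv_rho_eq H.smooth_rho]
    ring
  let U : bVectorFields (𝓡∂ k) M := ⟨VectorField.mlieBracket (𝓡∂ k) V.1 W.1,
    (H.patch_units.mem_bVectorFields_iff H.smooth_rho).2 ⟨contMDiff_mlieBracket hV hW,
      fun x hx => by rw [key, hx, mul_zero, neg_zero]⟩⟩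
  refine ⟨U, fun x => rfl, fun x => ?_⟩
  refine H.patch_units.bFactor_unique H.smooth_rho U ?_ key x
  exact (contMDiff_mvderiv_apply hws hV).continuous.sub (contMDiff_mvderiv_apply hfs hW).continuous

lemma bracket_mem (V W : bVectorFields (𝓡∂ k) M) {X Y : ∀ g : G, TangentSpace (𝓡∂ k') g}
    (hX : 𝒢.IsRightInvariantField (𝓡∂ k) (𝓡∂ k') X) (hY : 𝒢.IsRightInvariantField (𝓡∂ k) (𝓡∂ k') Y)
    {σ τ : ∀ x : M, 𝒢.algebroidFibre (𝓡∂ k) (𝓡∂ k') x} (hσ : ∀ x, X (𝒢.u x) = σ x)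
    (hτ : ∀ x, Y (𝒢.u x) = τ x) (hV : ∀ x, H.algebroidIso x (σ x) = bValue (𝓡∂ k) V x)
    (hW : ∀ x, H.algebroidIso x (τ x) = bValue (𝓡∂ k) W x) :
    ∃ U : bVectorFields (𝓡∂ k) M,
      (∀ x, U.1 x = VectorField.mlieBracket (𝓡∂ k) V.1 W.1 x) ∧
      ∀ x, mvderiv (𝓡∂ k') (𝒢.arrowEmbedding e s) (𝒢.u x)
          (VectorField.mlieBracket (𝓡∂ k') X Y (𝒢.u x)) =
        ((mvderiv (𝓡∂ k) e x (U.1 x), 0), H.patch_units.bFactor H.smooth_rho U x) := by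
  obtain ⟨U, hU, hU'⟩ := H.exists_bracket V W
  refine ⟨U, hU, fun x => ?_⟩
  rw [H.mvderiv_mlieBracket_rightInvariant (V := V) (W := W) hX.smooth hY.smooth
    (fun g => by rw [H.mvderiv_rightInvariant hX hσ, H.algebroidIso_eq_bValue_iff.1 (hV _)])
    (fun g => by rw [H.mvderiv_rightInvariant hY hτ, H.algebroidIso_eq_bValue_iff.1 (hW _)]),
    H.s_unit, mul_one, ← hU, ← hU']
  exact congrArg (fun y => ((mvderiv (𝓡∂ k) e y (U.1 y), (0 : E)),
      H.patch_units.bFactor H.smooth_rho U y)) (H.isGroupoid.r_unit x)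

theorem isAlgebroidIsoToBTangent :
    IsAlgebroidIsoToBTangent (𝓡∂ k) (𝓡∂ k') 𝒢 H.algebroidIso := by
  have hbr : ∀ σ τ ζ, 𝒢.IsAlgebroidBracket (𝓡∂ k) (𝓡∂ k') σ τ ζ → ∀ V W : bVectorFields (𝓡∂ k) M,
    (∀ x, H.algebroidIso x (σ x) = bValue (𝓡∂ k) V x) →
    (∀ x, H.algebroidIso x (τ x) = bValue (𝓡∂ k) W x) →
    ∃ U : bVectorFields (𝓡∂ k) M, (∀ x, U.1 x = VectorField.mlieBracket (𝓡∂ k) V.1 W.1 x) ∧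
      ∀ x, H.algebroidIso x (ζ x) = bValue (𝓡∂ k) U x := by
    rintro σ τ ζ ⟨X, Y, hX, hY, hσ, hτ, hζ⟩ V W hV hW
    obtain ⟨U, hU, hU'⟩ := H.bracket_mem V W hX hY hσ hτ hV hW
    refine ⟨U, hU, fun x => H.algebroidIso_eq_bValue_iff.2 ?_⟩
    have h1 := H.mvderiv_algebroidFibre x (ζ x)
    rw [hζ, hU'] at h1
    refine Prod.ext ?_ (congrArg (fun q => q.2) h1.symm)
    exact H.patch_units.mvderiv_injective x (congrArg (fun q => q.1.1) h1.symm)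
  have hsm : ∀ σ τ ζ, 𝒢.IsAlgebroidBracket (𝓡∂ k) (𝓡∂ k') σ τ ζ →
      𝒢.IsSmoothAlgebroidSection (𝓡∂ k) (𝓡∂ k') σ ∧
        𝒢.IsSmoothAlgebroidSection (𝓡∂ k) (𝓡∂ k') τ := by
    rintro σ τ ζ ⟨X, Y, hX, hY, hσ, hτ, -⟩
    exact ⟨smooth_of_isRightInvariantField H.contMDiff_u hX hσ,
      smooth_of_isRightInvariantField H.contMDiff_u hY hτ⟩
  refine ⟨H.smooth_iff, H.anchor, H.extension, ?_, ?_, hbr⟩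
  · intro σ τ hσ hτ
    obtain ⟨X, ⟨hX, hXσ⟩, hXu⟩ := H.extension σ hσ
    obtain ⟨Y, ⟨hY, hYτ⟩, hYu⟩ := H.extension τ hτ
    obtain ⟨V, hV⟩ := (H.smooth_iff σ).1 hσ
    obtain ⟨W, hW⟩ := (H.smooth_iff τ).1 hτ
    obtain ⟨U, hU, hU'⟩ := H.bracket_mem V W hX hY hXσ hYτ hV hW
    have hker : ∀ x, VectorField.mlieBracket (𝓡∂ k') X Y (𝒢.u x) ∈
        𝒢.algebroidFibre (𝓡∂ k) (𝓡∂ k') x := by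
      intro x
      have h1 := hU' x
      rw [H.mvderiv_arrowEmbedding] at h1
      have h2 := congrArg (fun q => q.1.2) h1
      exact H.patch_units.mvderiv_injective _ (h2.trans (map_zero _).symm)
    refine ⟨fun x => ⟨_, hker x⟩, ⟨X, Y, hX, hY, hXσ, hYτ, fun x => rfl⟩, ?_⟩
    rintro ζ ⟨X', Y', hX', hY', hXσ', hYτ', hζ⟩
    have hXX : X' = X := hXu X' ⟨hX', hXσ'⟩
    have hYY : Y' = Y := hYu Y' ⟨hY', hYτ'⟩
    funext x
    apply Subtype.ext
    rw [hζ, hXX, hYY]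
  · intro σ τ ζ hζ
    obtain ⟨V, hV⟩ := (H.smooth_iff σ).1 (hsm σ τ ζ hζ).1
    obtain ⟨W, hW⟩ := (H.smooth_iff τ).1 (hsm σ τ ζ hζ).2
    obtain ⟨U, -, hU⟩ := hbr σ τ ζ hζ V W hV hW
    exact (H.smooth_iff ζ).2 ⟨U, hU⟩

end IsBGroupoid
end GroupoidData

/-! ### Flat patches of regular zero sets and of hypersurfaces in spheres. -/

section ZeroSets

variable {X : Type*} [NormedAddCommGroup X] [NormedSpace ℝ X] [FiniteDimensional ℝ X]
  {F : Type*} [NormedAddCommGroup F] [NormedSpace ℝ F] [FiniteDimensional ℝ F]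
  {P : Type*} [NormedAddCommGroup P] [NormedSpace ℝ P] [FiniteDimensional ℝ P]

omit [FiniteDimensional ℝ P] [FiniteDimensional ℝ F] in
lemma exists_equiv_prod_fst_eq [FiniteDimensional ℝ F] [FiniteDimensional ℝ P] (A : X →L[ℝ] F)
    (hA : Function.Surjective A)
    (hd : Module.finrank ℝ X = Module.finrank ℝ F + Module.finrank ℝ P) :
    ∃ T : X ≃L[ℝ] F × P, ∀ x, (T x).1 = A x := by
  have hk : Module.finrank ℝ (LinearMap.ker A.toLinearMap) = Module.finrank ℝ P := by
    have h1 := LinearMap.finrank_range_add_finrank_ker A.toLinearMap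
    rw [LinearMap.range_eq_top.2 hA, finrank_top] at h1
    omega
  let L : LinearMap.ker A.toLinearMap ≃ₗ[ℝ] P := LinearEquiv.ofFinrankEq _ _ hk
  obtain ⟨B, hB⟩ := A.toLinearMap.exists_rightInverse_of_surjective (LinearMap.range_eq_top.2 hA)
  have hB' : ∀ a, A (B a) = a := fun a => congrArg (fun T => T a) hB
  let π : X →ₗ[ℝ] LinearMap.ker A.toLinearMap :=
    (LinearMap.id - B ∘ₗ A.toLinearMap).codRestrict _ fun x => by
      change A (x - B (A x)) = 0
      rw [map_sub, hB', sub_self]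
  let T : X →ₗ[ℝ] F × P := A.toLinearMap.prod (L.toLinearMap ∘ₗ π)
  have hT : Function.Bijective T := by
    constructor
    · refine (injective_iff_map_eq_zero T).2 fun x hx => ?_
      have h1 : A x = 0 := congrArg Prod.fst hx
      have h2 : π x = 0 := L.map_eq_zero_iff.1 (congrArg Prod.snd hx)
      have h3 : x - B (A x) = 0 := congrArg Subtype.val h2
      rwa [h1, map_zero, sub_zero] at h3
    · rintro ⟨a, b⟩
      have hAk : A ((L.symm b : X)) = 0 := (L.symm b).2
      have hA1 : A (B a + (L.symm b : X)) = a := by rw [map_add, hB', hAk, add_zero]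
      refine ⟨B a + (L.symm b : X), Prod.ext hA1 ?_⟩
      have h2 : π (B a + (L.symm b : X)) = L.symm b := by
        apply Subtype.ext
        change B a + (L.symm b : X) - B (A (B a + (L.symm b : X))) = _
        rw [hA1, add_sub_cancel_left]
      change L (π _) = b
      rw [h2, L.apply_symm_apply]
  exact ⟨(LinearEquiv.ofBijective T hT).toContinuousLinearEquiv, fun x => rfl⟩

/-- The inverse function theorem applied to `Ψ = (f, q)`, where the linear map `q` is complementary
to the derivative of `f` at `x`. The patch is `q` itself, and its inverse is `z ↦ Ψ⁻¹(0, z)`. -/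
lemma exists_flatPatch_zeroSet {S U : Set X} {f : X → F} {x : X} (hxS : x ∈ S) (hU : IsOpen U)
    (hxU : x ∈ U) (hf : ContDiffOn ℝ ∞ f U) (hs : Function.Surjective (fderiv ℝ f x))
    (hSU : ∀ y ∈ U, y ∈ S ↔ f y = 0)
    (hd : Module.finrank ℝ X = Module.finrank ℝ F + Module.finrank ℝ P) :
    Nonempty (FlatPatch P (Subtype.val : S → X) ⟨x, hxS⟩) := by
  obtain ⟨T, hT⟩ := exists_equiv_prod_fst_eq (P := P) (fderiv ℝ f x) hs hd
  have : CompleteSpace X := FiniteDimensional.complete ℝ X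
  let q : X →L[ℝ] P := (ContinuousLinearMap.snd ℝ F P).comp T.toContinuousLinearMap
  let Ψ : X → F × P := fun y => (f y, q y)
  have hΨ : ContDiffOn ℝ ∞ Ψ U := hf.prodMk q.contDiff.contDiffOn
  have hΨx : ContDiffAt ℝ ∞ Ψ x := hΨ.contDiffAt (hU.mem_nhds hxU)
  have hfx : DifferentiableAt ℝ f x :=
    (hf.contDiffAt (hU.mem_nhds hxU)).differentiableAt (by simp)
  have hder : HasFDerivAt Ψ (T : X →L[ℝ] F × P) x := by
    refine (hfx.hasFDerivAt.prodMk q.hasFDerivAt).congr_fderiv ?_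
    ext1 v
    exact Prod.ext (hT v).symm rfl
  let Φ := hΨx.toOpenPartialHomeomorph Ψ hder (by simp)
  have hΦx : x ∈ Φ.source := hΨx.mem_toOpenPartialHomeomorph_source hder (by simp)
  -- On `U'` the derivative of `Ψ` is invertible at every point and not only at `x`, which makes the
  -- local inverse smooth on its whole domain.
  let U' := U ∩ (fderiv ℝ Ψ) ⁻¹' (range ((↑) : (X ≃L[ℝ] F × P) → X →L[ℝ] F × P))
  have hU' : IsOpen U' :=
    (hΨ.continuousOn_fderiv_of_isOpen hU (by simp)).isOpen_inter_preimage hU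
      ContinuousLinearEquiv.isOpen
  have hxU' : x ∈ U' := ⟨hxU, ⟨T, hder.fderiv.symm⟩⟩
  let Φ' := Φ.restrOpen U' hU'
  have hsrc : ∀ y ∈ Φ'.source, y ∈ Φ.source ∧ y ∈ U' := fun y hy => by
    rwa [Φ.restrOpen_source U' hU'] at hy
  have hΦ' : ∀ y, Φ' y = Ψ y := fun y => rfl
  refine ⟨{
    O := Φ'.source
    W := (fun z : P => ((0 : F), z)) ⁻¹' Φ'.target
    F := q
    G := fun z => Φ'.symm (0, z)
    isOpen_O := Φ'.open_source
    isOpen_W := Φ'.open_target.preimage (by fun_prop)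
    mem_O := by
      change x ∈ Φ'.source
      rw [Φ.restrOpen_source U' hU']; exact ⟨hΦx, hxU'⟩
    smooth_F := q.contDiff.contDiffOn
    smooth_G := ?_
    map_F := ?_
    left_inv := ?_
    exists_param := ?_ }⟩
  · have h1 : ContDiffOn ℝ ∞ Φ'.symm Φ'.target := by
      intro z hz
      obtain ⟨-, hyU, T', hT'⟩ := hsrc _ (Φ'.map_target hz)
      have hy : ContDiffAt ℝ ∞ Ψ (Φ'.symm z) := hΨ.contDiffAt (hU.mem_nhds hyU)
      refine (Φ'.contDiffAt_symm (f₀' := T') hz ?_ hy).contDiffWithinAt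
      rw [hT']
      exact (hy.differentiableAt (by simp)).hasFDerivAt
    exact h1.comp (by fun_prop) fun z hz => hz
  · intro y hy
    have h1 : f y = 0 := (hSU y (hsrc _ hy).2.1).1 y.2
    have h2 := Φ'.map_source hy
    rw [hΦ'] at h2
    simp only [Ψ, h1] at h2
    exact h2
  · intro y hy
    have h1 : f y = 0 := (hSU y (hsrc _ hy).2.1).1 y.2
    have h2 := Φ'.left_inv hy
    rw [hΦ'] at h2
    simp only [Ψ, h1] at h2
    exact h2
  · intro z hz
    have h1 := Φ'.map_target hz
    have h2 := Φ'.right_inv hz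
    rw [hΦ'] at h2
    exact ⟨⟨_, (hSU _ (hsrc _ h1).2.1).2 (congrArg Prod.fst h2)⟩, rfl, h1, congrArg Prod.snd h2⟩

end ZeroSets

lemma IsSmoothHypersurface.exists_flatPatch {n : ℕ} {S : Set (Euc (n + 1))}
    (hS : IsSmoothHypersurface 𝓘(ℝ, Euc (n + 1)) S) (x : S) :
    Nonempty (FlatPatch (Euc n) (Subtype.val : S → Euc (n + 1)) x) := by
  obtain ⟨U, hU, hxU, f, hf, hdf, hSU⟩ := hS x x.2
  rw [contMDiffOn_iff_contDiffOn] at hf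
  rw [mfderiv_eq_fderiv] at hdf
  refine exists_flatPatch_zeroSet x.2 hU hxU hf ?_ (fun y hy => ?_) ?_
  · exact LinearMap.surjective (f := (fderiv ℝ f x).toLinearMap)
      fun h => hdf (ContinuousLinearMap.coe_injective h)
  · have := Set.ext_iff.1 hSU y
    simp only [mem_inter_iff, hy, and_true, mem_ofPred_eq, true_and] at this
    exact this
  · rw [finrank_euclideanSpace_fin, finrank_euclideanSpace_fin, Module.finrank_self, add_comm]

/-- A smooth map to the sphere, equal to the radial retraction near `y`. -/
lemma exists_sphere_retraction {n : ℕ} (y : sphere (0 : Euc (n + 1)) 1) :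
    ∃ π : Euc (n + 1) → sphere (0 : Euc (n + 1)) 1,
      ContMDiff 𝓘(ℝ, Euc (n + 1)) (𝓡 n) ∞ π ∧
      ∀ᶠ z in 𝓝 (y : Euc (n + 1)), (π z : Euc (n + 1)) = ‖z‖⁻¹ • z := by
  have hy : ‖(y : Euc (n + 1))‖ = 1 := by simp
  have : Fact (Module.finrank ℝ (Euc (n + 1)) = n + 1) := ⟨finrank_euclideanSpace_fin⟩
  let b : ContDiffBump (y : Euc (n + 1)) := ⟨1 / 4, 1 / 2, by norm_num, by norm_num⟩
  -- `q` is the identity near `y`, and it never vanishes: the bump is supported where `|z - y| ≤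
  -- 1/2`, so the displacement from the unit vector `y` has length less than `1`. Hence `q` can be
  -- normalized everywhere.
  let q : Euc (n + 1) → Euc (n + 1) := fun z => y + b z • (z - y)
  have hq : ContDiff ℝ ∞ q := by
    have hb : ContDiff ℝ ∞ b := b.contDiff
    exact contDiff_const.add (hb.smul (contDiff_id.sub contDiff_const))
  have hq0 : ∀ z, q z ≠ 0 := by
    intro z hz
    have h1 : ‖b z • (z - y)‖ < 1 := by
      rw [norm_smul, Real.norm_of_nonneg b.nonneg]
      by_cases h : dist z y < 1 / 2
      · rw [dist_eq_norm] at h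
        nlinarith [b.le_one (x := z), b.nonneg (x := z), norm_nonneg (z - (y : Euc (n + 1)))]
      · rw [b.zero_of_le_dist (not_lt.1 h)]; simp
    have h2 : (y : Euc (n + 1)) = -(b z • (z - y)) := eq_neg_of_add_eq_zero_left hz
    rw [h2, norm_neg] at hy
    linarith
  have hr : ContDiff ℝ ∞ fun z => ‖q z‖⁻¹ • q z :=
    contDiff_iff_contDiffAt.2 fun z =>
      ((hq.contDiffAt.norm ℝ (hq0 z)).inv (norm_ne_zero_iff.2 (hq0 z))).smul hq.contDiffAt
  have hmem : ∀ z, ‖q z‖⁻¹ • q z ∈ sphere (0 : Euc (n + 1)) 1 := fun z => by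
    rw [mem_sphere_zero_iff_norm, norm_smul, norm_inv, norm_norm,
      inv_mul_cancel₀ (norm_ne_zero_iff.2 (hq0 z))]
  refine ⟨_, hr.contMDiff.codRestrict_sphere hmem, ?_⟩
  filter_upwards [b.eventuallyEq_one] with z hz
  have : q z = z := by simp [q, hz]
  simp [this]

/-- In the ambient space the set is cut out by `|z|² - 1` and by `f` composed with the radial
retraction. The second function is constant along the ray through `y`, so its differential kills
`y`; that of the first does not. The two differentials are therefore independent. -/
lemma IsSmoothHypersurface.exists_flatPatch_sphere {n : ℕ} {S : Set (sphere (0 : Euc (n + 2)) 1)}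
    (hS : IsSmoothHypersurface (𝓡 (n + 1)) S) (x : ((↑) '' S : Set (Euc (n + 2)))) :
    Nonempty (FlatPatch (Euc n)
      (Subtype.val : ((↑) '' S : Set (Euc (n + 2))) → Euc (n + 2)) x) := by
  have : Fact (Module.finrank ℝ (Euc (n + 2)) = n + 1 + 1) := ⟨finrank_euclideanSpace_fin⟩
  obtain ⟨y, hyS, hyx⟩ := x.2
  obtain ⟨x, hx⟩ := x
  change (y : Euc (n + 2)) = x at hyx
  subst hyx
  have hy : ‖(y : Euc (n + 2))‖ = 1 := by simp
  have hy0 : (y : Euc (n + 2)) ≠ 0 := by rw [← norm_ne_zero_iff, hy]; exact one_ne_zero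
  obtain ⟨V, hV, hyV, f, hf, hdf, hSV⟩ := hS y hyS
  obtain ⟨π, hπ, hπe⟩ := exists_sphere_retraction y
  obtain ⟨O, hOe, hO, hyO⟩ := _root_.mem_nhds_iff.1 hπe
  have hπs : ∀ z : sphere (0 : Euc (n + 2)) 1, (z : Euc (n + 2)) ∈ O → π z = z := by
    intro z hz
    have h1 : (π z : Euc (n + 2)) = ‖(z : Euc (n + 2))‖⁻¹ • (z : Euc (n + 2)) := hOe hz
    have h2 : ‖(z : Euc (n + 2))‖ = 1 := by simp
    rw [h2, inv_one, one_smul] at h1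
    exact Subtype.ext h1
  have hπy : π y = y := hπs y hyO
  let U : Set (Euc (n + 2)) := (O ∩ π ⁻¹' V) ∩ {0}ᶜ
  have hU : IsOpen U := (hO.inter (hV.preimage hπ.continuous)).inter isOpen_compl_singleton
  have hyU : (y : Euc (n + 2)) ∈ U := ⟨⟨hyO, by rw [mem_preimage, hπy]; exact hyV⟩, hy0⟩
  let h : Euc (n + 2) → ℝ := fun z => f (π z)
  have hh : ContDiffOn ℝ ∞ h U := by
    rw [← contMDiffOn_iff_contDiffOn]
    exact hf.comp hπ.contMDiffOn fun z hz => hz.1.2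
  have hhy : DifferentiableAt ℝ h y := (hh.contDiffAt (hU.mem_nhds hyU)).differentiableAt (by simp)
  let g : Euc (n + 2) → ℝ × ℝ := fun z => (‖z‖ ^ 2 - 1, h z)
  have hg : ContDiffOn ℝ ∞ g U :=
    (((contDiff_norm_sq ℝ).sub contDiff_const).contDiffOn).prodMk hh
  have hd1 : HasFDerivAt (fun z : Euc (n + 2) => ‖z‖ ^ 2 - 1)
      (2 • innerSL ℝ (y : Euc (n + 2))) (y : Euc (n + 2)) :=
    ((hasStrictFDerivAt_norm_sq (y : Euc (n + 2))).hasFDerivAt).sub_const 1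
  have hdg : fderiv ℝ g y = (2 • innerSL ℝ (y : Euc (n + 2))).prod (fderiv ℝ h y) :=
    (hd1.prodMk hhy.hasFDerivAt).fderiv
  have hray : fderiv ℝ h y (y : Euc (n + 2)) = 0 := by
    have h1 : HasDerivAt (fun t : ℝ => (y : Euc (n + 2)) + t • (y : Euc (n + 2)))
        (y : Euc (n + 2)) 0 := by
      simpa using ((hasDerivAt_id (0 : ℝ)).smul_const (y : Euc (n + 2))).const_add
        (y : Euc (n + 2))
    have h2 : HasDerivAt (fun t : ℝ => h ((y : Euc (n + 2)) + t • (y : Euc (n + 2))))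
        (fderiv ℝ h y (y : Euc (n + 2))) 0 :=
      HasFDerivAt.comp_hasDerivAt_of_eq (0 : ℝ) hhy.hasFDerivAt h1 (by simp)
    have h3 : (fun t : ℝ => h ((y : Euc (n + 2)) + t • (y : Euc (n + 2)))) =ᶠ[𝓝 0]
        fun _ => f y := by
      have hc : ContinuousAt (fun t : ℝ => (y : Euc (n + 2)) + t • (y : Euc (n + 2))) 0 :=
        h1.continuousAt
      have h5 : ∀ᶠ t : ℝ in 𝓝 0, (y : Euc (n + 2)) + t • (y : Euc (n + 2)) ∈ O :=
        hc.eventually (hO.mem_nhds (by simpa using hyO))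
      filter_upwards [h5, eventually_gt_nhds (show (-1 : ℝ) < 0 by norm_num)] with t ht ht1
      have h6 : (π ((y : Euc (n + 2)) + t • (y : Euc (n + 2))) : Euc (n + 2)) = y := by
        refine (hOe ht).trans ?_
        have h7 : (y : Euc (n + 2)) + t • (y : Euc (n + 2)) = (1 + t) • (y : Euc (n + 2)) := by
          rw [add_smul, one_smul]
        have h8 : (0 : ℝ) < 1 + t := by linarith
        rw [h7, norm_smul, hy, mul_one, Real.norm_of_nonneg h8.le, smul_smul,
          inv_mul_cancel₀ h8.ne', one_smul]
      exact congrArg f (Subtype.ext h6)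
    exact h2.unique ((hasDerivAt_const (0 : ℝ) (f y)).congr_of_eventuallyEq h3)
  have hne : fderiv ℝ h y ≠ 0 := by
    intro h0
    apply hdf
    have h1 : f =ᶠ[𝓝 y] fun z : sphere (0 : Euc (n + 2)) 1 => h z := by
      filter_upwards [(hO.preimage continuous_subtype_val).mem_nhds hyO] with z hz
      rw [show h z = f (π z) from rfl, hπs z hz]
    have h2 : MDifferentiableAt (𝓡 (n + 1)) 𝓘(ℝ, Euc (n + 2))
        ((↑) : sphere (0 : Euc (n + 2)) 1 → Euc (n + 2)) y :=
      (contMDiff_coe_sphere (m := ∞) y).mdifferentiableAt (by simp)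
    have h3 := (hhy.hasFDerivAt.hasMFDerivAt).comp y h2.hasMFDerivAt
    rw [h1.mfderiv_eq]
    refine h3.mfderiv.trans ?_
    rw [h0]
    ext1 v
    rfl
  refine exists_flatPatch_zeroSet (F := ℝ × ℝ) (f := g) _ hU hyU hg ?_ ?_ ?_
  · obtain ⟨v, hv⟩ : ∃ v, fderiv ℝ h y v ≠ 0 := by
      by_contra! hcon
      exact hne (ContinuousLinearMap.ext hcon)
    rintro ⟨a, b⟩
    rw [hdg]
    let β := b / fderiv ℝ h y v
    let i : ℝ := inner ℝ (y : Euc (n + 2)) v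
    -- `β` fits the second component, to which `y` does not contribute; the multiple of `y` then
    -- corrects the first, where the differential is `2⟨y, ·⟩` and `|y| = 1`.
    refine ⟨β • v + (a / 2 - β * i) • (y : Euc (n + 2)), Prod.ext ?_ ?_⟩
    · change (2 • innerSL ℝ (y : Euc (n + 2))) _ = a
      simp only [smul_apply, innerSL_apply_apply, inner_add_right,
        real_inner_smul_right, real_inner_self_eq_norm_sq, hy]
      change 2 • (β * i + (a / 2 - β * i) * 1 ^ 2) = a
      rw [nsmul_eq_mul]
      push_cast
      ring
    · change fderiv ℝ h y _ = b
      rw [map_add, map_smul, map_smul, hray, smul_zero, add_zero, smul_eq_mul]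
      exact div_mul_cancel₀ b hv
  · intro z hz
    constructor
    · rintro ⟨z', hz'S, rfl⟩
      have h2 : ‖(z' : Euc (n + 2))‖ = 1 := by simp
      have h3 : π z' = z' := hπs z' hz.1.1
      have h4 : z' ∈ V := h3 ▸ hz.1.2
      have h5 : z' ∈ S ∩ V := ⟨hz'S, h4⟩
      rw [hSV] at h5
      simp [g, h, h2, h3, h5.2]
    · intro h0
      have h1 : ‖z‖ ^ 2 - 1 = 0 := congrArg Prod.fst h0
      have h2 : f (π z) = 0 := congrArg Prod.snd h0
      have h3 : ‖z‖ = 1 := by nlinarith [norm_nonneg z]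
      have h4 : π z ∈ S ∩ V := by rw [hSV]; exact ⟨hz.1.2, h2⟩
      refine ⟨π z, h4.1, ?_⟩
      have h5 : (π z : Euc (n + 2)) = ‖z‖⁻¹ • z := hOe hz.1.1
      rw [h5, h3, inv_one, one_smul]
  · rw [finrank_euclideanSpace_fin, finrank_euclideanSpace_fin, Module.finrank_prod,
      Module.finrank_self]
    omega

namespace ConicalDomain

variable {m : ℕ} (D : ConicalDomain m) {i j : Fin D.l} {x y : Euc (m + 2)} {t : ℝ}

/-! ### Polar coordinates near the conical points -/

lemma eq_of_mem_source (hi : x ∈ (D.φ i).source) (hj : x ∈ (D.φ j).source) : i = j := by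
  by_contra h
  exact disjoint_left.1 (D.disjoint_V i j h) (subset_closure hi) (subset_closure hj)

lemma p_mem_source_iff : D.p j ∈ (D.φ i).source ↔ j = i := by
  refine ⟨fun h => D.eq_of_mem_source (D.p_mem_source j) h, ?_⟩
  rintro rfl
  exact D.p_mem_source j

lemma p_injective : Function.Injective D.p := fun _ j h =>
  D.p_mem_source_iff.1 (h ▸ D.p_mem_source j)

lemma φ_eq_zero_iff (hx : x ∈ (D.φ i).source) : D.φ i x = 0 ↔ x = D.p i := by
  rw [← D.φ_p i]
  exact (D.φ i).injOn.eq_iff hx (D.p_mem_source i)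

lemma norm_φ_lt_one (hx : x ∈ (D.φ i).source) : ‖D.φ i x‖ < 1 := by
  have := (D.φ i).map_source hx
  rwa [D.target_φ, mem_ball_zero_iff] at this

lemma smul_mem_target (ht : |t| < 1) (hy : ‖y‖ = 1) : t • y ∈ (D.φ i).target := by
  rw [D.target_φ, mem_ball_zero_iff, norm_smul, hy, mul_one]
  exact ht

lemma symm_mem_source (ht : |t| < 1) (hy : ‖y‖ = 1) : (D.φ i).symm (t • y) ∈ (D.φ i).source :=
  (D.φ i).map_target (D.smul_mem_target ht hy)

lemma φ_symm (ht : |t| < 1) (hy : ‖y‖ = 1) : D.φ i ((D.φ i).symm (t • y)) = t • y :=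
  (D.φ i).right_inv (D.smul_mem_target ht hy)

lemma symm_zero_smul : (D.φ i).symm ((0 : ℝ) • y) = D.p i := by
  rw [zero_smul, ← D.φ_p i, (D.φ i).left_inv (D.p_mem_source i)]

lemma norm_φ_symm (h0 : 0 ≤ t) (ht : t < 1) (hy : ‖y‖ = 1) :
    ‖D.φ i ((D.φ i).symm (t • y))‖ = t := by
  rw [D.φ_symm (abs_lt.2 ⟨by linarith, ht⟩) hy, norm_smul, hy, mul_one, Real.norm_of_nonneg h0]

lemma unit_φ_symm (h0 : 0 < t) (ht : t < 1) (hy : ‖y‖ = 1) :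
    ‖D.φ i ((D.φ i).symm (t • y))‖⁻¹ • D.φ i ((D.φ i).symm (t • y)) = y := by
  rw [D.norm_φ_symm h0.le ht hy, D.φ_symm (abs_lt.2 ⟨by linarith, ht⟩) hy, smul_smul,
    inv_mul_cancel₀ h0.ne', one_smul]

lemma symm_norm_smul_unit (hx : x ∈ (D.φ i).source) :
    (D.φ i).symm (‖D.φ i x‖ • ‖D.φ i x‖⁻¹ • D.φ i x) = x := by
  by_cases h : D.φ i x = 0
  · rw [h, norm_zero, zero_smul, ← h, (D.φ i).left_inv hx]
  · rw [smul_smul, mul_inv_cancel₀ (norm_ne_zero_iff.2 h), one_smul, (D.φ i).left_inv hx]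

lemma norm_of_mem_bdω (hy : y ∈ D.bdω i) : ‖y‖ = 1 := by
  obtain ⟨z, -, rfl⟩ := hy
  simp

lemma isCompact_bdω (i : Fin D.l) : IsCompact (D.bdω i) :=
  isClosed_frontier.isCompact.image continuous_subtype_val

lemma exists_polar_of_mem_Ω (hx : x ∈ D.Ω) (hi : x ∈ (D.φ i).source) :
    ∃ t ∈ Ioo (0 : ℝ) 1, ∃ y ∈ D.base i, D.φ i x = t • (y : Euc (m + 2)) := by
  have h : D.φ i x ∈ D.φ i '' (D.Ω ∩ (D.φ i).source) := ⟨x, ⟨hx, hi⟩, rfl⟩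
  rwa [D.image_φ] at h

lemma symm_mem_Ω_iff (h0 : 0 < t) (ht : t < 1) (y : sphere (0 : Euc (m + 2)) 1) :
    (D.φ i).symm (t • (y : Euc (m + 2))) ∈ D.Ω ↔ y ∈ D.base i := by
  have hy : ‖(y : Euc (m + 2))‖ = 1 := by simp
  have habs : |t| < 1 := abs_lt.2 ⟨by linarith, ht⟩
  constructor
  · intro h
    obtain ⟨t', ⟨h0', ht'⟩, y', hy', he⟩ := D.exists_polar_of_mem_Ω h (D.symm_mem_source habs hy)
    rw [D.φ_symm habs hy] at he
    have h1 : t = t' := by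
      have := congrArg norm he
      rwa [norm_smul, norm_smul, hy, norm_eq_of_mem_sphere y', mul_one, mul_one,
        Real.norm_of_nonneg h0.le, Real.norm_of_nonneg h0'.le] at this
    rw [h1] at he
    have h2 : y = y' := Subtype.ext (smul_right_injective _ h0'.ne' he)
    rwa [h2]
  · intro h
    have h1 : t • (y : Euc (m + 2)) ∈ D.φ i '' (D.Ω ∩ (D.φ i).source) := by
      rw [D.image_φ]; exact ⟨t, ⟨h0, ht⟩, y, h, rfl⟩
    obtain ⟨x, ⟨hxΩ, hx⟩, hxe⟩ := h1
    rwa [← hxe, (D.φ i).left_inv hx]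

/-- The direction of `φ_i` is continuous where `φ_i ≠ 0` and takes `Ω ∩ V_i` into `ω_i`; in the
opposite direction `y ↦ φ_i⁻¹(t y)` is continuous on the sphere. -/
lemma symm_mem_closure_iff (h0 : 0 < t) (ht : t < 1) (y : sphere (0 : Euc (m + 2)) 1) :
    (D.φ i).symm (t • (y : Euc (m + 2))) ∈ closure D.Ω ↔ y ∈ closure (D.base i) := by
  have hy : ‖(y : Euc (m + 2))‖ = 1 := by simp
  have habs : |t| < 1 := abs_lt.2 ⟨by linarith, ht⟩
  constructor
  · intro h
    by_contra hcon
    obtain ⟨O, hO, hOe⟩ := isOpen_induced_iff.1 (isClosed_closure (s := D.base i)).isOpen_compl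
    have hyO : (y : Euc (m + 2)) ∈ O := by
      have : y ∈ Subtype.val ⁻¹' O := by rw [hOe]; exact hcon
      exact this
    set x := (D.φ i).symm (t • (y : Euc (m + 2))) with hx
    have hxs : x ∈ (D.φ i).source := D.symm_mem_source habs hy
    have hφx : D.φ i x ≠ 0 := by
      rw [hx, D.φ_symm habs hy]
      exact smul_ne_zero h0.ne' (norm_ne_zero_iff.1 (by rw [hy]; exact one_ne_zero))
    have hc : ContinuousAt (D.φ i) x := (D.φ i).continuousAt hxs
    have hc2 : ContinuousAt (fun x => ‖D.φ i x‖⁻¹ • D.φ i x) x :=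
      (hc.norm.inv₀ (norm_ne_zero_iff.2 hφx)).smul hc
    have hN : ∀ᶠ x' in 𝓝 x, x' ∈ (D.φ i).source ∧ ‖D.φ i x'‖⁻¹ • D.φ i x' ∈ O :=
      ((D.φ i).open_source.eventually_mem hxs).and (hc2.eventually (hO.mem_nhds (by
        change ‖D.φ i x‖⁻¹ • D.φ i x ∈ O
        rw [hx, D.unit_φ_symm h0 ht hy]; exact hyO)))
    obtain ⟨x', ⟨hx's, hx'O⟩, hx'Ω⟩ := mem_closure_iff_nhds.1 h _ hN
    obtain ⟨t', ⟨h0', ht'⟩, y', hy', he⟩ := D.exists_polar_of_mem_Ω hx'Ω hx's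
    rw [he, norm_smul, norm_eq_of_mem_sphere y', mul_one, Real.norm_of_nonneg h0'.le, smul_smul,
      inv_mul_cancel₀ h0'.ne', one_smul] at hx'O
    have : y' ∈ Subtype.val ⁻¹' O := hx'O
    rw [hOe] at this
    exact this (subset_closure hy')
  · intro h
    have hc : Continuous fun y : sphere (0 : Euc (m + 2)) 1 =>
        (D.φ i).symm (t • (y : Euc (m + 2))) := by
      refine (D.φ i).continuousOn_symm.comp_continuous (by fun_prop) fun z => ?_
      exact D.smul_mem_target habs (by simp)
    exact map_mem_closure (f := fun y : sphere (0 : Euc (m + 2)) 1 =>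
      (D.φ i).symm (t • (y : Euc (m + 2)))) hc h fun z hz => (D.symm_mem_Ω_iff h0 ht z).2 hz

lemma symm_mem_frontier_iff (h0 : 0 < t) (ht : t < 1) (y : sphere (0 : Euc (m + 2)) 1) :
    (D.φ i).symm (t • (y : Euc (m + 2))) ∈ frontier D.Ω ↔ y ∈ frontier (D.base i) := by
  rw [D.isOpen_Ω.frontier_eq, (D.isOpen_base i).frontier_eq, mem_sdiff, mem_sdiff,
    D.symm_mem_closure_iff h0 ht, D.symm_mem_Ω_iff h0 ht]

lemma symm_mem_Ω₀ (h0 : 0 < t) (ht : t < 1) (hy : y ∈ D.bdω i) :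
    (D.φ i).symm (t • y) ∈ D.Ω₀ := by
  have hy1 := D.norm_of_mem_bdω hy
  have habs : |t| < 1 := abs_lt.2 ⟨by linarith, ht⟩
  obtain ⟨z, hz, rfl⟩ := hy
  refine ⟨(D.symm_mem_frontier_iff h0 ht z).2 hz, ?_⟩
  rintro ⟨j, hj⟩
  have h1 : D.p j ∈ (D.φ i).source := hj ▸ D.symm_mem_source habs hy1
  obtain rfl := D.p_mem_source_iff.1 h1
  have h2 := D.norm_φ_symm (i := j) h0.le ht hy1
  rw [← hj, D.φ_p, norm_zero] at h2
  exact h0.ne h2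

lemma φ_ne_zero (hx : x ∈ D.Ω₀) (hi : x ∈ (D.φ i).source) : D.φ i x ≠ 0 := by
  rw [Ne, D.φ_eq_zero_iff hi]
  rintro rfl
  exact hx.2 ⟨i, rfl⟩

lemma norm_φ_pos (hx : x ∈ D.Ω₀) (hi : x ∈ (D.φ i).source) : 0 < ‖D.φ i x‖ :=
  norm_pos_iff.2 (D.φ_ne_zero hx hi)

lemma unit_φ_mem (hx : x ∈ D.Ω₀) (hi : x ∈ (D.φ i).source) :
    ‖D.φ i x‖⁻¹ • D.φ i x ∈ D.bdω i := by
  have h0 := D.norm_φ_pos hx hi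
  let y : sphere (0 : Euc (m + 2)) 1 := ⟨‖D.φ i x‖⁻¹ • D.φ i x, by
    rw [mem_sphere_zero_iff_norm, norm_smul, norm_inv, norm_norm, inv_mul_cancel₀ h0.ne']⟩
  refine ⟨y, ?_, rfl⟩
  rw [← D.symm_mem_frontier_iff h0 (D.norm_φ_lt_one hi) y]
  have h := D.symm_norm_smul_unit hi
  change (D.φ i).symm (‖D.φ i x‖ • ‖D.φ i x‖⁻¹ • D.φ i x) ∈ _
  rw [h]
  exact hx.1

lemma p_notMem_Ω₀ (i : Fin D.l) : D.p i ∉ D.Ω₀ := fun h => h.2 ⟨i, rfl⟩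

lemma isOpen_compl_range_p : IsOpen (range D.p)ᶜ := (finite_range D.p).isClosed.isOpen_compl

/-! ### Cutoff functions -/

/-- A bump function on the unit ball, equal to `1` on the ball of radius `ε_i`. -/
def bump (i : Fin D.l) : ContDiffBump (0 : Euc (m + 2)) where
  rIn := D.ε i
  rOut := (1 + D.ε i) / 2
  rIn_pos := (D.ε_mem i).1
  rIn_lt_rOut := by linarith [(D.ε_mem i).2]

open Classical in
/-- A smooth cutoff function supported in `V_i`, equal to `1` where `|φ_i| ≤ ε_i`. -/
def cutoff (i : Fin D.l) (x : Euc (m + 2)) : ℝ :=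
  if x ∈ (D.φ i).source then D.bump i (D.φ i x) else 0

lemma cutoff_of_notMem (hx : x ∉ (D.φ i).source) : D.cutoff i x = 0 := if_neg hx

lemma cutoff_of_mem (hx : x ∈ (D.φ i).source) : D.cutoff i x = D.bump i (D.φ i x) := if_pos hx

lemma cutoff_mem_Icc (i : Fin D.l) (x : Euc (m + 2)) : D.cutoff i x ∈ Icc (0 : ℝ) 1 := by
  by_cases hx : x ∈ (D.φ i).source
  · rw [D.cutoff_of_mem hx]; exact ⟨(D.bump i).nonneg, (D.bump i).le_one⟩
  · rw [D.cutoff_of_notMem hx]; simp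

lemma cutoff_eq_one (hx : x ∈ (D.φ i).source) (h : ‖D.φ i x‖ ≤ D.ε i) : D.cutoff i x = 1 := by
  rw [D.cutoff_of_mem hx]
  exact (D.bump i).one_of_mem_closedBall (mem_closedBall_zero_iff.2 h)

lemma contDiffAt_φ (hx : x ∈ (D.φ i).source) : ContDiffAt ℝ ∞ (D.φ i) x :=
  (D.smooth_φ i).contDiffAt ((D.φ i).open_source.mem_nhds hx)

/-- The cutoff vanishes off the image under `φ_i⁻¹` of a closed ball inside the unit ball. This
image is compact, hence closed in the whole space and not only in `V_i`. -/
lemma cutoff_eventually_eq_zero (hx : x ∉ (D.φ i).source) : ∀ᶠ y in 𝓝 x, D.cutoff i y = 0 := by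
  let K := (D.φ i).symm '' closedBall 0 ((1 + D.ε i) / 2)
  have hsub : closedBall (0 : Euc (m + 2)) ((1 + D.ε i) / 2) ⊆ (D.φ i).target := by
    rw [D.target_φ]
    exact closedBall_subset_ball (by linarith [(D.ε_mem i).2])
  have hK : IsCompact K :=
    (isCompact_closedBall _ _).image_of_continuousOn ((D.φ i).continuousOn_symm.mono hsub)
  have hxK : x ∉ K := by
    rintro ⟨z, hz, rfl⟩
    exact hx ((D.φ i).map_target (hsub hz))
  filter_upwards [hK.isClosed.isOpen_compl.mem_nhds hxK] with y hy
  by_cases hys : y ∈ (D.φ i).source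
  · rw [D.cutoff_of_mem hys]
    refine (D.bump i).zero_of_le_dist (not_lt.1 fun h => hy ?_)
    exact ⟨D.φ i y, ball_subset_closedBall h, (D.φ i).left_inv hys⟩
  · exact D.cutoff_of_notMem hys

lemma contDiffAt_cutoff_smul {F : Type*} [NormedAddCommGroup F] [NormedSpace ℝ F]
    {f : Euc (m + 2) → F} (hf : x ∈ (D.φ i).source → ContDiffAt ℝ ∞ f x) :
    ContDiffAt ℝ ∞ (fun x => D.cutoff i x • f x) x := by
  by_cases hx : x ∈ (D.φ i).source
  · have h1 : ContDiffAt ℝ ∞ (fun x => D.bump i (D.φ i x) • f x) x :=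
      ((D.bump i).contDiffAt.comp x (D.contDiffAt_φ hx)).smul (hf hx)
    refine h1.congr_of_eventuallyEq ?_
    filter_upwards [(D.φ i).open_source.mem_nhds hx] with y hy
    rw [D.cutoff_of_mem hy]
  · refine (contDiffAt_const (c := (0 : F))).congr_of_eventuallyEq ?_
    filter_upwards [D.cutoff_eventually_eq_zero hx] with y hy
    rw [hy, zero_smul]

/-- The direction of `φ_i(x)`, cut off away from the conical points. -/
def direction (x : Euc (m + 2)) : Euc (m + 2) :=
  ∑ i, D.cutoff i x • ‖D.φ i x‖⁻¹ • D.φ i x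

/-- A smooth positive function on the complement of the conical points, equal to `|φ_i|` near
`p_i`. -/
def radius (x : Euc (m + 2)) : ℝ := 1 + ∑ i, D.cutoff i x • (‖D.φ i x‖ - 1)

lemma sum_cutoff {F : Type*} [AddCommGroup F] [Module ℝ F] (f : Fin D.l → F)
    (hx : x ∈ (D.φ i).source) : ∑ j, D.cutoff j x • f j = D.cutoff i x • f i := by
  refine Finset.sum_eq_single i (fun j _ hji => ?_) (by simp)
  rw [D.cutoff_of_notMem fun h => hji (D.eq_of_mem_source h hx), zero_smul]

lemma direction_eq (hx : x ∈ (D.φ i).source) (h : ‖D.φ i x‖ ≤ D.ε i) :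
    D.direction x = ‖D.φ i x‖⁻¹ • D.φ i x := by
  rw [direction, D.sum_cutoff _ hx, D.cutoff_eq_one hx h, one_smul]

lemma radius_eq (hx : x ∈ (D.φ i).source) (h : ‖D.φ i x‖ ≤ D.ε i) :
    D.radius x = ‖D.φ i x‖ := by
  rw [radius, D.sum_cutoff _ hx, D.cutoff_eq_one hx h, one_smul, add_sub_cancel]

/-- In `V_i` the radius is a convex combination of `1` and `|φ_i(x)|`, both positive off `p_i`. -/
lemma radius_pos (hx : x ∉ range D.p) : 0 < D.radius x := by
  by_cases h : ∃ i, x ∈ (D.φ i).source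
  · obtain ⟨i, hi⟩ := h
    rw [radius, D.sum_cutoff _ hi, smul_eq_mul]
    have h1 : 0 < ‖D.φ i x‖ := norm_pos_iff.2 fun h0 => hx ⟨i, ((D.φ_eq_zero_iff hi).1 h0).symm⟩
    obtain ⟨h2, h3⟩ := D.cutoff_mem_Icc i x
    have h4 := D.norm_φ_lt_one hi
    nlinarith
  · push Not at h
    rw [radius, Finset.sum_eq_zero fun i _ => by rw [D.cutoff_of_notMem (h i), zero_smul]]
    norm_num

lemma contDiffAt_norm_φ (hx : x ∉ range D.p) (hi : x ∈ (D.φ i).source) :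
    ContDiffAt ℝ ∞ (fun x => ‖D.φ i x‖) x :=
  (D.contDiffAt_φ hi).norm ℝ fun h0 => hx ⟨i, ((D.φ_eq_zero_iff hi).1 h0).symm⟩

lemma contDiffAt_direction (hx : x ∉ range D.p) : ContDiffAt ℝ ∞ D.direction x := by
  refine ContDiffAt.sum fun i _ => D.contDiffAt_cutoff_smul fun hi => ?_
  refine ((D.contDiffAt_norm_φ hx hi).inv ?_).smul (D.contDiffAt_φ hi)
  exact norm_ne_zero_iff.2 fun h0 => hx ⟨i, ((D.φ_eq_zero_iff hi).1 h0).symm⟩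

lemma contDiffAt_radius (hx : x ∉ range D.p) : ContDiffAt ℝ ∞ D.radius x :=
  contDiffAt_const.add (ContDiffAt.sum fun _ _ => D.contDiffAt_cutoff_smul fun hi =>
    (D.contDiffAt_norm_φ hx hi).sub contDiffAt_const)

end ConicalDomain

/-- Used for the glued spaces, where a point is recovered from its image through the canonical map
of a piece. The set `T` need not be open, since such a map is defined only over `Ω₀` or over a
collar. -/
lemma isEmbedding_of_local_inverse {A B : Type*} [TopologicalSpace A] [TopologicalSpace B]
    {f : A → B} (hf : Continuous f)
    (h : ∀ a, ∃ (T : Set B) (g : T → A) (O : Set B), Continuous g ∧ IsOpen O ∧ f a ∈ O ∧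
      ∀ a', f a' ∈ O → ∃ hT : f a' ∈ T, g ⟨f a', hT⟩ = a') : Topology.IsEmbedding f := by
  refine ⟨Topology.isInducing_iff_nhds.2 fun a => le_antisymm
    (Filter.map_le_iff_le_comap.1 hf.continuousAt) ?_, fun a a' haa => ?_⟩
  · obtain ⟨T, g, O, hg, hO, haO, hgO⟩ := h a
    obtain ⟨haT, hga⟩ := hgO a haO
    intro U hU
    have h1 : g ⁻¹' U ∈ 𝓝 (⟨f a, haT⟩ : T) := hg.continuousAt (by rwa [hga])
    rw [nhds_subtype_eq_comap] at h1
    obtain ⟨V, hV, hVU⟩ := h1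
    refine ⟨V ∩ O, Filter.inter_mem hV (hO.mem_nhds haO), fun a' ha' => ?_⟩
    obtain ⟨ha'T, hga'⟩ := hgO a' ha'.2
    have h2 : (⟨f a', ha'T⟩ : T) ∈ g ⁻¹' U := hVU ha'.1
    rwa [mem_preimage, hga'] at h2
  · obtain ⟨T, g, O, hg, hO, haO, hgO⟩ := h a
    obtain ⟨haT, hga⟩ := hgO a haO
    obtain ⟨haT', hga'⟩ := hgO a' (haa ▸ haO)
    rw [← hga, ← hga']
    congr 1
    exact Subtype.ext haa

namespace ConicalDomain

variable {m : ℕ} (D : ConicalDomain m) {i j : Fin D.l}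

/-! ### Coordinates on the space of units -/

/-- The set of points of `V_i` covered by the collar of size `ε_i`. -/
def nbhd (i : Fin D.l) : Set (Euc (m + 2)) := {x | x ∈ (D.φ i).source ∧ ‖D.φ i x‖ < D.ε i}

lemma isOpen_nbhd (i : Fin D.l) : IsOpen (D.nbhd i) :=
  (D.φ i).continuousOn.norm.isOpen_inter_preimage (D.φ i).open_source isOpen_Iio

lemma p_mem_nbhd (i : Fin D.l) : D.p i ∈ D.nbhd i :=
  ⟨D.p_mem_source i, by rw [D.φ_p, norm_zero]; exact (D.ε_mem i).1⟩

lemma symm_mem_nbhd {t : ℝ} {y : Euc (m + 2)} (h0 : 0 ≤ t) (ht : t < D.ε i) (hy : ‖y‖ = 1) :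
    (D.φ i).symm (t • y) ∈ D.nbhd i := by
  have ht1 := ht.trans (D.ε_mem i).2
  exact ⟨D.symm_mem_source (abs_lt.2 ⟨by linarith, ht1⟩) hy, by
    rwa [D.norm_φ_symm h0 ht1 hy]⟩

lemma direction_symm {t : ℝ} {y : Euc (m + 2)} (h0 : 0 < t) (ht : t < D.ε i) (hy : ‖y‖ = 1) :
    D.direction ((D.φ i).symm (t • y)) = y := by
  obtain ⟨h1, h2⟩ := D.symm_mem_nbhd h0.le ht hy
  rw [D.direction_eq h1 h2.le, D.unit_φ_symm h0 (ht.trans (D.ε_mem i).2) hy]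

lemma radius_symm {t : ℝ} {y : Euc (m + 2)} (h0 : 0 < t) (ht : t < D.ε i) (hy : ‖y‖ = 1) :
    D.radius ((D.φ i).symm (t • y)) = t := by
  obtain ⟨h1, h2⟩ := D.symm_mem_nbhd h0.le ht hy
  rw [D.radius_eq h1 h2.le, D.norm_φ_symm h0.le (ht.trans (D.ε_mem i).2) hy]

/-- Position, direction and radius of a unit. -/
def unitEmb : D.Units → Euc (m + 2) × Euc (m + 2) × ℝ :=
  Quot.lift (Sum.elim (fun z => ((D.φ z.1).symm (z.2.1.1 • z.2.1.2), z.2.1.2, z.2.1.1))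
    (fun x => ((x : Euc (m + 2)), D.direction x, D.radius x))) (by
      rintro _ _ ⟨i, z, x, ht, hx⟩
      have hy := D.norm_of_mem_bdω z.2.2
      simp only [Sum.elim_inl, Sum.elim_inr, hx]
      rw [D.direction_symm ht z.2.1.2 hy, D.radius_symm ht z.2.1.2 hy])

/-- The boundary defining function on the space of units. -/
def rho (u : D.Units) : ℝ := (D.unitEmb u).2.2

lemma unitEmb_collar (z : D.unitCollar i) : D.unitEmb (D.unitsOfCollar i z) =
    ((D.φ i).symm (z.1.1 • z.1.2), z.1.2, z.1.1) := rfl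

lemma unitEmb_smooth (x : D.Ω₀) : D.unitEmb (D.unitsOfSmooth x) =
    ((x : Euc (m + 2)), D.direction x, D.radius x) := rfl

lemma unitEmb_tip (y : D.bdω i) : D.unitEmb (D.tip i y) = (D.p i, (y : Euc (m + 2)), 0) := by
  rw [tip, unitEmb_collar]
  exact Prod.ext D.symm_zero_smul rfl

lemma rho_smooth_pos (x : D.Ω₀) : 0 < D.rho (D.unitsOfSmooth x) := D.radius_pos x.2.2

lemma rho_tip (y : D.bdω i) : D.rho (D.tip i y) = 0 := rfl

lemma unitsOfCollar_eq_smooth {z : D.unitCollar i} (ht : 0 < z.1.1) :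
    D.unitsOfCollar i z = D.unitsOfSmooth ⟨(D.φ i).symm (z.1.1 • z.1.2),
      D.symm_mem_Ω₀ ht (z.2.1.2.trans (D.ε_mem i).2) z.2.2⟩ :=
  Quot.sound (UnitRel.glue i z _ ht rfl)

lemma unitsOfCollar_eq_tip {z : D.unitCollar i} (ht : z.1.1 = 0) :
    D.unitsOfCollar i z = D.tip i ⟨z.1.2, z.2.2⟩ :=
  congrArg (D.unitsOfCollar i) (Subtype.ext (Prod.ext ht rfl))

lemma units_cases (u : D.Units) :
    (∃ x, u = D.unitsOfSmooth x) ∨ ∃ i, ∃ y : D.bdω i, u = D.tip i y := by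
  rcases u with ⟨⟨i, z⟩ | x⟩
  · rcases z.2.1.1.eq_or_lt with h | h
    · exact Or.inr ⟨i, _, D.unitsOfCollar_eq_tip h.symm⟩
    · exact Or.inl ⟨_, D.unitsOfCollar_eq_smooth h⟩
  · exact Or.inl ⟨x, rfl⟩

lemma mem_unitCollar_of_mem_nbhd {x : Euc (m + 2)} (hx : x ∈ D.Ω₀) (hi : x ∈ D.nbhd i) :
    (‖D.φ i x‖, ‖D.φ i x‖⁻¹ • D.φ i x) ∈ D.unitCollar i :=
  ⟨⟨norm_nonneg _, hi.2⟩, D.unit_φ_mem hx hi.1⟩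

lemma unitsOfSmooth_eq_collar (x : D.Ω₀) (hi : (x : Euc (m + 2)) ∈ D.nbhd i) :
    D.unitsOfSmooth x = D.unitsOfCollar i ⟨_, D.mem_unitCollar_of_mem_nbhd x.2 hi⟩ :=
  (Quot.sound (UnitRel.glue i _ x (D.norm_φ_pos x.2 hi.1) (D.symm_norm_smul_unit hi.1).symm)).symm

/-- The inverse of `unitEmb` near the tips: the collar coordinates are the recorded radius and
direction. -/
lemma exists_eq_unitsOfCollar {u : D.Units} (hi : (D.unitEmb u).1 ∈ D.nbhd i) :
    ∃ h : ((D.unitEmb u).2.2, (D.unitEmb u).2.1) ∈ D.unitCollar i,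
      D.unitsOfCollar i ⟨_, h⟩ = u := by
  suffices h : ∃ z, u = D.unitsOfCollar i z by
    obtain ⟨z, rfl⟩ := h
    exact ⟨z.2, rfl⟩
  rcases D.units_cases u with ⟨x, rfl⟩ | ⟨j, y, rfl⟩
  · exact ⟨_, D.unitsOfSmooth_eq_collar x hi⟩
  · rw [unitEmb_tip] at hi
    obtain rfl := D.p_mem_source_iff.1 hi.1
    exact ⟨_, rfl⟩

lemma exists_eq_unitsOfSmooth {u : D.Units} (h : (D.unitEmb u).1 ∉ range D.p) :
    ∃ hx : (D.unitEmb u).1 ∈ D.Ω₀, D.unitsOfSmooth ⟨_, hx⟩ = u := by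
  rcases D.units_cases u with ⟨x, rfl⟩ | ⟨j, y, rfl⟩
  · exact ⟨x.2, rfl⟩
  · rw [unitEmb_tip] at h
    exact absurd ⟨j, rfl⟩ h

lemma continuous_unitsOfCollar (i : Fin D.l) : Continuous (D.unitsOfCollar i) :=
  continuous_quot_mk.comp (continuous_inl.comp continuous_sigmaMk)

lemma continuous_unitsOfSmooth : Continuous D.unitsOfSmooth :=
  continuous_quot_mk.comp continuous_inr

lemma continuous_units_iff {Y : Type*} [TopologicalSpace Y] {f : D.Units → Y} :
    Continuous f ↔ (∀ i, Continuous fun z => f (D.unitsOfCollar i z)) ∧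
      Continuous fun x => f (D.unitsOfSmooth x) := by
  refine ⟨fun h => ⟨fun i => h.comp (D.continuous_unitsOfCollar i),
    h.comp D.continuous_unitsOfSmooth⟩, fun h => ?_⟩
  refine (isQuotientMap_quot_mk (r := D.UnitRel)).continuous_iff.2 ?_
  exact continuous_sum_dom.2 ⟨continuous_sigma h.1, h.2⟩

lemma continuous_symm_smul {Y : Type*} [TopologicalSpace Y] {f : Y → ℝ} {g : Y → Euc (m + 2)}
    (hf : Continuous f) (hg : Continuous g) (h : ∀ a, |f a| < 1) (h1 : ∀ a, ‖g a‖ = 1) :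
    Continuous fun a => (D.φ i).symm (f a • g a) :=
  (D.φ i).continuousOn_symm.comp_continuous (hf.smul hg) fun a => D.smul_mem_target (h a) (h1 a)

lemma abs_lt_one_of_mem {z : ℝ × Euc (m + 2)} (hz : z ∈ D.unitCollar i) : |z.1| < 1 :=
  abs_lt.2 ⟨by linarith [hz.1.1], hz.1.2.trans (D.ε_mem i).2⟩

lemma continuous_pos_collar {Y : Type*} [TopologicalSpace Y] {f : Y → ℝ × Euc (m + 2)}
    (hf : Continuous f) (h : ∀ a, f a ∈ D.unitCollar i) :
    Continuous fun a => ((D.φ i).symm ((f a).1 • (f a).2), (f a).2, (f a).1) :=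
  (D.continuous_symm_smul hf.fst hf.snd (fun a => D.abs_lt_one_of_mem (h a))
    fun a => D.norm_of_mem_bdω (h a).2).prodMk (hf.snd.prodMk hf.fst)

lemma continuous_direction : Continuous fun x : D.Ω₀ => D.direction x :=
  continuous_iff_continuousAt.2 fun x =>
    ((D.contDiffAt_direction x.2.2).continuousAt).comp continuousAt_subtype_val

lemma continuous_radius : Continuous fun x : D.Ω₀ => D.radius x :=
  continuous_iff_continuousAt.2 fun x =>
    ((D.contDiffAt_radius x.2.2).continuousAt).comp continuousAt_subtype_val

lemma continuous_unitEmb : Continuous D.unitEmb :=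
  D.continuous_units_iff.2 ⟨fun _ => D.continuous_pos_collar continuous_subtype_val fun z => z.2,
    continuous_subtype_val.prodMk (D.continuous_direction.prodMk D.continuous_radius)⟩

lemma isEmbedding_unitEmb : Topology.IsEmbedding D.unitEmb := by
  refine isEmbedding_of_local_inverse D.continuous_unitEmb fun u => ?_
  rcases D.units_cases u with ⟨x, rfl⟩ | ⟨i, y, rfl⟩
  · refine ⟨{b | b.1 ∈ D.Ω₀}, fun b => D.unitsOfSmooth ⟨b.1.1, b.2⟩, {b | b.1 ∉ range D.p},
      D.continuous_unitsOfSmooth.comp (by fun_prop), D.isOpen_compl_range_p.preimage continuous_fst,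
      x.2.2, fun u hu => D.exists_eq_unitsOfSmooth hu⟩
  · refine ⟨{b | (b.2.2, b.2.1) ∈ D.unitCollar i},
      fun b => D.unitsOfCollar i ⟨(b.1.2.2, b.1.2.1), b.2⟩, {b | b.1 ∈ D.nbhd i},
      (D.continuous_unitsOfCollar i).comp (by fun_prop),
      (D.isOpen_nbhd i).preimage continuous_fst, ?_, fun u hu => D.exists_eq_unitsOfCollar hu⟩
    rw [mem_ofPred_eq, unitEmb_tip]
    exact D.p_mem_nbhd i

lemma rho_eq_zero_iff {u : D.Units} : D.rho u = 0 ↔ ∃ i, ∃ y : D.bdω i, u = D.tip i y := by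
  rcases D.units_cases u with ⟨x, rfl⟩ | ⟨i, y, rfl⟩
  · refine iff_of_false (D.rho_smooth_pos x).ne' ?_
    rintro ⟨i, y, h⟩
    have := D.rho_smooth_pos x
    rw [h, rho_tip] at this
    exact this.false
  · exact iff_of_true rfl ⟨i, y, rfl⟩

lemma rho_ne_zero_iff {u : D.Units} : D.rho u ≠ 0 ↔ ∃ x, u = D.unitsOfSmooth x := by
  rcases D.units_cases u with ⟨x, rfl⟩ | ⟨i, y, rfl⟩
  · exact iff_of_true (D.rho_smooth_pos x).ne' ⟨x, rfl⟩
  · refine iff_of_false (fun h => h rfl) ?_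
    rintro ⟨x, h⟩
    have := D.rho_smooth_pos x
    rw [← h, rho_tip] at this
    exact this.false

lemma unitsOfSmooth_injective : Function.Injective D.unitsOfSmooth := fun _ _ h =>
  Subtype.ext (congrArg (fun u => (D.unitEmb u).1) h)

lemma tip_eq_iff {y : D.bdω i} {y' : D.bdω j} :
    D.tip i y = D.tip j y' ↔ i = j ∧ (y : Euc (m + 2)) = y' := by
  constructor
  · intro h
    have h1 := congrArg D.unitEmb h
    rw [unitEmb_tip, unitEmb_tip] at h1
    exact ⟨D.p_injective (congrArg Prod.fst h1), congrArg (fun q => q.2.1) h1⟩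
  · rintro ⟨rfl, h⟩
    rw [Subtype.ext h]

/-! ### Coordinates on the space of arrows -/

/-- The ratio of the radii of the domain and of the range of an arrow. -/
def ratio : D.Arrows → ℝ :=
  Quot.lift (Sum.elim (fun g => g.2.1.1.2) (fun x => D.radius x.2 / D.radius x.1)) (by
    rintro _ _ ⟨i, g, x, ht, h₁, h₂⟩
    have hy1 := D.norm_of_mem_bdω g.2.2.2.2
    have hy2 := D.norm_of_mem_bdω g.2.2.1.2
    have e1 : D.radius x.1 = g.1.1.1 := by
      rw [h₁]; exact D.radius_symm ht g.2.2.2.1.2 hy1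
    have e2 : D.radius x.2 = g.1.1.1 * g.1.1.2 := by
      rw [h₂]; exact D.radius_symm (mul_pos ht g.2.1) g.2.2.1.1.2 hy2
    simp only [Sum.elim_inl, Sum.elim_inr]
    rw [e1, e2, mul_div_cancel_left₀ _ ht.ne'])

/-- The arrow `(0, s, y₁, y₂)` of the collar at `p_i`. -/
def tipArrow (i : Fin D.l) (s : ℝ) (hs : 0 < s) (y₁ y₂ : D.bdω i) : D.Arrows :=
  D.arrowsOfCollar i ⟨((0, s), (y₁, y₂)), hs,
    ⟨by simp [coneGroupoid, GroupoidData.prod, GroupoidData.dilation, (D.ε_mem i).1], y₂.2⟩,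
    ⟨⟨le_rfl, (D.ε_mem i).1⟩, y₁.2⟩⟩

lemma ran_pair (x : D.Ω₀ × D.Ω₀) : D.ran (D.arrowsOfPair x) = D.unitsOfSmooth x.1 := rfl

lemma dom_pair (x : D.Ω₀ × D.Ω₀) : D.dom (D.arrowsOfPair x) = D.unitsOfSmooth x.2 := rfl

lemma ratio_pair (x : D.Ω₀ × D.Ω₀) :
    D.ratio (D.arrowsOfPair x) = D.radius x.2 / D.radius x.1 := rfl

lemma ran_tipArrow (s : ℝ) (hs : 0 < s) (y₁ y₂ : D.bdω i) :
    D.ran (D.tipArrow i s hs y₁ y₂) = D.tip i y₁ := rfl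

lemma dom_tipArrow (s : ℝ) (hs : 0 < s) (y₁ y₂ : D.bdω i) :
    D.dom (D.tipArrow i s hs y₁ y₂) = D.tip i y₂ :=
  D.unitsOfCollar_eq_tip (zero_mul s)

lemma arrows_cases (g : D.Arrows) : (∃ x, g = D.arrowsOfPair x) ∨
    ∃ i s, ∃ hs : 0 < s, ∃ y₁ y₂, g = D.tipArrow i s hs y₁ y₂ := by
  rcases g with ⟨⟨i, g⟩ | x⟩
  · rcases g.2.2.2.1.1.eq_or_lt with h | h
    · refine Or.inr ⟨i, g.1.1.2, g.2.1, ⟨_, g.2.2.2.2⟩, ⟨_, g.2.2.1.2⟩, ?_⟩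
      exact congrArg (D.arrowsOfCollar i) (Subtype.ext (Prod.ext (Prod.ext h.symm rfl) rfl))
    · refine Or.inl ⟨(⟨_, D.symm_mem_Ω₀ h (g.2.2.2.1.2.trans (D.ε_mem i).2) g.2.2.2.2⟩,
        ⟨_, D.symm_mem_Ω₀ (mul_pos h g.2.1) (g.2.2.1.1.2.trans (D.ε_mem i).2) g.2.2.1.2⟩), ?_⟩
      exact Quot.sound (ArrowRel.glue i g _ h rfl rfl)
  · exact Or.inl ⟨x, rfl⟩

lemma arrowsOfPair_eq_collar (x : D.Ω₀ × D.Ω₀) (h1 : (x.1 : Euc (m + 2)) ∈ D.nbhd i)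
    (h2 : (x.2 : Euc (m + 2)) ∈ D.nbhd i) : ∃ g, D.arrowsOfPair x = D.arrowsOfCollar i g := by
  have h10 := D.norm_φ_pos x.1.2 h1.1
  have h20 := D.norm_φ_pos x.2.2 h2.1
  have hc : ‖D.φ i x.1‖ * (‖D.φ i x.2‖ / ‖D.φ i x.1‖) = ‖D.φ i x.2‖ :=
    mul_div_cancel₀ _ h10.ne'
  refine ⟨⟨((‖D.φ i x.1‖, ‖D.φ i x.2‖ / ‖D.φ i x.1‖),
    (‖D.φ i x.1‖⁻¹ • D.φ i x.1, ‖D.φ i x.2‖⁻¹ • D.φ i x.2)), div_pos h20 h10, ?_,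
    D.mem_unitCollar_of_mem_nbhd x.1.2 h1⟩, ?_⟩
  · change (‖D.φ i x.1‖ * (‖D.φ i x.2‖ / ‖D.φ i x.1‖), ‖D.φ i x.2‖⁻¹ • D.φ i x.2) ∈ _
    rw [hc]
    exact D.mem_unitCollar_of_mem_nbhd x.2.2 h2
  · refine (Quot.sound (ArrowRel.glue i _ x h10 (D.symm_norm_smul_unit h1.1).symm ?_)).symm
    simp only [hc]
    exact (D.symm_norm_smul_unit h2.1).symm

/-- The embedding of the space of arrows by range, domain and ratio. -/
def arrowEmb : D.Arrows →
    ((Euc (m + 2) × Euc (m + 2) × ℝ) × (Euc (m + 2) × Euc (m + 2) × ℝ)) × ℝ :=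
  D.groupoid.arrowEmbedding D.unitEmb D.ratio

lemma arrowEmb_eq (g : D.Arrows) :
    D.arrowEmb g = ((D.unitEmb (D.ran g), D.unitEmb (D.dom g)), D.ratio g) := rfl

lemma exists_eq_arrowsOfCollar {g : D.Arrows} (h1 : (D.arrowEmb g).1.1.1 ∈ D.nbhd i)
    (h2 : (D.arrowEmb g).1.2.1 ∈ D.nbhd i) :
    ∃ h : (((D.arrowEmb g).1.1.2.2, (D.arrowEmb g).2),
        ((D.arrowEmb g).1.1.2.1, (D.arrowEmb g).1.2.2.1)) ∈ D.arrowCollar i,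
      D.arrowsOfCollar i ⟨_, h⟩ = g := by
  suffices h : ∃ z, g = D.arrowsOfCollar i z by
    obtain ⟨z, rfl⟩ := h
    exact ⟨z.2, rfl⟩
  rcases D.arrows_cases g with ⟨x, rfl⟩ | ⟨j, s, hs, y₁, y₂, rfl⟩
  · exact D.arrowsOfPair_eq_collar x h1 h2
  · rw [arrowEmb_eq, ran_tipArrow, unitEmb_tip] at h1
    obtain rfl := D.p_mem_source_iff.1 h1.1
    exact ⟨_, rfl⟩

lemma exists_eq_arrowsOfPair {g : D.Arrows} (h : (D.arrowEmb g).1.1.1 ∉ range D.p) :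
    ∃ hx : (D.arrowEmb g).1.1.1 ∈ D.Ω₀ ∧ (D.arrowEmb g).1.2.1 ∈ D.Ω₀,
      D.arrowsOfPair (⟨_, hx.1⟩, ⟨_, hx.2⟩) = g := by
  rcases D.arrows_cases g with ⟨x, rfl⟩ | ⟨j, s, hs, y₁, y₂, rfl⟩
  · exact ⟨⟨x.1.2, x.2.2⟩, rfl⟩
  · rw [arrowEmb_eq, ran_tipArrow, unitEmb_tip] at h
    exact absurd ⟨j, rfl⟩ h

lemma continuous_arrowsOfCollar (i : Fin D.l) : Continuous (D.arrowsOfCollar i) :=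
  continuous_quot_mk.comp (continuous_inl.comp continuous_sigmaMk)

lemma continuous_arrowsOfPair : Continuous D.arrowsOfPair :=
  continuous_quot_mk.comp continuous_inr

lemma continuous_arrows_iff {Y : Type*} [TopologicalSpace Y] {f : D.Arrows → Y} :
    Continuous f ↔ (∀ i, Continuous fun z => f (D.arrowsOfCollar i z)) ∧
      Continuous fun x => f (D.arrowsOfPair x) := by
  refine ⟨fun h => ⟨fun i => h.comp (D.continuous_arrowsOfCollar i),
    h.comp D.continuous_arrowsOfPair⟩, fun h => ?_⟩
  refine (isQuotientMap_quot_mk (r := D.ArrowRel)).continuous_iff.2 ?_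
  exact continuous_sum_dom.2 ⟨continuous_sigma h.1, h.2⟩

lemma continuous_arrowEmb : Continuous D.arrowEmb := by
  refine D.continuous_arrows_iff.2 ⟨fun i => ?_, ?_⟩
  · have hr : Continuous fun g : D.arrowCollar i => (coneGroupoid m).r g.1 :=
      continuous_subtype_val.fst.fst.prodMk continuous_subtype_val.snd.fst
    have hd : Continuous fun g : D.arrowCollar i => (coneGroupoid m).d g.1 :=
      (continuous_subtype_val.fst.fst.mul continuous_subtype_val.fst.snd).prodMk
        continuous_subtype_val.snd.snd
    exact ((D.continuous_pos_collar hr fun g => g.2.2.2).prodMk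
      (D.continuous_pos_collar hd fun g => g.2.2.1)).prodMk continuous_subtype_val.fst.snd
  · have he : Continuous fun x : D.Ω₀ => D.unitEmb (D.unitsOfSmooth x) :=
      D.continuous_unitEmb.comp D.continuous_unitsOfSmooth
    refine ((he.comp continuous_fst).prodMk (he.comp continuous_snd)).prodMk ?_
    exact (D.continuous_radius.comp continuous_snd).div₀ (D.continuous_radius.comp continuous_fst)
      fun x => (D.radius_pos x.1.2.2).ne'

lemma isEmbedding_arrowEmb : Topology.IsEmbedding D.arrowEmb := by
  refine isEmbedding_of_local_inverse D.continuous_arrowEmb fun g => ?_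
  rcases D.arrows_cases g with ⟨x, rfl⟩ | ⟨i, s, hs, y₁, y₂, rfl⟩
  · refine ⟨{b | b.1.1.1 ∈ D.Ω₀ ∧ b.1.2.1 ∈ D.Ω₀},
      fun b => D.arrowsOfPair (⟨b.1.1.1.1, b.2.1⟩, ⟨b.1.1.2.1, b.2.2⟩), {b | b.1.1.1 ∉ range D.p},
      D.continuous_arrowsOfPair.comp (by fun_prop), D.isOpen_compl_range_p.preimage (by fun_prop),
      x.1.2.2, fun u hu => D.exists_eq_arrowsOfPair hu⟩
  · refine ⟨{b | ((b.1.1.2.2, b.2), (b.1.1.2.1, b.1.2.2.1)) ∈ D.arrowCollar i},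
      fun b => D.arrowsOfCollar i ⟨((b.1.1.1.2.2, b.1.2), (b.1.1.1.2.1, b.1.1.2.2.1)), b.2⟩,
      {b | b.1.1.1 ∈ D.nbhd i ∧ b.1.2.1 ∈ D.nbhd i},
      (D.continuous_arrowsOfCollar i).comp (by fun_prop),
      ((D.isOpen_nbhd i).preimage (by fun_prop)).inter ((D.isOpen_nbhd i).preimage (by fun_prop)),
      ?_, fun u hu => D.exists_eq_arrowsOfCollar hu.1 hu.2⟩
    rw [mem_ofPred_eq, arrowEmb_eq, ran_tipArrow, dom_tipArrow, unitEmb_tip, unitEmb_tip]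
    exact ⟨D.p_mem_nbhd i, D.p_mem_nbhd i⟩

/-! ### The groupoid laws -/

/-- Range, domain and ratio determine an arrow; every groupoid law is reduced to this. -/
lemma arrow_ext {g h : D.Arrows} (hr : D.ran g = D.ran h) (hd : D.dom g = D.dom h)
    (hs : D.ratio g = D.ratio h) : g = h := by
  apply D.isEmbedding_arrowEmb.injective
  rw [arrowEmb_eq, arrowEmb_eq, hr, hd, hs]

lemma ratio_pos (g : D.Arrows) : 0 < D.ratio g := by
  rcases D.arrows_cases g with ⟨x, rfl⟩ | ⟨j, s, hs, y₁, y₂, rfl⟩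
  · exact div_pos (D.radius_pos x.2.2.2) (D.radius_pos x.1.2.2)
  · exact hs

lemma rho_dom (g : D.Arrows) : D.rho (D.dom g) = D.ratio g * D.rho (D.ran g) := by
  rcases D.arrows_cases g with ⟨x, rfl⟩ | ⟨j, s, hs, y₁, y₂, rfl⟩
  · exact (div_mul_cancel₀ _ (D.radius_pos x.1.2.2).ne').symm
  · rw [dom_tipArrow, ran_tipArrow, rho_tip, rho_tip, mul_zero]

lemma MulRel.spec {D : ConicalDomain m} {g h k : D.Arrows} (H : D.MulRel g h k) :
    D.ran k = D.ran g ∧ D.dom k = D.dom h ∧ D.ratio k = D.ratio g * D.ratio h := by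
  rcases H with ⟨i, ⟨g, hg⟩, ⟨h, hh⟩, ⟨k, hk'⟩, hgh, hk⟩ | ⟨x, y, z⟩
  · subst hk
    refine ⟨rfl, ?_, rfl⟩
    refine congrArg (D.unitsOfCollar i) (Subtype.ext (Prod.ext ?_ rfl))
    have h1 : g.1.1 * g.1.2 = h.1.1 := congrArg Prod.fst hgh
    change g.1.1 * (g.1.2 * h.1.2) = h.1.1 * h.1.2
    rw [← mul_assoc, h1]
  · refine ⟨rfl, rfl, ?_⟩
    rw [ratio_pair, ratio_pair, ratio_pair]
    have := (D.radius_pos y.2.2).ne'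
    field_simp

/-- Composable arrows are of the same kind, because `ρ` vanishes at tips and at no point of `Ω₀`.
Two arrows between tips belong to the same collar. -/
lemma exists_mulRel {g h : D.Arrows} (hgh : D.dom g = D.ran h) : ∃ k, D.MulRel g h k := by
  rcases D.arrows_cases g with ⟨⟨x, y⟩, rfl⟩ | ⟨i, s, hs, y₁, y₂, rfl⟩ <;>
  rcases D.arrows_cases h with ⟨⟨y', z⟩, rfl⟩ | ⟨j, s', hs', z₁, z₂, rfl⟩
  · rw [dom_pair, ran_pair] at hgh
    obtain rfl : y = y' := D.unitsOfSmooth_injective hgh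
    exact ⟨_, MulRel.smooth x y z⟩
  · rw [dom_pair, ran_tipArrow] at hgh
    exact absurd (hgh ▸ D.rho_tip z₁) (D.rho_smooth_pos _).ne'
  · rw [dom_tipArrow, ran_pair] at hgh
    exact absurd (hgh ▸ D.rho_tip y₂) (D.rho_smooth_pos _).ne'
  · rw [dom_tipArrow, ran_tipArrow] at hgh
    obtain ⟨rfl, hy⟩ := D.tip_eq_iff.1 hgh
    refine ⟨D.tipArrow i (s * s') (mul_pos hs hs') y₁ z₂, MulRel.collar i _ _ _ ?_ rfl⟩
    exact Prod.ext (zero_mul s) hy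

/-- Any arrow related to `g` and `h` has the range of `g`, the domain of `h` and the product ratio,
so it is unique. Hence the choice in `mul` is harmless and the products of the pieces agree. -/
lemma mul_eq_of_mulRel {g h k : D.Arrows} (H : D.MulRel g h k) : D.mul g h = k := by
  have hex : ∃ k, D.MulRel g h k := ⟨k, H⟩
  obtain ⟨h1, h2, h3⟩ := H.spec
  have h4 : D.MulRel g h (D.mul g h) := by
    rw [mul, dif_pos hex]
    exact hex.choose_spec
  obtain ⟨h5, h6, h7⟩ := h4.spec
  exact D.arrow_ext (h5.trans h1.symm) (h6.trans h2.symm) (h7.trans h3.symm)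

lemma mul_spec {g h : D.Arrows} (hgh : D.dom g = D.ran h) :
    D.ran (D.mul g h) = D.ran g ∧ D.dom (D.mul g h) = D.dom h ∧
      D.ratio (D.mul g h) = D.ratio g * D.ratio h := by
  obtain ⟨k, hk⟩ := D.exists_mulRel hgh
  rw [D.mul_eq_of_mulRel hk]
  exact hk.spec

lemma unit_tip (y : D.bdω i) : D.unit (D.tip i y) = D.tipArrow i 1 one_pos y y := rfl

lemma unit_spec (u : D.Units) :
    D.ran (D.unit u) = u ∧ D.dom (D.unit u) = u ∧ D.ratio (D.unit u) = 1 := by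
  rcases D.units_cases u with ⟨x, rfl⟩ | ⟨i, y, rfl⟩
  · exact ⟨rfl, rfl, div_self (D.radius_pos x.2.2).ne'⟩
  · exact ⟨rfl, by rw [unit_tip, dom_tipArrow], rfl⟩

lemma inversion_tipArrow (s : ℝ) (hs : 0 < s) (y₁ y₂ : D.bdω i) :
    D.inversion (D.tipArrow i s hs y₁ y₂) = D.tipArrow i s⁻¹ (inv_pos.2 hs) y₂ y₁ :=
  congrArg (D.arrowsOfCollar i) (Subtype.ext (Prod.ext (Prod.ext (zero_mul s) rfl) rfl))

lemma inversion_spec (g : D.Arrows) : D.ran (D.inversion g) = D.dom g ∧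
    D.dom (D.inversion g) = D.ran g ∧ D.ratio (D.inversion g) = (D.ratio g)⁻¹ := by
  rcases D.arrows_cases g with ⟨x, rfl⟩ | ⟨j, s, hs, y₁, y₂, rfl⟩
  · exact ⟨rfl, rfl, (inv_div _ _).symm⟩
  · rw [inversion_tipArrow, dom_tipArrow, dom_tipArrow]
    exact ⟨rfl, rfl, rfl⟩

lemma isGroupoid : D.groupoid.IsGroupoid where
  d_unit u := (D.unit_spec u).2.1
  r_unit u := (D.unit_spec u).1
  d_mul _ _ h := (D.mul_spec h).2.1
  r_mul _ _ h := (D.mul_spec h).1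
  assoc k h g hkh hhg := by
    obtain ⟨r1, d1, s1⟩ := D.mul_spec hkh
    obtain ⟨r2, d2, s2⟩ := D.mul_spec hhg
    obtain ⟨r3, d3, s3⟩ := D.mul_spec (g := k) (h := D.mul h g) (hkh.trans r2.symm)
    obtain ⟨r4, d4, s4⟩ := D.mul_spec (g := D.mul k h) (h := g) (d1.trans hhg)
    refine D.arrow_ext (r3.trans (r1.symm.trans r4.symm)) (d3.trans (d2.trans d4.symm)) ?_
    exact s3.trans (by rw [s2, ← mul_assoc, ← s1]; exact s4.symm)
  unit_mul g := by
    obtain ⟨r1, d1, s1⟩ := D.unit_spec (D.ran g)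
    obtain ⟨r2, d2, s2⟩ := D.mul_spec (g := D.unit (D.ran g)) (h := g) d1
    exact D.arrow_ext (r2.trans r1) d2 (s2.trans (by rw [s1, one_mul]))
  mul_unit g := by
    obtain ⟨r1, d1, s1⟩ := D.unit_spec (D.dom g)
    obtain ⟨r2, d2, s2⟩ := D.mul_spec (g := g) (h := D.unit (D.dom g)) r1.symm
    exact D.arrow_ext r2 (d2.trans d1) (s2.trans (by rw [s1, mul_one]))
  d_inv g := (D.inversion_spec g).2.1
  r_inv g := (D.inversion_spec g).1
  inv_mul g := by
    obtain ⟨r1, d1, s1⟩ := D.inversion_spec g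
    obtain ⟨r2, d2, s2⟩ := D.mul_spec (g := D.inversion g) (h := g) d1
    obtain ⟨r3, d3, s3⟩ := D.unit_spec (D.dom g)
    exact D.arrow_ext ((r2.trans r1).trans r3.symm) (d2.trans d3.symm)
      (s2.trans (by rw [s1, inv_mul_cancel₀ (D.ratio_pos g).ne']; exact s3.symm))
  mul_inv g := by
    obtain ⟨r1, d1, s1⟩ := D.inversion_spec g
    obtain ⟨r2, d2, s2⟩ := D.mul_spec (g := g) (h := D.inversion g) r1.symm
    obtain ⟨r3, d3, s3⟩ := D.unit_spec (D.ran g)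
    exact D.arrow_ext (r2.trans r3.symm) ((d2.trans d1).trans d3.symm)
      (s2.trans (by rw [s1, mul_inv_cancel₀ (D.ratio_pos g).ne']; exact s3.symm))

end ConicalDomain

/-! ### Patches modelled on the standard half space. -/

section Models

variable {E : Type*} [NormedAddCommGroup E] [NormedSpace ℝ E] {N : Type*}
  {P : Type*} [NormedAddCommGroup P] [NormedSpace ℝ P] [FiniteDimensional ℝ P]
  {c : N → E} {ρ : N → ℝ} {x : N}

lemma FlatPatch.nonempty_halfPatch {d : ℕ} [NeZero d] (p : FlatPatch P c x)
    (hd : Module.finrank ℝ P = d) (hρ : ∀ y, c y ∈ p.O → ρ y ≠ 0) :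
    Nonempty (HalfPatch c ρ (firstCoord d) x) := by
  let L : P ≃L[ℝ] EuclideanSpace ℝ (Fin d) :=
    ContinuousLinearEquiv.ofFinrankEq (hd.trans finrank_euclideanSpace_fin.symm)
  exact ⟨(p.toHalfPatch ((firstCoord d).comp L.toContinuousLinearMap)
    (L.symm (EuclideanSpace.single 0 1)) (by simp) hρ).congr _ L fun _ => rfl⟩

lemma HalfPatch.nonempty_of_fst {d : ℕ} [NeZero d]
    (p : HalfPatch c ρ (ContinuousLinearMap.fst ℝ ℝ P) x) (hd : d = 1 + Module.finrank ℝ P) :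
    Nonempty (HalfPatch c ρ (firstCoord d) x) := by
  obtain ⟨T, hT⟩ := exists_equiv_prod_fst_eq (P := P) (firstCoord d)
    (fun a => ⟨EuclideanSpace.single 0 a, by simp⟩)
    (by rw [finrank_euclideanSpace_fin, Module.finrank_self, hd])
  exact ⟨p.congr _ T.symm fun z => by rw [← hT, T.apply_symm_apply]; rfl⟩

end Models

/-! ### Patches and smooth structures of the spaces of units and arrows. -/

namespace ConicalDomain

variable {m : ℕ} (D : ConicalDomain m) {i j : Fin D.l}

lemma unitEmb_fst_eq {u : D.Units} (hi : (D.unitEmb u).1 ∈ D.nbhd i) :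
    (D.unitEmb u).1 = (D.φ i).symm ((D.unitEmb u).2.2 • (D.unitEmb u).2.1) := by
  obtain ⟨h, hu⟩ := D.exists_eq_unitsOfCollar hi
  exact congrArg Prod.fst ((congrArg D.unitEmb hu).symm.trans (D.unitEmb_collar _))

lemma contDiffOn_symm_smul {P : Type*} [NormedAddCommGroup P] [NormedSpace ℝ P] {W : Set P}
    {f : P → ℝ} {g : P → Euc (m + 2)} (hf : ContDiffOn ℝ ∞ f W) (hg : ContDiffOn ℝ ∞ g W)
    (h : ∀ z ∈ W, |f z| < 1) (h1 : ∀ z ∈ W, ‖g z‖ = 1) :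
    ContDiffOn ℝ ∞ (fun z => (D.φ i).symm (f z • g z)) W :=
  (D.smooth_φ_symm i).comp (hf.smul hg) fun z hz => D.smul_mem_target (h z hz) (h1 z hz)

lemma mem_of_flatPatch {P : Type*} [NormedAddCommGroup P] [NormedSpace ℝ P]
    {S : Set (Euc (m + 2))} {x : S} (q : FlatPatch P (Subtype.val : S → Euc (m + 2)) x) {z : P}
    (hz : z ∈ q.W) : q.G z ∈ S ∧ q.G z ∈ q.O ∧ q.F (q.G z) = z := by
  obtain ⟨y, h1, h2, h3⟩ := q.exists_param z hz
  rw [← h1]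
  exact ⟨y.2, h2, by rw [h1, h3]⟩

/-- A patch of the space of units near a tip. -/
def unitTipPatch {y : D.bdω i} (q : FlatPatch (Euc m) (Subtype.val : D.bdω i → Euc (m + 2)) y) :
    HalfPatch D.unitEmb D.rho (ContinuousLinearMap.fst ℝ ℝ (Euc m)) (D.tip i y) where
  O := {b | b.1 ∈ D.nbhd i ∧ b.2.1 ∈ q.O}
  -- Negative `t` are allowed, so that the set is open: `φ_i⁻¹(t y)` is smooth in `t` across `0`
  -- because `φ_i⁻¹` is defined on the whole ball.
  W := {z | |z.1| < D.ε i ∧ z.2 ∈ q.W}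
  F b := (b.2.2, q.F b.2.1)
  G z := ((D.φ i).symm (z.1 • q.G z.2), q.G z.2, z.1)
  isOpen_O := ((D.isOpen_nbhd i).preimage (by fun_prop)).inter (q.isOpen_O.preimage (by fun_prop))
  isOpen_W := (isOpen_lt (continuous_abs.comp continuous_fst) continuous_const).inter
    (q.isOpen_W.preimage continuous_snd)
  mem_O := by
    rw [unitEmb_tip]
    exact ⟨D.p_mem_nbhd i, q.mem_O⟩
  smooth_F := by
    refine ContDiffOn.prodMk (by fun_prop) ?_
    exact q.smooth_F.comp (by fun_prop) fun b hb => hb.2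
  smooth_G := by
    have hG : ContDiffOn ℝ ∞ (fun z : ℝ × Euc m => q.G z.2) {z | |z.1| < D.ε i ∧ z.2 ∈ q.W} :=
      q.smooth_G.comp (by fun_prop) fun z hz => hz.2
    refine (D.contDiffOn_symm_smul (by fun_prop) hG (fun z hz => hz.1.trans (D.ε_mem i).2)
      fun z hz => ?_).prodMk (hG.prodMk (by fun_prop))
    exact D.norm_of_mem_bdω (mem_of_flatPatch q hz.2).1
  map_F u hu := by
    obtain ⟨h, -⟩ := D.exists_eq_unitsOfCollar hu.1
    exact ⟨by rw [abs_of_nonneg h.1.1]; exact h.1.2, q.map_F ⟨_, h.2⟩ hu.2⟩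
  nonneg u hu := by
    obtain ⟨h, -⟩ := D.exists_eq_unitsOfCollar hu.1
    exact h.1.1
  zero_iff u hu := Iff.rfl
  eq_rho _ u hu := rfl
  left_inv u hu := by
    obtain ⟨h, -⟩ := D.exists_eq_unitsOfCollar hu.1
    have h1 : q.G (q.F (D.unitEmb u).2.1) = (D.unitEmb u).2.1 := q.left_inv ⟨_, h.2⟩ hu.2
    refine Prod.ext ?_ (Prod.ext h1 rfl)
    rw [D.unitEmb_fst_eq hu.1]
    simp only [h1]
  exists_param z hz h0 := by
    obtain ⟨h1, h2, h3⟩ := mem_of_flatPatch q hz.2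
    have h0' : 0 ≤ z.1 := h0
    have hz1 : z.1 < D.ε i := by have := hz.1; rwa [abs_of_nonneg h0'] at this
    refine ⟨D.unitsOfCollar i ⟨(z.1, q.G z.2), ⟨h0, hz1⟩, h1⟩, rfl, ⟨?_, h2⟩,
      Prod.ext rfl h3⟩
    exact D.symm_mem_nbhd h0 hz1 (D.norm_of_mem_bdω h1)

/-- A patch of the space of units near a point of the smooth boundary. -/
def unitSmoothPatch {x : D.Ω₀}
    (q : FlatPatch (Euc (m + 1)) (Subtype.val : D.Ω₀ → Euc (m + 2)) x) :
    FlatPatch (Euc (m + 1)) D.unitEmb (D.unitsOfSmooth x) where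
  O := {b | b.1 ∈ q.O ∧ b.1 ∉ range D.p}
  W := q.W
  F b := q.F b.1
  G z := (q.G z, D.direction (q.G z), D.radius (q.G z))
  isOpen_O := (q.isOpen_O.preimage (by fun_prop)).inter
    (D.isOpen_compl_range_p.preimage (by fun_prop))
  isOpen_W := q.isOpen_W
  mem_O := ⟨q.mem_O, x.2.2⟩
  smooth_F := q.smooth_F.comp (by fun_prop) fun b hb => hb.1
  smooth_G := by
    have h : ∀ z ∈ q.W, q.G z ∉ range D.p := fun z hz => (mem_of_flatPatch q hz).1.2
    refine q.smooth_G.prodMk (ContDiffOn.prodMk (fun z hz => ?_) fun z hz => ?_)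
    · exact (D.contDiffAt_direction (h z hz)).comp_contDiffWithinAt z (q.smooth_G z hz)
    · exact (D.contDiffAt_radius (h z hz)).comp_contDiffWithinAt z (q.smooth_G z hz)
  map_F u hu := by
    obtain ⟨h, -⟩ := D.exists_eq_unitsOfSmooth hu.2
    exact q.map_F ⟨_, h⟩ hu.1
  left_inv u hu := by
    obtain ⟨h, hu'⟩ := D.exists_eq_unitsOfSmooth hu.2
    have h1 : q.G (q.F (D.unitEmb u).1) = (D.unitEmb u).1 := q.left_inv ⟨_, h⟩ hu.1
    simp only [h1]
    exact (D.unitEmb_smooth ⟨_, h⟩).symm.trans (congrArg D.unitEmb hu')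
  exists_param z hz := by
    obtain ⟨h1, h2, h3⟩ := mem_of_flatPatch q hz
    exact ⟨D.unitsOfSmooth ⟨_, h1⟩, rfl, ⟨h2, h1.2⟩, h3⟩

/-- A patch of the space of arrows near a boundary point. -/
def arrowTipPatch {s : ℝ} (hs : 0 < s) {y₁ y₂ : D.bdω i}
    (q₁ : FlatPatch (Euc m) (Subtype.val : D.bdω i → Euc (m + 2)) y₁)
    (q₂ : FlatPatch (Euc m) (Subtype.val : D.bdω i → Euc (m + 2)) y₂) :
    HalfPatch D.arrowEmb (fun g => D.rho (D.ran g))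
      (ContinuousLinearMap.fst ℝ ℝ (ℝ × Euc m × Euc m)) (D.tipArrow i s hs y₁ y₂) where
  O := {b | (b.1.1.1 ∈ D.nbhd i ∧ b.1.2.1 ∈ D.nbhd i) ∧ b.1.1.2.1 ∈ q₁.O ∧ b.1.2.2.1 ∈ q₂.O}
  -- The coordinates are `(t, s, y₁, y₂)`. The bounds keep range and domain in the collar, and `t`
  -- may again be negative.
  W := {z | (|z.1| < D.ε i ∧ 0 < z.2.1 ∧ |z.1 * z.2.1| < D.ε i) ∧ z.2.2.1 ∈ q₁.W ∧ z.2.2.2 ∈ q₂.W}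
  F b := (b.1.1.2.2, b.2, q₁.F b.1.1.2.1, q₂.F b.1.2.2.1)
  G z := ((((D.φ i).symm (z.1 • q₁.G z.2.2.1), q₁.G z.2.2.1, z.1),
    ((D.φ i).symm ((z.1 * z.2.1) • q₂.G z.2.2.2), q₂.G z.2.2.2, z.1 * z.2.1)), z.2.1)
  isOpen_O := (((D.isOpen_nbhd i).preimage (by fun_prop)).inter
    ((D.isOpen_nbhd i).preimage (by fun_prop))).inter
    ((q₁.isOpen_O.preimage (by fun_prop)).inter (q₂.isOpen_O.preimage (by fun_prop)))
  isOpen_W := by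
    have h1 : Continuous fun z : ℝ × ℝ × Euc m × Euc m => |z.1| := by fun_prop
    have h2 : Continuous fun z : ℝ × ℝ × Euc m × Euc m => |z.1 * z.2.1| := by fun_prop
    have h3 : Continuous fun z : ℝ × ℝ × Euc m × Euc m => z.2.1 := by fun_prop
    have h4 : Continuous fun z : ℝ × ℝ × Euc m × Euc m => z.2.2.1 := by fun_prop
    have h5 : Continuous fun z : ℝ × ℝ × Euc m × Euc m => z.2.2.2 := by fun_prop
    exact ((isOpen_lt h1 continuous_const).inter ((isOpen_lt continuous_const h3).inter
      (isOpen_lt h2 continuous_const))).inter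
      ((q₁.isOpen_W.preimage h4).inter (q₂.isOpen_W.preimage h5))
  mem_O := by
    rw [arrowEmb_eq, ran_tipArrow, dom_tipArrow, unitEmb_tip, unitEmb_tip]
    exact ⟨⟨D.p_mem_nbhd i, D.p_mem_nbhd i⟩, q₁.mem_O, q₂.mem_O⟩
  smooth_F := by
    refine ContDiffOn.prodMk (by fun_prop) (ContDiffOn.prodMk (by fun_prop)
      (ContDiffOn.prodMk ?_ ?_))
    · exact q₁.smooth_F.comp (by fun_prop) fun b hb => hb.2.1
    · exact q₂.smooth_F.comp (by fun_prop) fun b hb => hb.2.2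
  smooth_G := by
    set W : Set (ℝ × ℝ × Euc m × Euc m) := {z | (|z.1| < D.ε i ∧ 0 < z.2.1 ∧
      |z.1 * z.2.1| < D.ε i) ∧ z.2.2.1 ∈ q₁.W ∧ z.2.2.2 ∈ q₂.W} with hW
    have hG₁ : ContDiffOn ℝ ∞ (fun z : ℝ × ℝ × Euc m × Euc m => q₁.G z.2.2.1) W :=
      q₁.smooth_G.comp (by fun_prop) fun z hz => hz.2.1
    have hG₂ : ContDiffOn ℝ ∞ (fun z : ℝ × ℝ × Euc m × Euc m => q₂.G z.2.2.2) W :=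
      q₂.smooth_G.comp (by fun_prop) fun z hz => hz.2.2
    have hφ₁ := D.contDiffOn_symm_smul (i := i) (f := fun z : ℝ × ℝ × Euc m × Euc m => z.1)
      (by fun_prop) hG₁ (fun z hz => hz.1.1.trans (D.ε_mem i).2)
      fun z hz => D.norm_of_mem_bdω (mem_of_flatPatch q₁ hz.2.1).1
    have hφ₂ := D.contDiffOn_symm_smul (i := i)
      (f := fun z : ℝ × ℝ × Euc m × Euc m => z.1 * z.2.1)
      (by fun_prop) hG₂ (fun z hz => hz.1.2.2.trans (D.ε_mem i).2)
      fun z hz => D.norm_of_mem_bdω (mem_of_flatPatch q₂ hz.2.2).1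
    exact ((hφ₁.prodMk (hG₁.prodMk (by fun_prop))).prodMk
      (hφ₂.prodMk (hG₂.prodMk (by fun_prop)))).prodMk (by fun_prop)
  map_F g hg := by
    obtain ⟨h, -⟩ := D.exists_eq_arrowsOfCollar hg.1.1 hg.1.2
    obtain ⟨h0, h1, h2⟩ := h
    exact ⟨⟨(abs_of_nonneg h2.1.1).trans_lt h2.1.2, h0, (abs_of_nonneg h1.1.1).trans_lt h1.1.2⟩,
      q₁.map_F ⟨_, h2.2⟩ hg.2.1, q₂.map_F ⟨_, h1.2⟩ hg.2.2⟩
  nonneg g hg := by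
    obtain ⟨h, -⟩ := D.exists_eq_arrowsOfCollar hg.1.1 hg.1.2
    exact h.2.2.1.1
  zero_iff g hg := Iff.rfl
  eq_rho _ g hg := rfl
  left_inv g hg := by
    obtain ⟨h, hg'⟩ := D.exists_eq_arrowsOfCollar hg.1.1 hg.1.2
    obtain ⟨h0, h1, h2⟩ := h
    have e1 : q₁.G (q₁.F (D.arrowEmb g).1.1.2.1) = (D.arrowEmb g).1.1.2.1 :=
      q₁.left_inv ⟨_, h2.2⟩ hg.2.1
    have e2 : q₂.G (q₂.F (D.arrowEmb g).1.2.2.1) = (D.arrowEmb g).1.2.2.1 :=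
      q₂.left_inv ⟨_, h1.2⟩ hg.2.2
    simp only [e1, e2]
    exact congrArg D.arrowEmb hg'
  exists_param z hz h0 := by
    obtain ⟨a1, a2, a3⟩ := mem_of_flatPatch q₁ hz.2.1
    obtain ⟨b1, b2, b3⟩ := mem_of_flatPatch q₂ hz.2.2
    have h0' : 0 ≤ z.1 := h0
    have h1' : 0 ≤ z.1 * z.2.1 := mul_nonneg h0' hz.1.2.1.le
    have hz1 : z.1 < D.ε i := by have := hz.1.1; rwa [abs_of_nonneg h0'] at this
    have hz2 : z.1 * z.2.1 < D.ε i := by have := hz.1.2.2; rwa [abs_of_nonneg h1'] at this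
    refine ⟨D.arrowsOfCollar i ⟨((z.1, z.2.1), (q₁.G z.2.2.1, q₂.G z.2.2.2)), hz.1.2.1,
      ⟨⟨h1', hz2⟩, b1⟩, ⟨h0, hz1⟩, a1⟩, rfl, ⟨⟨?_, ?_⟩, a2, b2⟩,
      Prod.ext rfl (Prod.ext rfl (Prod.ext a3 b3))⟩
    · exact D.symm_mem_nbhd h0' hz1 (D.norm_of_mem_bdω a1)
    · exact D.symm_mem_nbhd h1' hz2 (D.norm_of_mem_bdω b1)

/-- A patch of the space of arrows near an interior point. -/
def arrowSmoothPatch {x₁ x₂ : D.Ω₀}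
    (q₁ : FlatPatch (Euc (m + 1)) (Subtype.val : D.Ω₀ → Euc (m + 2)) x₁)
    (q₂ : FlatPatch (Euc (m + 1)) (Subtype.val : D.Ω₀ → Euc (m + 2)) x₂) :
    FlatPatch (Euc (m + 1) × Euc (m + 1)) D.arrowEmb (D.arrowsOfPair (x₁, x₂)) where
  -- It suffices to keep the range away from the conical points, since no arrow joins a tip to a
  -- point of `Ω₀`.
  O := {b | (b.1.1.1 ∈ q₁.O ∧ b.1.2.1 ∈ q₂.O) ∧ b.1.1.1 ∉ range D.p}
  W := q₁.W ×ˢ q₂.W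
  F b := (q₁.F b.1.1.1, q₂.F b.1.2.1)
  G z := (((D.unitSmoothPatch q₁).G z.1, (D.unitSmoothPatch q₂).G z.2),
    D.radius (q₂.G z.2) / D.radius (q₁.G z.1))
  isOpen_O := ((q₁.isOpen_O.preimage (by fun_prop)).inter (q₂.isOpen_O.preimage
    (by fun_prop))).inter (D.isOpen_compl_range_p.preimage (by fun_prop))
  isOpen_W := q₁.isOpen_W.prod q₂.isOpen_W
  mem_O := ⟨⟨q₁.mem_O, q₂.mem_O⟩, x₁.2.2⟩
  smooth_F := by
    refine ContDiffOn.prodMk ?_ ?_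
    · exact q₁.smooth_F.comp (by fun_prop) fun b hb => hb.1.1
    · exact q₂.smooth_F.comp (by fun_prop) fun b hb => hb.1.2
  smooth_G := by
    have h1 : ContDiffOn ℝ ∞ (fun z : Euc (m + 1) × Euc (m + 1) => (D.unitSmoothPatch q₁).G z.1)
      (q₁.W ×ˢ q₂.W) := (D.unitSmoothPatch q₁).smooth_G.comp (by fun_prop) fun z hz => hz.1
    have h2 : ContDiffOn ℝ ∞ (fun z : Euc (m + 1) × Euc (m + 1) => (D.unitSmoothPatch q₂).G z.2)
      (q₁.W ×ˢ q₂.W) := (D.unitSmoothPatch q₂).smooth_G.comp (by fun_prop) fun z hz => hz.2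
    refine (h1.prodMk h2).prodMk (h2.snd.snd.div h1.snd.snd fun z hz => ?_)
    exact (D.radius_pos (mem_of_flatPatch q₁ hz.1).1.2).ne'
  map_F g hg := by
    obtain ⟨h, -⟩ := D.exists_eq_arrowsOfPair hg.2
    exact ⟨q₁.map_F ⟨_, h.1⟩ hg.1.1, q₂.map_F ⟨_, h.2⟩ hg.1.2⟩
  left_inv g hg := by
    obtain ⟨h, hg'⟩ := D.exists_eq_arrowsOfPair hg.2
    have e1 : q₁.G (q₁.F (D.arrowEmb g).1.1.1) = (D.arrowEmb g).1.1.1 :=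
      q₁.left_inv ⟨_, h.1⟩ hg.1.1
    have e2 : q₂.G (q₂.F (D.arrowEmb g).1.2.1) = (D.arrowEmb g).1.2.1 :=
      q₂.left_inv ⟨_, h.2⟩ hg.1.2
    simp only [unitSmoothPatch, e1, e2]
    exact congrArg D.arrowEmb hg'
  exists_param z hz := by
    obtain ⟨a1, a2, a3⟩ := mem_of_flatPatch q₁ hz.1
    obtain ⟨b1, b2, b3⟩ := mem_of_flatPatch q₂ hz.2
    exact ⟨D.arrowsOfPair (⟨_, a1⟩, ⟨_, b1⟩), rfl, ⟨⟨a2, b2⟩, a1.2⟩, Prod.ext a3 b3⟩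

lemma rho_ne_zero_of_fst {u : D.Units} (h : (D.unitEmb u).1 ∉ range D.p) : D.rho u ≠ 0 := by
  obtain ⟨hx, hu⟩ := D.exists_eq_unitsOfSmooth h
  exact D.rho_ne_zero_iff.2 ⟨_, hu.symm⟩

lemma nonempty_unitPatch (u : D.Units) :
    Nonempty (HalfPatch D.unitEmb D.rho (firstCoord (m + 1)) u) := by
  rcases D.units_cases u with ⟨x, rfl⟩ | ⟨i, y, rfl⟩
  · obtain ⟨q⟩ := D.smooth_boundary.exists_flatPatch x
    exact (D.unitSmoothPatch q).nonempty_halfPatch finrank_euclideanSpace_fin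
      fun u hu => D.rho_ne_zero_of_fst hu.2
  · obtain ⟨q⟩ := (D.smooth_boundary_base i).exists_flatPatch_sphere y
    exact (D.unitTipPatch q).nonempty_of_fst (by rw [finrank_euclideanSpace_fin, add_comm])

lemma nonempty_arrowPatch (g : D.Arrows) :
    Nonempty (HalfPatch D.arrowEmb (fun g => D.rho (D.ran g)) (firstCoord (2 * m + 2)) g) := by
  rcases D.arrows_cases g with ⟨⟨x₁, x₂⟩, rfl⟩ | ⟨i, s, hs, y₁, y₂, rfl⟩
  · obtain ⟨q₁⟩ := D.smooth_boundary.exists_flatPatch x₁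
    obtain ⟨q₂⟩ := D.smooth_boundary.exists_flatPatch x₂
    refine (D.arrowSmoothPatch q₁ q₂).nonempty_halfPatch ?_
      fun g hg => D.rho_ne_zero_of_fst hg.2
    rw [Module.finrank_prod, finrank_euclideanSpace_fin]
    ring
  · obtain ⟨q₁⟩ := (D.smooth_boundary_base i).exists_flatPatch_sphere y₁
    obtain ⟨q₂⟩ := (D.smooth_boundary_base i).exists_flatPatch_sphere y₂
    refine (D.arrowTipPatch hs q₁ q₂).nonempty_of_fst ?_
    rw [Module.finrank_prod, Module.finrank_prod, Module.finrank_self, finrank_euclideanSpace_fin]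
    ring

instance : ChartedSpace (EuclideanHalfSpace (m + 1)) D.Units :=
  patchChartedSpace D.isEmbedding_unitEmb fun u => (D.nonempty_unitPatch u).some

instance : ChartedSpace (EuclideanHalfSpace (2 * m + 2)) D.Arrows :=
  patchChartedSpace D.isEmbedding_arrowEmb fun g => (D.nonempty_arrowPatch g).some

instance : IsManifold (𝓡∂ (m + 1)) ∞ D.Units := isManifold_patchChartedSpace _ _

instance : IsManifold (𝓡∂ (2 * m + 2)) ∞ D.Arrows := isManifold_patchChartedSpace _ _

lemma isPatchEmbedding_unitEmb : IsPatchEmbedding (m + 1) D.unitEmb D.rho :=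
  isPatchEmbedding_patchChartedSpace _ _

lemma isPatchEmbedding_arrowEmb :
    IsPatchEmbedding (2 * m + 2) D.arrowEmb (fun g => D.rho (D.ran g)) :=
  isPatchEmbedding_patchChartedSpace _ _

lemma isBGroupoid :
    D.groupoid.IsBGroupoid (m + 1) (2 * m + 2) D.unitEmb D.rho D.ratio where
  patch_units := D.isPatchEmbedding_unitEmb
  patch_arrows := D.isPatchEmbedding_arrowEmb
  dim_eq := by ring
  smooth_rho := (contDiff_snd.comp contDiff_snd).contMDiff.comp D.isPatchEmbedding_unitEmb.contMDiff
  isGroupoid := D.isGroupoid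
  s_pos := D.ratio_pos
  rho_d := D.rho_dom
  s_mul _ _ h := (D.mul_spec h).2.2
  exists_interior a b ha hb := by
    obtain ⟨x, rfl⟩ := D.rho_ne_zero_iff.1 ha
    obtain ⟨y, rfl⟩ := D.rho_ne_zero_iff.1 hb
    exact ⟨D.arrowsOfPair (x, y), rfl, rfl⟩
  exists_boundary h h0 := by
    rcases D.arrows_cases h with ⟨⟨x₁, x₂⟩, rfl⟩ | ⟨i, s, hs, y₁, y₂, rfl⟩
    · exact absurd h0 (D.rho_smooth_pos x₁).ne'
    -- The collar neighbourhood of `p_i` contains no other conical point, so a nearby boundary unit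
    -- is a tip over the same `p_i`, and arrows of the collar reach it with any ratio.
    · have h1 : ∀ᶠ a in 𝓝 (D.tip i y₁), (D.unitEmb a).1 ∈ D.nbhd i := by
        refine (D.continuous_unitEmb.fst.tendsto _).eventually ((D.isOpen_nbhd i).mem_nhds ?_)
        rw [unitEmb_tip]
        exact D.p_mem_nbhd i
      filter_upwards [h1] with a ha ha0 σ hσ
      obtain ⟨j, y, rfl⟩ := D.rho_eq_zero_iff.1 ha0
      rw [unitEmb_tip] at ha
      obtain rfl := D.p_mem_source_iff.1 ha.1
      refine ⟨D.tipArrow j σ hσ y y₂, rfl, ?_, rfl⟩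
      exact (D.dom_tipArrow σ hσ y y₂).trans (D.dom_tipArrow s hs y₁ y₂).symm

end ConicalDomain

/-- If the embedding factors as `e = G ∘ c` on `S` with `G` smooth, then `c` is injective and `e ∘
c⁻¹ = G`, so the inverse is smooth by `contMDiffWithinAt_of_comp`. All diffeomorphism claims about
the pieces, the restrictions to interior and boundary, and `∂'Σ(Ω)` are proved by exhibiting `G`,
apart from the identity on the units of the interior. -/
lemma IsPatchEmbedding.isDiffeoOn {E : Type*} [NormedAddCommGroup E] [NormedSpace ℝ E] {N : Type*}
    [TopologicalSpace N] {d : ℕ} [NeZero d] [ChartedSpace (EuclideanHalfSpace d) N] {e : N → E}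
    {ρ : N → ℝ} {E' : Type*} [NormedAddCommGroup E'] [NormedSpace ℝ E'] {H' : Type*}
    [TopologicalSpace H'] {J : ModelWithCorners ℝ E' H'} {N' : Type*} [TopologicalSpace N']
    [ChartedSpace H' N'] (hc : IsPatchEmbedding d e ρ) {S : Set N} {X : Set N'} {c : N → N'}
    (hmaps : MapsTo c S X) (hsurj : SurjOn c S X) (hsm : ContMDiffOn (𝓡∂ d) J ∞ c S) {G : N' → E}
    (hG : ContMDiffOn J 𝓘(ℝ, E) ∞ G X) (heG : ∀ a ∈ S, e a = G (c a)) :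
    IsDiffeoOn (𝓡∂ d) J S X c := by
  have hinj : InjOn c S := fun a ha b hb hab =>
    hc.isEmbedding.injective (by rw [heG a ha, heG b hb, hab])
  refine ⟨⟨hmaps, hinj, hsurj⟩, hsm, fun x hx => ?_⟩
  obtain ⟨a, -, -⟩ := hsurj hx
  have : Nonempty N := ⟨a⟩
  refine ⟨Function.invFunOn c S, hinj.leftInvOn_invFunOn, hc.contMDiffWithinAt_of_comp ?_⟩
  have h : ∀ y ∈ X, e (Function.invFunOn c S y) = G y := fun y hy => by
    rw [heG _ (hsurj.mapsTo_invFunOn hy), hsurj.rightInvOn_invFunOn hy]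
  exact (hG x hx).congr h (h x hx)

namespace ConicalDomain

variable {m : ℕ} (D : ConicalDomain m) {i j : Fin D.l}

/-! ### The smooth structures are the glued ones -/

lemma contMDiff_unitEmb : ContMDiff (𝓡∂ (m + 1)) 𝓘(ℝ, Euc (m + 2) × Euc (m + 2) × ℝ) ∞ D.unitEmb :=
  D.isPatchEmbedding_unitEmb.contMDiff

lemma contMDiff_arrowEmb : ContMDiff (𝓡∂ (2 * m + 2))
    𝓘(ℝ, ((Euc (m + 2) × Euc (m + 2) × ℝ) × (Euc (m + 2) × Euc (m + 2) × ℝ)) × ℝ) ∞ D.arrowEmb :=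
  D.isPatchEmbedding_arrowEmb.contMDiff

lemma contDiffOn_unitCollar {P : Type*} [NormedAddCommGroup P] [NormedSpace ℝ P] {W : Set P}
    {f : P → ℝ} {g : P → Euc (m + 2)} (hf : ContDiffOn ℝ ∞ f W) (hg : ContDiffOn ℝ ∞ g W)
    (h : ∀ z ∈ W, (f z, g z) ∈ D.unitCollar i) :
    ContDiffOn ℝ ∞ (fun z => ((D.φ i).symm (f z • g z), g z, f z)) W :=
  (D.contDiffOn_symm_smul hf hg (fun z hz => D.abs_lt_one_of_mem (h z hz))
    fun z hz => D.norm_of_mem_bdω (h z hz).2).prodMk (hg.prodMk hf)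

lemma contDiffOn_unitSmooth : ContDiffOn ℝ ∞ (fun x => (x, D.direction x, D.radius x)) D.Ω₀ :=
  contDiffOn_id.prodMk (ContDiffOn.prodMk
    (fun _ hx => (D.contDiffAt_direction hx.2).contDiffWithinAt)
    fun _ hx => (D.contDiffAt_radius hx.2).contDiffWithinAt)

lemma range_unitsOfCollar (i : Fin D.l) :
    range (D.unitsOfCollar i) = {u | (D.unitEmb u).1 ∈ D.nbhd i} := by
  ext u
  constructor
  · rintro ⟨z, rfl⟩
    exact D.symm_mem_nbhd z.2.1.1 z.2.1.2 (D.norm_of_mem_bdω z.2.2)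
  · intro hu
    obtain ⟨h, hu⟩ := D.exists_eq_unitsOfCollar hu
    exact ⟨_, hu⟩

lemma range_unitsOfSmooth : range D.unitsOfSmooth = {u | (D.unitEmb u).1 ∉ range D.p} := by
  ext u
  constructor
  · rintro ⟨x, rfl⟩
    exact x.2.2
  · intro hu
    obtain ⟨h, hu⟩ := D.exists_eq_unitsOfSmooth hu
    exact ⟨_, hu⟩

lemma range_arrowsOfCollar (i : Fin D.l) : range (D.arrowsOfCollar i) =
    {g | (D.arrowEmb g).1.1.1 ∈ D.nbhd i ∧ (D.arrowEmb g).1.2.1 ∈ D.nbhd i} := by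
  ext g
  constructor
  · rintro ⟨z, rfl⟩
    exact ⟨D.symm_mem_nbhd z.2.2.2.1.1 z.2.2.2.1.2 (D.norm_of_mem_bdω z.2.2.2.2),
      D.symm_mem_nbhd z.2.2.1.1.1 z.2.2.1.1.2 (D.norm_of_mem_bdω z.2.2.1.2)⟩
  · intro hg
    obtain ⟨h, hg⟩ := D.exists_eq_arrowsOfCollar hg.1 hg.2
    exact ⟨_, hg⟩

lemma range_arrowsOfSmooth :
    range D.arrowsOfSmooth = {g | (D.arrowEmb g).1.1.1 ∉ range D.p} := by
  ext g
  constructor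
  · rintro ⟨x, rfl⟩
    exact x.2.1.2
  · intro hg
    obtain ⟨h, hg⟩ := D.exists_eq_arrowsOfPair hg
    exact ⟨⟨(_, _), h⟩, hg⟩

lemma isGlued : D.IsGlued where
  units_collar i := by
    refine ⟨?_, fun u => ((D.unitEmb u).2.2, (D.unitEmb u).2.1), fun z => rfl, ?_⟩
    · rw [range_unitsOfCollar]
      exact (D.isOpen_nbhd i).preimage D.continuous_unitEmb.fst
    · refine D.isPatchEmbedding_unitEmb.isDiffeoOn
        (G := fun z => ((D.φ i).symm (z.1 • z.2), z.2, z.1)) ?_ ?_ ?_ ?_ ?_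
      · rintro _ ⟨z, rfl⟩; exact z.2
      · exact fun z hz => ⟨_, ⟨⟨z, hz⟩, rfl⟩, rfl⟩
      · exact ((contDiff_snd.snd.prodMk contDiff_snd.fst).contMDiff.comp
          D.contMDiff_unitEmb).contMDiffOn
      · exact (D.contDiffOn_unitCollar contDiffOn_fst contDiffOn_snd fun z hz => hz).contMDiffOn
      · rintro _ ⟨z, rfl⟩; rfl
  units_smooth := by
    refine ⟨?_, fun u => (D.unitEmb u).1, fun z => rfl, ?_⟩
    · rw [range_unitsOfSmooth]
      exact D.isOpen_compl_range_p.preimage D.continuous_unitEmb.fst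
    · refine D.isPatchEmbedding_unitEmb.isDiffeoOn
        (G := fun x => (x, D.direction x, D.radius x)) ?_ ?_ ?_ ?_ ?_
      · rintro _ ⟨z, rfl⟩; exact z.2
      · exact fun z hz => ⟨_, ⟨⟨z, hz⟩, rfl⟩, rfl⟩
      · exact (contDiff_fst.contMDiff.comp D.contMDiff_unitEmb).contMDiffOn
      · exact D.contDiffOn_unitSmooth.contMDiffOn
      · rintro _ ⟨z, rfl⟩; rfl
  arrows_collar i := by
    refine ⟨?_, fun g => (((D.arrowEmb g).1.1.2.2, (D.arrowEmb g).2),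
      ((D.arrowEmb g).1.1.2.1, (D.arrowEmb g).1.2.2.1)), fun z => rfl, ?_⟩
    · rw [range_arrowsOfCollar]
      exact ((D.isOpen_nbhd i).preimage D.continuous_arrowEmb.fst.fst.fst).inter
        ((D.isOpen_nbhd i).preimage D.continuous_arrowEmb.fst.snd.fst)
    · refine D.isPatchEmbedding_arrowEmb.isDiffeoOn (G := fun z =>
        ((((D.φ i).symm (z.1.1 • z.2.1), z.2.1, z.1.1),
          ((D.φ i).symm ((z.1.1 * z.1.2) • z.2.2), z.2.2, z.1.1 * z.1.2)), z.1.2)) ?_ ?_ ?_ ?_ ?_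
      · rintro _ ⟨z, rfl⟩; exact z.2
      · exact fun z hz => ⟨_, ⟨⟨z, hz⟩, rfl⟩, rfl⟩
      · have h : ContDiff ℝ ∞ fun q : ((Euc (m + 2) × Euc (m + 2) × ℝ) ×
            (Euc (m + 2) × Euc (m + 2) × ℝ)) × ℝ => ((q.1.1.2.2, q.2), (q.1.1.2.1, q.1.2.2.1)) := by
          fun_prop
        exact (h.contMDiff.comp D.contMDiff_arrowEmb).contMDiffOn
      · refine ContDiffOn.contMDiffOn (ContDiffOn.prodMk (ContDiffOn.prodMk ?_ ?_) (by fun_prop))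
        · exact D.contDiffOn_unitCollar (by fun_prop) (by fun_prop) fun z hz => hz.2.2
        · exact D.contDiffOn_unitCollar (by fun_prop) (by fun_prop) fun z hz => hz.2.1
      · rintro _ ⟨z, rfl⟩; rfl
  arrows_smooth := by
    refine ⟨?_, fun g => ((D.arrowEmb g).1.1.1, (D.arrowEmb g).1.2.1), fun z => rfl, ?_⟩
    · rw [range_arrowsOfSmooth]
      exact D.isOpen_compl_range_p.preimage D.continuous_arrowEmb.fst.fst.fst
    · refine D.isPatchEmbedding_arrowEmb.isDiffeoOn (G := fun x =>
        (((x.1, D.direction x.1, D.radius x.1), (x.2, D.direction x.2, D.radius x.2)),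
          D.radius x.2 / D.radius x.1)) ?_ ?_ ?_ ?_ ?_
      · rintro _ ⟨z, rfl⟩; exact z.2
      · exact fun z hz => ⟨_, ⟨⟨z, hz⟩, rfl⟩, rfl⟩
      · have h : ContDiff ℝ ∞ fun q : ((Euc (m + 2) × Euc (m + 2) × ℝ) ×
            (Euc (m + 2) × Euc (m + 2) × ℝ)) × ℝ => (q.1.1.1, q.1.2.1) := by
          fun_prop
        exact (h.contMDiff.comp D.contMDiff_arrowEmb).contMDiffOn
      · have h1 : ContDiffOn ℝ ∞ (fun x : Euc (m + 2) × Euc (m + 2) =>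
            (x.1, D.direction x.1, D.radius x.1)) (D.Ω₀ ×ˢ D.Ω₀) :=
          D.contDiffOn_unitSmooth.comp contDiffOn_fst fun z hz => hz.1
        have h2 : ContDiffOn ℝ ∞ (fun x : Euc (m + 2) × Euc (m + 2) =>
            (x.2, D.direction x.2, D.radius x.2)) (D.Ω₀ ×ˢ D.Ω₀) :=
          D.contDiffOn_unitSmooth.comp contDiffOn_snd fun z hz => hz.2
        refine ContDiffOn.contMDiffOn ((h1.prodMk h2).prodMk (h2.snd.snd.div h1.snd.snd ?_))
        exact fun z hz => (D.radius_pos hz.1.2).ne'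
      · rintro _ ⟨z, rfl⟩; rfl
  mul_eq _ _ _ h := D.mul_eq_of_mulRel h

/-! ### The interior -/

lemma interior_units : (𝓡∂ (m + 1)).interior D.Units = range D.unitsOfSmooth := by
  rw [D.isPatchEmbedding_unitEmb.interior_eq]
  ext u
  rw [mem_ofPred_eq, D.rho_ne_zero_iff]
  exact exists_congr fun x => eq_comm

lemma boundary_units : (𝓡∂ (m + 1)).boundary D.Units = ⋃ i, range (D.tip i) := by
  rw [D.isPatchEmbedding_unitEmb.boundary_eq]
  ext u
  rw [mem_ofPred_eq, D.rho_eq_zero_iff, mem_iUnion]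
  exact exists_congr fun i => exists_congr fun x => eq_comm

lemma rho_dom_eq_zero_iff (g : D.Arrows) : D.rho (D.dom g) = 0 ↔ D.rho (D.ran g) = 0 :=
  D.isBGroupoid.rho_d_eq_zero_iff g

lemma isInvariant_interior : D.groupoid.IsInvariant ((𝓡∂ (m + 1)).interior D.Units) := by
  rw [D.isPatchEmbedding_unitEmb.interior_eq]
  ext g
  exact not_congr (D.rho_dom_eq_zero_iff g)

lemma isInvariant_boundary : D.groupoid.IsInvariant ((𝓡∂ (m + 1)).boundary D.Units) := by
  rw [D.isPatchEmbedding_unitEmb.boundary_eq]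
  ext g
  exact D.rho_dom_eq_zero_iff g

lemma isInvariant_tip (i : Fin D.l) : D.groupoid.IsInvariant (range (D.tip i)) := by
  ext g
  change D.dom g ∈ range (D.tip i) ↔ D.ran g ∈ range (D.tip i)
  rcases D.arrows_cases g with ⟨x, rfl⟩ | ⟨j, s, hs, y₁, y₂, rfl⟩
  · have h : ∀ x, D.unitsOfSmooth x ∉ range (D.tip i) := by
      rintro x ⟨y, hy⟩
      exact D.rho_ne_zero_iff.2 ⟨x, rfl⟩ (hy ▸ D.rho_tip y)
    exact iff_of_false (h _) (h _)
  · rw [dom_tipArrow, ran_tipArrow]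
    have h : ∀ y : D.bdω j, D.tip j y ∈ range (D.tip i) ↔ i = j := by
      intro y
      constructor
      · rintro ⟨y', hy'⟩
        exact (D.tip_eq_iff.1 hy').1
      · rintro rfl
        exact ⟨y, rfl⟩
    rw [h, h]

lemma contMDiff_rho : ContMDiff (𝓡∂ (m + 1)) 𝓘(ℝ, ℝ) ∞ D.rho := D.isBGroupoid.smooth_rho

lemma isDiffeoOn_id {E : Type*} [NormedAddCommGroup E] [NormedSpace ℝ E] {H : Type*}
    [TopologicalSpace H] (I : ModelWithCorners ℝ E H) {N : Type*} [TopologicalSpace N]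
    [ChartedSpace H N] (S : Set N) : IsDiffeoOn I I S S (id : N → N) :=
  ⟨bijOn_id S, contMDiffOn_id, fun _ _ => ⟨id, fun _ _ => rfl, contMDiffWithinAt_id⟩⟩

lemma interior_iso : D.groupoid.IsIsoOfRestriction (𝓡∂ (m + 1)) (𝓡∂ (2 * m + 2))
    (𝓡∂ (m + 1)) ((𝓡∂ (m + 1)).prod (𝓡∂ (m + 1)))
    (GroupoidData.pair D.Units) ((𝓡∂ (m + 1)).interior D.Units)
    ((𝓡∂ (m + 1)).interior D.Units ×ˢ (𝓡∂ (m + 1)).interior D.Units)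
    ((𝓡∂ (m + 1)).interior D.Units) (fun g => (D.ran g, D.dom g)) id where
  diffeo_arrows := by
    rw [D.isPatchEmbedding_unitEmb.interior_eq]
    -- Over the interior the ratio is recovered from the two units as `ρ(d)/ρ(r)`.
    refine D.isPatchEmbedding_arrowEmb.isDiffeoOn (G := fun q =>
      ((D.unitEmb q.1, D.unitEmb q.2), D.rho q.2 / D.rho q.1)) ?_ ?_ ?_ ?_ ?_
    · intro g hg
      exact ⟨fun h => hg ((D.rho_dom_eq_zero_iff g).2 h), hg⟩
    · rintro ⟨u, v⟩ ⟨hu, hv⟩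
      obtain ⟨x, rfl⟩ := D.rho_ne_zero_iff.1 hu
      obtain ⟨y, rfl⟩ := D.rho_ne_zero_iff.1 hv
      exact ⟨D.arrowsOfPair (x, y), hv, rfl⟩
    · exact (D.isBGroupoid.contMDiff_r.prodMk D.isBGroupoid.contMDiff_d).contMDiffOn
    · intro q hq
      refine ContMDiffAt.contMDiffWithinAt ((ContMDiffAt.prodMk_space ?_ ?_).prodMk_space ?_)
      · exact (D.contMDiff_unitEmb.comp contMDiff_fst) q
      · exact (D.contMDiff_unitEmb.comp contMDiff_snd) q
      · exact ((D.contMDiff_rho.comp contMDiff_snd) q).div₀ ((D.contMDiff_rho.comp contMDiff_fst) q)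
          hq.1
    · intro g hg
      have hr : D.rho (D.ran g) ≠ 0 := fun h => hg ((D.rho_dom_eq_zero_iff g).2 h)
      rw [arrowEmb_eq, D.rho_dom, mul_div_cancel_right₀ _ hr]
  diffeo_units := isDiffeoOn_id _ _
  map_d _ _ := rfl
  map_r _ _ := rfl
  map_u u _ := Prod.ext (D.unit_spec u).1 (D.unit_spec u).2.1
  map_inv g _ := Prod.ext (D.inversion_spec g).1 (D.inversion_spec g).2.1
  map_mul _ _ _ _ hgh := Prod.ext (D.mul_spec hgh).1 (D.mul_spec hgh).2.1

/-! ### The boundary -/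

lemma boundary_iso : D.groupoid.IsIsoOfRestriction (𝓡∂ (m + 1)) (𝓡∂ (2 * m + 2))
    𝓘(ℝ, Euc (m + 2) × Euc (m + 2))
    𝓘(ℝ, (Euc (m + 2) × Euc (m + 2)) × (ℝ × Euc (m + 2)))
    ((GroupoidData.pair (Euc (m + 2))).prod (GroupoidData.multGroupOver (Euc (m + 2))))
    ((𝓡∂ (m + 1)).boundary D.Units)
    (⋃ i, (D.bdω i ×ˢ D.bdω i) ×ˢ (Ioi (0 : ℝ) ×ˢ {D.p i}))
    (⋃ i, D.bdω i ×ˢ {D.p i})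
    (fun g => (((D.unitEmb (D.ran g)).2.1, (D.unitEmb (D.dom g)).2.1),
      (D.ratio g, (D.unitEmb (D.ran g)).1)))
    (fun u => ((D.unitEmb u).2.1, (D.unitEmb u).1)) := by
  have hcases : ∀ g, D.rho (D.dom g) = 0 →
      ∃ i s, ∃ hs : 0 < s, ∃ y₁ y₂, g = D.tipArrow i s hs y₁ y₂ := by
    intro g hg
    rcases D.arrows_cases g with ⟨x, rfl⟩ | h
    · exact absurd hg (D.rho_smooth_pos _).ne'
    · exact h
  have hbd : D.groupoid.d ⁻¹' ((𝓡∂ (m + 1)).boundary D.Units) = {g | D.rho (D.dom g) = 0} := by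
    rw [D.isPatchEmbedding_unitEmb.boundary_eq]; rfl
  have hfst : ∀ g, D.rho (D.dom g) = 0 → (D.unitEmb (D.dom g)).1 = (D.unitEmb (D.ran g)).1 := by
    intro g hg
    obtain ⟨i, s, hs, y₁, y₂, rfl⟩ := hcases g hg
    rw [dom_tipArrow, ran_tipArrow, unitEmb_tip, unitEmb_tip]
  refine ⟨?_, ?_, ?_, ?_, ?_, ?_, ?_⟩
  · rw [hbd]
    -- A boundary arrow has the same conical point at both ends and radius `0` there, so `p_i`, the
    -- two directions and the ratio determine it. Recording `p_i` keeps the components apart.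
    refine D.isPatchEmbedding_arrowEmb.isDiffeoOn (G := fun z =>
      (((z.2.2, z.1.1, 0), (z.2.2, z.1.2, 0)), z.2.1)) ?_ ?_ ?_ ?_ ?_
    · intro g hg
      obtain ⟨i, s, hs, y₁, y₂, rfl⟩ := hcases g hg
      beta_reduce
      rw [dom_tipArrow, ran_tipArrow, unitEmb_tip, unitEmb_tip]
      exact mem_iUnion.2 ⟨i, ⟨y₁.2, y₂.2⟩, hs, rfl⟩
    · rintro ⟨⟨y₁, y₂⟩, s, q⟩ hz
      obtain ⟨i, ⟨h1, h2⟩, hs, hq⟩ := mem_iUnion.1 hz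
      obtain rfl : q = D.p i := hq
      change 0 < s at hs
      change y₁ ∈ D.bdω i at h1
      change y₂ ∈ D.bdω i at h2
      refine ⟨D.tipArrow i s hs ⟨y₁, h1⟩ ⟨y₂, h2⟩, ?_, ?_⟩
      · rw [mem_ofPred_eq, dom_tipArrow, rho_tip]
      · beta_reduce
        rw [dom_tipArrow, ran_tipArrow, unitEmb_tip, unitEmb_tip]
        rfl
    · have h : ContDiff ℝ ∞ fun q : ((Euc (m + 2) × Euc (m + 2) × ℝ) ×
          (Euc (m + 2) × Euc (m + 2) × ℝ)) × ℝ => ((q.1.1.2.1, q.1.2.2.1), (q.2, q.1.1.1)) := by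
        fun_prop
      exact (h.contMDiff.comp D.contMDiff_arrowEmb).contMDiffOn
    · exact ContDiff.contMDiff (by fun_prop) |>.contMDiffOn
    · intro g hg
      obtain ⟨i, s, hs, y₁, y₂, rfl⟩ := hcases g hg
      rw [arrowEmb_eq, dom_tipArrow, ran_tipArrow, unitEmb_tip, unitEmb_tip]
  · rw [boundary_units]
    refine D.isPatchEmbedding_unitEmb.isDiffeoOn (G := fun z => (z.2, z.1, 0)) ?_ ?_ ?_ ?_ ?_
    · intro u hu
      obtain ⟨i, y, rfl⟩ := mem_iUnion.1 hu
      beta_reduce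
      rw [unitEmb_tip]
      exact mem_iUnion.2 ⟨i, y.2, rfl⟩
    · rintro ⟨y, q⟩ hz
      obtain ⟨i, h1, hq⟩ := mem_iUnion.1 hz
      obtain rfl : q = D.p i := hq
      refine ⟨D.tip i ⟨y, h1⟩, mem_iUnion.2 ⟨i, _, rfl⟩, ?_⟩
      beta_reduce
      rw [unitEmb_tip]
    · have h : ContDiff ℝ ∞ fun q : Euc (m + 2) × Euc (m + 2) × ℝ => (q.2.1, q.1) := by
        fun_prop
      exact (h.contMDiff.comp D.contMDiff_unitEmb).contMDiffOn
    · exact ContDiff.contMDiff (by fun_prop) |>.contMDiffOn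
    · intro u hu
      obtain ⟨i, y, rfl⟩ := mem_iUnion.1 hu
      rw [unitEmb_tip]
  · rw [hbd]
    intro g hg
    exact Prod.ext rfl (hfst g hg).symm
  · intro g _
    rfl
  · intro u _
    obtain ⟨h1, h2, h3⟩ := D.unit_spec u
    change (((D.unitEmb (D.ran (D.unit u))).2.1, (D.unitEmb (D.dom (D.unit u))).2.1),
      (D.ratio (D.unit u), (D.unitEmb (D.ran (D.unit u))).1)) = _
    rw [h1, h2, h3]
    rfl
  · rw [hbd]
    intro g hg
    obtain ⟨h1, h2, h3⟩ := D.inversion_spec g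
    change (((D.unitEmb (D.ran (D.inversion g))).2.1, (D.unitEmb (D.dom (D.inversion g))).2.1),
      (D.ratio (D.inversion g), (D.unitEmb (D.ran (D.inversion g))).1)) = _
    rw [h1, h2, h3, hfst g hg]
    rfl
  · intro g _ h _ hgh
    obtain ⟨h1, h2, h3⟩ := D.mul_spec hgh
    change (((D.unitEmb (D.ran (D.mul g h))).2.1, (D.unitEmb (D.dom (D.mul g h))).2.1),
      (D.ratio (D.mul g h), (D.unitEmb (D.ran (D.mul g h))).1)) = _
    rw [h1, h2, h3]
    rfl

end ConicalDomain

/-- Hadamard's lemma along the segments from `a`, after a translation of `a` to the origin. -/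
lemma ContDiffOn.exists_linear_factor {E F : Type} [NormedAddCommGroup E] [NormedSpace ℝ E]
    [NormedAddCommGroup F] [NormedSpace ℝ F] [CompleteSpace F] {f : E → F} {U : Set E} {a : E}
    {f' : E →L[ℝ] F} (hU : IsOpen U) (ha : a ∈ U) (hf : ContDiffOn ℝ ∞ f U)
    (hf' : HasFDerivAt f f' a) : ∃ A : E → E →L[ℝ] F, ContDiffAt ℝ ∞ A a ∧ A a = f' ∧
      ∀ᶠ x in 𝓝 a, f x - f a = A x (x - a) := by
  obtain ⟨r, hr, hrU⟩ := Metric.isOpen_iff.1 hU a ha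
  have hball : ball (0 : E) r ∈ 𝓝 0 := ball_mem_nhds 0 hr
  have hg : ContDiffOn ℝ ∞ (fun z => f (a + z)) (ball 0 r) := by
    refine hf.comp (contDiffOn_const.add contDiffOn_id) fun z hz => hrU ?_
    rw [mem_ball_iff_norm, add_sub_assoc, add_comm, sub_add, sub_self, sub_zero]
    exact mem_ball_zero_iff.1 hz
  obtain ⟨A, hA, h1, h2⟩ := hg.exists_hadamard (convex_ball 0 r) isOpen_ball.uniqueDiffOn
    (ContinuousLinearMap.id ℝ E) fun z _ => by simpa using hr
  have hd : HasFDerivAt (fun z => f (a + z)) f' 0 := by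
    rw [← add_zero a] at hf'
    exact hf'.comp (0 : E) ((hasFDerivAt_id (𝕜 := ℝ) (0 : E)).const_add a)
  refine ⟨fun x => A (x - a), ContDiffAt.comp a ?_ (by fun_prop), ?_, ?_⟩
  · rw [sub_self]
    exact hA.contDiffAt hball
  · beta_reduce
    rw [sub_self, h2 0 (mem_ball_self hr) rfl, fderivWithin_of_mem_nhds hball, hd.fderiv]
  · filter_upwards [ball_mem_nhds a hr] with x hx
    have hx' : x - a ∈ ball (0 : E) r := by rwa [mem_ball_zero_iff, ← dist_eq_norm]
    have h := h1 _ hx'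
    simp only [ContinuousLinearMap.id_apply, sub_self, add_zero, add_sub_cancel] at h
    rw [sub_eq_iff_eq_add', h]

lemma normalize_pos_smul {E : Type*} [NormedAddCommGroup E] [NormedSpace ℝ E] {c : ℝ} (hc : 0 < c)
    (a : E) : ‖c • a‖⁻¹ • c • a = ‖a‖⁻¹ • a := by
  rw [norm_smul, Real.norm_of_nonneg hc.le, smul_smul, mul_inv, mul_right_comm,
    inv_mul_cancel₀ hc.ne', one_mul]

lemma eq_of_mem_closure_of_eqOn {A B : Type*} [TopologicalSpace A] [TopologicalSpace B] [T2Space B]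
    {S : Set A} {f g : A → B} {a : A} (ha : a ∈ closure S) (hf : ContinuousWithinAt f S a)
    (hg : ContinuousWithinAt g S a) (h : EqOn f g S) : f a = g a := by
  have := mem_closure_iff_nhdsWithin_neBot.1 ha
  exact tendsto_nhds_unique_of_eventuallyEq hf hg (h.eventuallyEq_nhdsWithin)

/-! ### The space of units as the boundary of the desingularization. -/

namespace ConicalDomain

variable {m : ℕ} (D : ConicalDomain m) {i j : Fin D.l} {x y : Euc (m + 2)}
  {ψ : Fin D.l → Euc (m + 2) → ℝ}

lemma Ω₀_subset_closure : D.Ω₀ ⊆ closure D.Ω := fun _ hx => frontier_subset_closure hx.1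

open Classical in
/-- The map of `M` onto `∂'Σ(Ω)`. -/
def unitsToDesing (ψ : Fin D.l → Euc (m + 2) → ℝ) (u : D.Units) : Euc (m + 2) × Euc (m + 2) :=
  if D.rho u = 0 then ((D.unitEmb u).1, (D.unitEmb u).2.1) else D.Φ ψ (D.unitEmb u).1

lemma unitsToDesing_smooth (x : D.Ω₀) : D.unitsToDesing ψ (D.unitsOfSmooth x) = D.Φ ψ x :=
  if_neg (D.rho_smooth_pos x).ne'

lemma unitsToDesing_tip (y : D.bdω i) :
    D.unitsToDesing ψ (D.tip i y) = (D.p i, (y : Euc (m + 2))) := by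
  rw [unitsToDesing, if_pos (D.rho_tip y), unitEmb_tip]

open Classical in
/-- The inverse of the map of `M` onto `∂'Σ(Ω)`, followed by the embedding of `M`. -/
def desingInv (z : Euc (m + 2) × Euc (m + 2)) : Euc (m + 2) × Euc (m + 2) × ℝ :=
  if z.1 ∈ range D.p then (z.1, z.2, 0) else (z.1, D.direction z.1, D.radius z.1)

lemma desingInv_unitsToDesing (u : D.Units) : D.unitEmb u = D.desingInv (D.unitsToDesing ψ u) := by
  rcases D.units_cases u with ⟨x, rfl⟩ | ⟨i, y, rfl⟩
  · rw [unitsToDesing_smooth, desingInv, if_neg (show (D.Φ ψ x).1 ∉ range D.p from x.2.2)]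
    rfl
  · rw [unitsToDesing_tip, unitEmb_tip, desingInv, if_pos ⟨i, rfl⟩]

lemma unitEmb_fst_mem_closure (u : D.Units) : (D.unitEmb u).1 ∈ closure D.Ω := by
  rcases D.units_cases u with ⟨x, rfl⟩ | ⟨i, y, rfl⟩
  · exact D.Ω₀_subset_closure x.2
  · rw [unitEmb_tip]
    exact frontier_subset_closure (D.p_mem i)

/-- This expresses the direction of `φ_i(x)` through that of `x - p_i`, by normalizing `A(x)` of the
latter, smoothly up to `p_i`. The condition `Dφ_i(p_i) = I` gives `A(p_i) = I`, so the two
directions have the same limit. -/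
lemma exists_φ_factor (i : Fin D.l) : ∃ A : Euc (m + 2) → Euc (m + 2) →L[ℝ] Euc (m + 2),
    ContDiffAt ℝ ∞ A (D.p i) ∧ A (D.p i) = ContinuousLinearMap.id ℝ _ ∧
      ∀ᶠ x in 𝓝 (D.p i), D.φ i x = A x (x - D.p i) := by
  obtain ⟨A, h1, h2, h3⟩ := (D.smooth_φ i).exists_linear_factor (D.φ i).open_source
    (D.p_mem_source i) (D.fderiv_φ i)
  refine ⟨A, h1, h2, h3.mono fun x hx => ?_⟩
  rwa [D.φ_p, sub_zero] at hx

/-- The converse of `exists_φ_factor`. It serves for the map from `M` to `∂'Σ(Ω)`, the other one for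
its inverse. -/
lemma exists_symm_factor (i : Fin D.l) : ∃ A : Euc (m + 2) → Euc (m + 2) →L[ℝ] Euc (m + 2),
    ContDiffAt ℝ ∞ A (D.p i) ∧ A (D.p i) = ContinuousLinearMap.id ℝ _ ∧
      ∀ᶠ x in 𝓝 (D.p i), x - D.p i = A x (D.φ i x) := by
  have h0 : (0 : Euc (m + 2)) ∈ (D.φ i).target := by
    rw [D.target_φ]; exact mem_ball_self one_pos
  have hs : (D.φ i).symm 0 = D.p i := by rw [← D.φ_p i, (D.φ i).left_inv (D.p_mem_source i)]
  have hd : HasFDerivAt (D.φ i).symm (ContinuousLinearMap.id ℝ (Euc (m + 2))) 0 := by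
    refine (D.φ i).hasFDerivAt_symm (f' := ContinuousLinearEquiv.refl ℝ _) h0 ?_
    rw [hs]
    exact D.fderiv_φ i
  obtain ⟨A, h1, h2, h3⟩ := (D.smooth_φ_symm i).exists_linear_factor (D.φ i).open_target h0 hd
  have hc := D.contDiffAt_φ (D.p_mem_source i)
  refine ⟨fun x => A (D.φ i x), ContDiffAt.comp _ (by rwa [D.φ_p]) hc, by
    beta_reduce; rw [D.φ_p, h2], ?_⟩
  have h4 : ∀ᶠ x in 𝓝 (D.p i), (D.φ i).symm (D.φ i x) - (D.φ i).symm 0 = A (D.φ i x) (D.φ i x - 0) :=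
    hc.continuousAt.eventually (by rwa [D.φ_p])
  filter_upwards [h4, (D.φ i).open_source.mem_nhds (D.p_mem_source i)] with x hx hxs
  rwa [(D.φ i).left_inv hxs, hs, sub_zero] at hx

/-- Normalization of `A(x) v` is smooth in `(x, v)` where `A(x) v ≠ 0`. -/
lemma contDiffAt_normalize_clm {P : Type*} [NormedAddCommGroup P] [NormedSpace ℝ P]
    {A : P → Euc (m + 2) →L[ℝ] Euc (m + 2)} {g : P → Euc (m + 2)} {a : P}
    (hA : ContDiffAt ℝ ∞ A a) (hg : ContDiffAt ℝ ∞ g a) (h0 : A a (g a) ≠ 0) :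
    ContDiffAt ℝ ∞ (fun z => ‖A z (g z)‖⁻¹ • A z (g z)) a := by
  have h := hA.clm_apply hg
  exact ((h.norm ℝ h0).inv (norm_ne_zero_iff.2 h0)).smul h

lemma tip_mem_closure (y : D.bdω i) : D.tip i y ∈ closure (range D.unitsOfSmooth) := by
  let f : Ico 0 (D.ε i) → D.Units := fun t => D.unitsOfCollar i ⟨(t.1, y.1), t.2, y.2⟩
  have hf : Continuous f := (D.continuous_unitsOfCollar i).comp (by fun_prop)
  have hε := (D.ε_mem i).1
  let o : Ico 0 (D.ε i) := ⟨0, le_rfl, hε⟩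
  have ho : o ∈ closure (Ioi o) := by
    rw [closure_Ioi' ⟨⟨D.ε i / 2, by constructor <;> linarith⟩, half_pos hε⟩]
    exact self_mem_Ici
  refine map_mem_closure (f := f) hf ho fun t ht => ?_
  exact ⟨_, (D.unitsOfCollar_eq_smooth (z := ⟨(t.1, y.1), t.2, y.2⟩) ht).symm⟩

namespace IsCutoff

variable {D}

/-- The cutoff conditions concern `Ω` only; continuity on the closure carries them to `∂Ω`. -/
lemma eq_const (hψ : D.IsCutoff ψ) {U : Set (Euc (m + 2))} (hU : IsOpen U) (hx : x ∈ closure D.Ω)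
    (hxU : x ∈ U) {c : ℝ} (h : ∀ y ∈ D.Ω, y ∈ U → ψ j y = c) : ψ j x = c := by
  refine eq_of_mem_closure_of_eqOn (S := U ∩ D.Ω) (g := fun _ => c)
    (hU.inter_closure ⟨hxU, hx⟩) ?_ continuousWithinAt_const fun y hy => h y hy.2 hy.1
  exact ((hψ.smooth j).continuousOn x hx).mono (inter_subset_right.trans subset_closure)

lemma eq_zero_of_ne (hψ : D.IsCutoff ψ) (hx : x ∈ closure D.Ω) (hi : x ∈ (D.φ i).source)
    (hij : j ≠ i) : ψ j x = 0 :=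
  hψ.eq_const (D.φ i).open_source hx hi fun y hy hyi =>
    hψ.eq_zero j y hy fun hyj => hij (D.eq_of_mem_source hyj hyi)

/-- Near `p_i`, up to the boundary of `Ω`, one has `ψ_i = 1` and the other `ψ_j` vanish. -/
lemma eventually_Φ_eq (hψ : D.IsCutoff ψ) (i : Fin D.l) : ∀ᶠ x in 𝓝 (D.p i), x ∈ closure D.Ω →
    D.Φ ψ x = (x, ‖x - D.p i‖⁻¹ • (x - D.p i)) := by
  obtain ⟨δ, hδ, h1⟩ := hψ.eq_one i
  let U := (D.φ i).source ∩ {x | ‖D.φ i x‖ < δ}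
  have hU : IsOpen U := (D.φ i).continuousOn.norm.isOpen_inter_preimage (D.φ i).open_source isOpen_Iio
  have hp : D.p i ∈ U := ⟨D.p_mem_source i, by
    rw [mem_ofPred_eq, D.φ_p, norm_zero]; exact hδ.1⟩
  filter_upwards [hU.mem_nhds hp] with x hxU hx
  have hone : ψ i x = 1 := hψ.eq_const hU hx hxU fun y hy hyU => by
    obtain ⟨t, ht, w, hw, he⟩ := D.exists_polar_of_mem_Ω hy hyU.1
    have hn : ‖D.φ i y‖ = t := by
      rw [he, norm_smul, norm_eq_of_mem_sphere w, mul_one, Real.norm_of_nonneg ht.1.le]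
    have h2 := h1 t ⟨ht.1, hn ▸ hyU.2⟩ w hw
    rwa [← he, (D.φ i).left_inv hyU.1] at h2
  rw [Φ, Finset.sum_eq_single i (fun j _ hj => by rw [hψ.eq_zero_of_ne hx hxU.1 hj, zero_smul])
    (by simp), hone, one_smul]

lemma contDiffWithinAt_Φ (hψ : D.IsCutoff ψ) (hx : x ∈ closure D.Ω) (hxp : x ∉ range D.p) :
    ContDiffWithinAt ℝ ∞ (D.Φ ψ) (closure D.Ω) x := by
  refine contDiffWithinAt_id.prodMk (ContDiffWithinAt.sum fun i _ => (hψ.smooth i x hx).smul ?_)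
  have h : x - D.p i ≠ 0 := fun h => hxp ⟨i, (sub_eq_zero.1 h).symm⟩
  have h1 : ContDiffAt ℝ ∞ (fun x => x - D.p i) x := by fun_prop
  exact (((h1.norm ℝ h).inv (norm_ne_zero_iff.2 h)).smul h1).contDiffWithinAt

/-- Near a tip the second component is the normalization of `A(x) y`, where `y` is the recorded
direction and `A` comes from `exists_symm_factor`. This is smooth in `unitEmb`, and at the tips it
equals `y` because `A(p_i) = I`. -/
lemma contMDiff_unitsToDesing (hψ : D.IsCutoff ψ) :
    ContMDiff (𝓡∂ (m + 1)) 𝓘(ℝ, Euc (m + 2) × Euc (m + 2)) ∞ (D.unitsToDesing ψ) := by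
  intro u
  have hpos : ContMDiff (𝓡∂ (m + 1)) 𝓘(ℝ, Euc (m + 2)) ∞ fun u => (D.unitEmb u).1 :=
    contDiff_fst.contMDiff.comp D.contMDiff_unitEmb
  rcases D.units_cases u with ⟨x, rfl⟩ | ⟨i, y, rfl⟩
  · have h : ContMDiffWithinAt (𝓡∂ (m + 1)) 𝓘(ℝ, Euc (m + 2) × Euc (m + 2)) ∞
        (D.Φ ψ ∘ fun u => (D.unitEmb u).1) univ (D.unitsOfSmooth x) :=
      ContMDiffWithinAt.comp (D.unitsOfSmooth x) (t := closure D.Ω)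
        (hψ.contDiffWithinAt_Φ (D.Ω₀_subset_closure x.2) x.2.2).contMDiffWithinAt
        (hpos _).contMDiffWithinAt fun u _ => D.unitEmb_fst_mem_closure u
    refine (contMDiffWithinAt_univ.1 h).congr_of_eventuallyEq ?_
    filter_upwards [D.contMDiff_rho.continuous.continuousAt.eventually_ne (D.rho_smooth_pos x).ne']
      with u hu
    exact if_neg hu
  · obtain ⟨A, hA, hA1, hA2⟩ := D.exists_symm_factor i
    have hy1 := D.norm_of_mem_bdω y.2
    have hF : ContDiffAt ℝ ∞ (fun z : Euc (m + 2) × Euc (m + 2) × ℝ =>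
        (z.1, ‖A z.1 z.2.1‖⁻¹ • A z.1 z.2.1)) (D.unitEmb (D.tip i y)) := by
      rw [unitEmb_tip]
      have hA' : ContDiffAt ℝ ∞ (fun z : Euc (m + 2) × Euc (m + 2) × ℝ => A z.1)
        (D.p i, y.1, 0) := ContDiffAt.comp _ hA contDiffAt_fst
      refine contDiffAt_fst.prodMk (contDiffAt_normalize_clm hA' (by fun_prop) ?_)
      change A (D.p i) y ≠ 0
      rw [hA1]
      exact norm_ne_zero_iff.1 (by rw [ContinuousLinearMap.id_apply, hy1]; exact one_ne_zero)
    refine (hF.contMDiffAt.comp _ (D.contMDiff_unitEmb _)).congr_of_eventuallyEq ?_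
    have hev : ∀ᶠ x in 𝓝 (D.p i), x - D.p i = A x (D.φ i x) ∧ x ∈ D.nbhd i ∧ (x ∈ closure D.Ω →
        D.Φ ψ x = (x, ‖x - D.p i‖⁻¹ • (x - D.p i))) :=
      hA2.and (((D.isOpen_nbhd i).eventually_mem (D.p_mem_nbhd i)).and (hψ.eventually_Φ_eq i))
    have hev' : ∀ᶠ u in 𝓝 (D.tip i y), (D.unitEmb u).1 - D.p i =
        A (D.unitEmb u).1 (D.φ i (D.unitEmb u).1) ∧ (D.unitEmb u).1 ∈ D.nbhd i ∧
        ((D.unitEmb u).1 ∈ closure D.Ω → D.Φ ψ (D.unitEmb u).1 =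
          ((D.unitEmb u).1, ‖(D.unitEmb u).1 - D.p i‖⁻¹ • ((D.unitEmb u).1 - D.p i))) :=
      hpos.continuous.continuousAt.eventually (by
        beta_reduce
        rw [D.unitEmb_tip y]; exact hev)
    filter_upwards [hev'] with u hu
    rcases D.units_cases u with ⟨x, rfl⟩ | ⟨j, w, rfl⟩
    · obtain ⟨h1, h2, h3⟩ := hu
      change x.1 - D.p i = A x.1 (D.φ i x.1) at h1
      change x.1 ∈ D.nbhd i at h2
      have h4 : D.Φ ψ x = (x.1, ‖x.1 - D.p i‖⁻¹ • (x.1 - D.p i)) := h3 (D.Ω₀_subset_closure x.2)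
      rw [unitsToDesing_smooth, h4, Function.comp_apply, unitEmb_smooth,
        D.direction_eq h2.1 h2.2.le, map_smul,
        normalize_pos_smul (inv_pos.2 (D.norm_φ_pos x.2 h2.1)), h1]
    · obtain ⟨-, h2, -⟩ := hu
      rw [unitEmb_tip] at h2
      obtain rfl := D.p_mem_source_iff.1 h2.1
      rw [unitsToDesing_tip, Function.comp_apply, unitEmb_tip]
      beta_reduce
      rw [hA1, ContinuousLinearMap.id_apply, D.norm_of_mem_bdω w.2, inv_one, one_smul]

/-- Near `(p_i, y)`, a point of `∂'Σ(Ω)` over the smooth part determines the direction and the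
radius of `φ_i`. -/
lemma exists_inverse (hψ : D.IsCutoff ψ) (i : Fin D.l) :
    ∃ A : Euc (m + 2) → Euc (m + 2) →L[ℝ] Euc (m + 2),
      ContDiffAt ℝ ∞ A (D.p i) ∧ A (D.p i) = ContinuousLinearMap.id ℝ _ ∧
      ∀ᶠ x in 𝓝 (D.p i), x ∈ D.nbhd i ∧ (x ∈ D.Ω₀ → ‖(D.Φ ψ x).2‖ = 1 ∧
        ‖A x (D.Φ ψ x).2‖⁻¹ • A x (D.Φ ψ x).2 = ‖D.φ i x‖⁻¹ • D.φ i x ∧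
        inner ℝ (x - D.p i) (D.Φ ψ x).2 * ‖A x (D.Φ ψ x).2‖ = ‖D.φ i x‖) := by
  obtain ⟨A, hA, hA1, hA2⟩ := D.exists_φ_factor i
  refine ⟨A, hA, hA1, ?_⟩
  filter_upwards [hA2, (D.isOpen_nbhd i).mem_nhds (D.p_mem_nbhd i), hψ.eventually_Φ_eq i]
    with x h1 h2 h3
  refine ⟨h2, fun hx => ?_⟩
  have hr : 0 < ‖x - D.p i‖ := by
    rw [norm_pos_iff, sub_ne_zero]
    rintro rfl
    exact D.p_notMem_Ω₀ i hx
  rw [h3 (D.Ω₀_subset_closure hx)]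
  refine ⟨?_, ?_, ?_⟩
  · rw [norm_smul, norm_inv, norm_norm, inv_mul_cancel₀ hr.ne']
  · rw [map_smul, normalize_pos_smul (inv_pos.2 hr), ← h1]
  -- The inner product equals `|x - p_i|` and the norm equals `|φ_i(x)| / |x - p_i|`. In this form
  -- the radius is smooth at `p_i`, which `|x - p_i|` alone is not.
  · rw [map_smul, ← h1, norm_smul, norm_inv, norm_norm, real_inner_smul_right,
      real_inner_self_eq_norm_sq]
    field_simp

/-- Away from the conical points `Φ` is continuous on the closure of `Ω`, so limits of its values
are values. Over `p_i` a limit direction is a unit vector; the normalizations of `A` applied to the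
approximating directions lie in the compact set `∂ω_i`, and in the limit `A = I`, so the limit
direction lies in `∂ω_i`. Conversely the tips are limits of points of `Ω₀`. -/
lemma desingBoundary_eq (hψ : D.IsCutoff ψ) :
    D.desingBoundary ψ = range (D.unitsToDesing ψ) := by
  -- Needed twice: with `S = Ω` to find the part of `Σ(Ω)` over `Ω₀`, and with `S = Ω₀` for its
  -- closure.
  have hlift : ∀ S ⊆ closure D.Ω, ∀ z ∈ closure (D.Φ ψ '' S), z.1 ∉ range D.p →
      z.1 ∈ closure D.Ω → z = D.Φ ψ z.1 := by
    intro S hS z hz hzp hzc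
    refine eq_of_mem_closure_of_eqOn (f := id) (g := fun z => D.Φ ψ z.1) hz
      continuousWithinAt_id ?_ ?_
    · refine ContinuousWithinAt.comp (t := closure D.Ω)
        (hψ.contDiffWithinAt_Φ hzc hzp).continuousWithinAt continuousWithinAt_fst ?_
      rintro _ ⟨x, hx, rfl⟩
      exact hS hx
    · rintro _ ⟨x, -, rfl⟩
      rfl
  have hset : {z | z ∈ D.desing ψ ∧ z.1 ∈ D.Ω₀} = D.Φ ψ '' D.Ω₀ := by
    ext z
    constructor
    · rintro ⟨hz, hz0⟩
      exact ⟨z.1, hz0, (hlift _ subset_closure z hz hz0.2 (D.Ω₀_subset_closure hz0)).symm⟩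
    · rintro ⟨x, hx, rfl⟩
      refine ⟨?_, hx⟩
      exact ((hψ.contDiffWithinAt_Φ (D.Ω₀_subset_closure hx) hx.2).continuousWithinAt.mono
        subset_closure).mem_closure_image (D.Ω₀_subset_closure hx)
  have himage : D.Φ ψ '' D.Ω₀ = D.unitsToDesing ψ '' range D.unitsOfSmooth := by
    rw [← range_comp, image_eq_range]
    exact congrArg range (funext fun x => (D.unitsToDesing_smooth x).symm)
  rw [desingBoundary, hset]
  refine subset_antisymm (fun z hz => ?_) ?_
  · have hzf : z.1 ∈ frontier D.Ω := by
      refine isClosed_frontier.closure_subset (map_mem_closure continuous_fst hz ?_)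
      rintro _ ⟨x, hx, rfl⟩
      exact hx.1
    by_cases hzp : z.1 ∈ range D.p
    · obtain ⟨i, hi⟩ := hzp
      obtain ⟨A, hA, hA1, hA2⟩ := hψ.exists_inverse i
      rw [hi] at hA hA1 hA2
      have hev := (continuousAt_fst (p := z)).eventually hA2
      have hne : (𝓝[D.Φ ψ '' D.Ω₀] z).NeBot := mem_closure_iff_nhdsWithin_neBot.1 hz
      have hw : ∀ᶠ w in 𝓝[D.Φ ψ '' D.Ω₀] z, ‖w.2‖ = 1 ∧
          ‖A w.1 w.2‖⁻¹ • A w.1 w.2 ∈ D.bdω i := by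
        filter_upwards [nhdsWithin_le_nhds hev, self_mem_nhdsWithin]
        rintro _ h ⟨x, hx, rfl⟩
        obtain ⟨h1, h2⟩ := h
        obtain ⟨h3, h4, -⟩ := h2 hx
        refine ⟨h3, ?_⟩
        change ‖A x (D.Φ ψ x).2‖⁻¹ • A x (D.Φ ψ x).2 = ‖D.φ i x‖⁻¹ • D.φ i x at h4
        change ‖A x (D.Φ ψ x).2‖⁻¹ • A x (D.Φ ψ x).2 ∈ _
        rw [h4]
        exact D.unit_φ_mem hx h1.1
      have hn : ‖z.2‖ = 1 := by
        have h := (continuous_snd.norm.continuousWithinAt (s := D.Φ ψ '' D.Ω₀) (x := z)).tendsto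
        exact tendsto_nhds_unique h (tendsto_const_nhds.congr' (hw.mono fun w hw => hw.1.symm))
      have hc : ContinuousAt (fun w : Euc (m + 2) × Euc (m + 2) =>
          ‖A w.1 w.2‖⁻¹ • A w.1 w.2) z := by
        refine (contDiffAt_normalize_clm (hA.comp z contDiffAt_fst) contDiffAt_snd ?_).continuousAt
        rw [Function.comp_apply, hA1]
        exact norm_ne_zero_iff.1 (by rw [ContinuousLinearMap.id_apply, hn]; exact one_ne_zero)
      have hb := (D.isCompact_bdω i).isClosed.mem_of_tendsto
        (hc.continuousWithinAt (s := D.Φ ψ '' D.Ω₀)) (hw.mono fun w hw => hw.2)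
      beta_reduce at hb
      rw [hA1, ContinuousLinearMap.id_apply, hn, inv_one, one_smul] at hb
      exact ⟨D.tip i ⟨z.2, hb⟩, by rw [unitsToDesing_tip, hi]⟩
    · refine ⟨D.unitsOfSmooth ⟨z.1, hzf, hzp⟩, ?_⟩
      rw [unitsToDesing_smooth]
      exact (hlift _ D.Ω₀_subset_closure z hz hzp (frontier_subset_closure hzf)).symm
  · rintro _ ⟨u, rfl⟩
    rw [himage]
    refine image_closure_subset_closure_image hψ.contMDiff_unitsToDesing.continuous
      (mem_image_of_mem _ ?_)
    rcases D.units_cases u with ⟨x, rfl⟩ | ⟨i, y, rfl⟩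
    · exact subset_closure ⟨x, rfl⟩
    · exact D.tip_mem_closure y

/-- Near `(p_i, y)` the formulas of `exists_inverse` give direction and radius over `Ω₀`. They are
smooth in both variables and hold at the tips as well, where `A = I` and `z.1 - p_i = 0`; so they
describe the inverse on all of `∂'Σ(Ω)` near this point. -/
lemma contDiffOn_desingInv (hψ : D.IsCutoff ψ) :
    ContDiffOn ℝ ∞ D.desingInv (D.desingBoundary ψ) := by
  rw [hψ.desingBoundary_eq]
  rintro _ ⟨u, rfl⟩
  rcases D.units_cases u with ⟨x, rfl⟩ | ⟨i, y, rfl⟩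
  · rw [unitsToDesing_smooth]
    have hx : (D.Φ ψ x).1 ∉ range D.p := x.2.2
    refine ContDiffAt.contDiffWithinAt ?_
    have h : ContDiffAt ℝ ∞ (fun z : Euc (m + 2) × Euc (m + 2) =>
        (z.1, D.direction z.1, D.radius z.1)) (D.Φ ψ x) :=
      contDiffAt_fst.prodMk (ContDiffAt.prodMk
        (D.contDiffAt_direction hx).fst''
        (D.contDiffAt_radius hx).fst'')
    refine h.congr_of_eventuallyEq ?_
    filter_upwards [(D.isOpen_compl_range_p.preimage continuous_fst).mem_nhds hx] with z hz
    exact if_neg hz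
  · obtain ⟨A, hA, hA1, hA2⟩ := hψ.exists_inverse i
    have hy1 := D.norm_of_mem_bdω y.2
    rw [unitsToDesing_tip]
    have h0 : A (D.p i) y ≠ 0 := by
      rw [hA1]
      exact norm_ne_zero_iff.1 (by rw [ContinuousLinearMap.id_apply, hy1]; exact one_ne_zero)
    have hA' : ContDiffAt ℝ ∞ (fun z : Euc (m + 2) × Euc (m + 2) => A z.1) (D.p i, y.1) :=
      ContDiffAt.comp _ hA contDiffAt_fst
    have h : ContDiffAt ℝ ∞ (fun z : Euc (m + 2) × Euc (m + 2) =>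
        (z.1, ‖A z.1 z.2‖⁻¹ • A z.1 z.2, inner ℝ (z.1 - D.p i) z.2 * ‖A z.1 z.2‖))
        (D.p i, y.1) :=
      contDiffAt_fst.prodMk ((contDiffAt_normalize_clm hA' contDiffAt_snd h0).prodMk
        (((contDiffAt_fst.sub contDiffAt_const).inner ℝ contDiffAt_snd).mul
          ((hA'.clm_apply contDiffAt_snd).norm ℝ h0)))
    have hformula : ∀ᶠ z in 𝓝[range (D.unitsToDesing ψ)] (D.p i, y.1), D.desingInv z =
        (z.1, ‖A z.1 z.2‖⁻¹ • A z.1 z.2, inner ℝ (z.1 - D.p i) z.2 * ‖A z.1 z.2‖) := by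
      filter_upwards [nhdsWithin_le_nhds ((continuousAt_fst (p := (D.p i, y.1))).eventually hA2),
        self_mem_nhdsWithin]
      rintro _ ⟨hn, hz⟩ ⟨u, rfl⟩
      rw [← D.desingInv_unitsToDesing]
      rcases D.units_cases u with ⟨x, rfl⟩ | ⟨j, w, rfl⟩
      · rw [unitsToDesing_smooth] at hn hz ⊢
        change x.1 ∈ D.nbhd i at hn
        obtain ⟨-, h4, h5⟩ := hz x.2
        change ‖A x (D.Φ ψ x).2‖⁻¹ • A x (D.Φ ψ x).2 = ‖D.φ i x‖⁻¹ • D.φ i x at h4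
        change inner ℝ (x.1 - D.p i) (D.Φ ψ x).2 * ‖A x (D.Φ ψ x).2‖ = ‖D.φ i x‖ at h5
        rw [unitEmb_smooth, D.direction_eq hn.1 hn.2.le, D.radius_eq hn.1 hn.2.le, ← h4, ← h5]
        rfl
      · rw [unitsToDesing_tip] at hn ⊢
        obtain rfl := D.p_mem_source_iff.1 hn.1
        rw [unitEmb_tip, hA1, ContinuousLinearMap.id_apply, D.norm_of_mem_bdω w.2, inv_one,
          one_smul, sub_self, inner_zero_left, zero_mul]
    refine h.contDiffWithinAt.congr_of_eventuallyEq hformula ?_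
    exact hformula.self_of_nhdsWithin ⟨D.tip i y, D.unitsToDesing_tip y⟩

lemma isDiffeoOn_unitsToDesing (hψ : D.IsCutoff ψ) :
    IsDiffeoOn (𝓡∂ (m + 1)) 𝓘(ℝ, Euc (m + 2) × Euc (m + 2)) univ (D.desingBoundary ψ)
      (D.unitsToDesing ψ) := by
  refine D.isPatchEmbedding_unitEmb.isDiffeoOn (G := D.desingInv) ?_ ?_
    hψ.contMDiff_unitsToDesing.contMDiffOn hψ.contDiffOn_desingInv.contMDiffOn
    fun u _ => D.desingInv_unitsToDesing u
  · rw [hψ.desingBoundary_eq]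
    exact fun u _ => ⟨u, rfl⟩
  · rw [hψ.desingBoundary_eq]
    rintro _ ⟨u, rfl⟩
    exact ⟨u, mem_univ u, rfl⟩

end IsCutoff

end ConicalDomain

end

theorem proposition4p1 (m : ℕ) (D : ConicalDomain m) :
    ∃ (_ : ChartedSpace (EuclideanHalfSpace (m + 1)) D.Units)
      (_ : ChartedSpace (EuclideanHalfSpace (2 * m + 2)) D.Arrows)
      (_ : IsManifold (𝓡∂ (m + 1)) ∞ D.Units) (_ : IsManifold (𝓡∂ (2 * m + 2)) ∞ D.Arrows),
      -- the smooth structures are the glued ones, and with them `𝒢` is a Lie groupoid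
      D.IsGlued ∧
      D.groupoid.IsLieGroupoid (𝓡∂ (m + 1)) (𝓡∂ (2 * m + 2)) ∧
      -- its space of units `M` is `∂'Σ(Ω)`
      (∀ ψ : Fin D.l → Euc (m + 2) → ℝ, D.IsCutoff ψ →
        ∃ j : D.Units → Euc (m + 2) × Euc (m + 2),
          (∀ x : D.Ω₀, j (D.unitsOfSmooth x) = D.Φ ψ x) ∧
          (∀ i, ∀ y : D.bdω i, j (D.tip i y) = (D.p i, (y : Euc (m + 2)))) ∧
          IsDiffeoOn (𝓡∂ (m + 1)) 𝓘(ℝ, Euc (m + 2) × Euc (m + 2)) univ (D.desingBoundary ψ) j) ∧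
      -- (1) the interior
      (𝓡∂ (m + 1)).interior D.Units = range D.unitsOfSmooth ∧
      D.groupoid.IsInvariant ((𝓡∂ (m + 1)).interior D.Units) ∧
      (∃ c : D.Arrows → D.Units × D.Units,
        D.groupoid.IsIsoOfRestriction (𝓡∂ (m + 1)) (𝓡∂ (2 * m + 2))
          (𝓡∂ (m + 1)) ((𝓡∂ (m + 1)).prod (𝓡∂ (m + 1)))
          (GroupoidData.pair D.Units) ((𝓡∂ (m + 1)).interior D.Units)
          ((𝓡∂ (m + 1)).interior D.Units ×ˢ (𝓡∂ (m + 1)).interior D.Units)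
          ((𝓡∂ (m + 1)).interior D.Units) c id) ∧
      -- (2) the boundary
      (𝓡∂ (m + 1)).boundary D.Units = ⋃ i, range (D.tip i) ∧
      (∀ i, D.groupoid.IsInvariant (range (D.tip i))) ∧
      D.groupoid.IsInvariant ((𝓡∂ (m + 1)).boundary D.Units) ∧
      (∃ (c : D.Arrows → (Euc (m + 2) × Euc (m + 2)) × (ℝ × Euc (m + 2)))
          (c₀ : D.Units → Euc (m + 2) × Euc (m + 2)),
        (∀ i, ∀ y : D.bdω i, c₀ (D.tip i y) = ((y : Euc (m + 2)), D.p i)) ∧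
        D.groupoid.IsIsoOfRestriction (𝓡∂ (m + 1)) (𝓡∂ (2 * m + 2))
          𝓘(ℝ, Euc (m + 2) × Euc (m + 2))
          𝓘(ℝ, (Euc (m + 2) × Euc (m + 2)) × (ℝ × Euc (m + 2)))
          ((GroupoidData.pair (Euc (m + 2))).prod (GroupoidData.multGroupOver (Euc (m + 2))))
          ((𝓡∂ (m + 1)).boundary D.Units)
          (⋃ i, (D.bdω i ×ˢ D.bdω i) ×ˢ (Ioi (0 : ℝ) ×ˢ {D.p i}))
          (⋃ i, D.bdω i ×ˢ {D.p i}) c c₀) ∧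
      -- (3) the Lie algebroid
      ∃ θ : ∀ x : D.Units, D.groupoid.algebroidFibre (𝓡∂ (m + 1)) (𝓡∂ (2 * m + 2)) x ≃ₗ[ℝ]
          bTangentFibre (𝓡∂ (m + 1)) x,
        IsAlgebroidIsoToBTangent (𝓡∂ (m + 1)) (𝓡∂ (2 * m + 2)) D.groupoid θ := by
  refine ⟨inferInstance, inferInstance, inferInstance, inferInstance, D.isGlued,
    D.isBGroupoid.isLieGroupoid,
    fun ψ hψ => ⟨D.unitsToDesing ψ, D.unitsToDesing_smooth, fun i => D.unitsToDesing_tip,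
      hψ.isDiffeoOn_unitsToDesing⟩,
    D.interior_units, D.isInvariant_interior, ⟨_, D.interior_iso⟩, D.boundary_units,
    D.isInvariant_tip, D.isInvariant_boundary, ⟨_, _, fun i y => ?_, D.boundary_iso⟩,
    _, D.isBGroupoid.isAlgebroidIsoToBTangent⟩
  rw [ConicalDomain.unitEmb_tip]
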